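/- Let $(h_n)_{n\ge1}$ be positive numbers with $h_n\to0$, $T_n:=nh_n\to\infty$ and $nh_n^{\kappa}\to0$ for some $\kappa>0$ (for instance $nh_n^2\to0$). **Point process.** Let $\bar{\mathcal N}=(\bar{\mathcal N}^1_t,\bar{\mathcal N}^2_t)_{t\ge0}$ be the counting functions of a pair of point processes on $(0,\infty)$, jointly stationary in the sense that for all $K\in\mathbb N$ and $0\le t_0<\dots<t_K$ the law of $(\bar{\mathcal N}^l_{t+t_k}-\bar{\mathcal N}^l_{t+t_{k-1}})_{1\le k\le K,\,l=1,2}$ does not depend on $t\ge0$, and jointly exponentially $\alpha$-mixing: there are $c_1,c_2>0$ such that $|P(A\cap B)-P(A)P(B)|\le c_1e^{-c_2u}$ for all $s,u\ge0$, all $A$ in the $\sigma$-algebra generated by the increments of $\bar{\mathcal N}^1,\bar{\mathcal N}^2$ over subintervals of $[0,s]$ and all $B$ in the one generated by their increments over subintervals of $[s+u,\infty)$. **Observation times.** For $n\ge1$ and $l\in\{1,2\}$ let $0=S^{n,l}_0<S^{n,l}_1<\dots<S^{n,l}_{M_l}=T_n$ be random times, with $M_l$ a random positive integer (depending on $n$).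 Let $\mathcal N^{n,l}_t=\sum_{i=1}^{M_l}1_{\{S^{n,l}_i\le t\}}$ and assume that, almost surely, $\mathcal N^{n,l}_t=\bar{\mathcal N}^l_{h_n^{-1}t}$ for all $n$, $l$ and $0\le t<T_n$. (Thus the observation times are the rescaled points of $\bar{\mathcal N}^l$ in $(0,T_n)$, together with $0$ and $T_n$.) **Moment and gap conditions.** Assume that for every $q>0$ $$\text{(B1-}q)\quad \sup_{n\ge1}\max_{l}\sup_{0\le t\le(n-1)h_n}E[(\mathcal N^{n,l}_{t+h_n}-\mathcal N^{n,l}_t)^q]<\infty,$$ $$\text{(B2-}q)\quad \limsup_{u\to\infty}\sup_{n\ge1}\max_{l}\sup_{0\le t\le nh_n-uh_n}u^qP(\mathcal N^{n,l}_{t+uh_n}-\mathcal N^{n,l}_t=0)<\infty .$$ **Notation.** Let $I^l_i=(S^{n,l}_{i-1},S^{n,l}_i]$, $r_n=\max_{i,l}|I^l_i|$, $\mathfrak I_l=(|I^l_i|^{1/2})_{i=1}^{M_l}$ and let $G$ be the $M_1\times M_2$ matrix with entries $|I^1_i\cap I^2_j|\,|I^1_i|^{-1/2}|I^2_j|^{-1/2}$.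 Let $\mathfrak S$ be the set of all partitions $0=s_0<s_1<\cdots$ of $[0,\infty)$ with $\sup_k(s_k-s_{k-1})\le1$ and $\inf_k(s_k-s_{k-1})>0$. For $(s_k)\in\mathfrak S$ put $q_n=\max\{k: s_k\le T_n\}$, $M_{l,k}=\#\{i: S^{n,l}_i\in(s_{k-1},s_k]\}$, and let $\mathcal E^l_{(k)}$ be the diagonal $M_l\times M_l$ matrix whose $i$-th diagonal entry is $1$ if $S^{n,l}_i\in(s_{k-1},s_k]$ and $0$ otherwise. **Conclusion.** As $n\to\infty$ the following hold. (A2) $r_n\to0$ in probability. (A4) There exist constants $a_0^1,a_0^2>0$ such that for $l\in\{1,2\}$ and every $(s_k)\in\mathfrak S$ the sequence $(h_nM_{l,q_n+1})_{n\ge1}$ is tight and $\max_{1\le k\le q_n}|h_nM_{l,k}-a_0^l(s_k-s_{k-1})|\to0$ in probability; and for every integer $p\ge1$ there exists a constant $a_p^1\ge0$ such that $\max_{1\le k\le q_n}|h_n\mathrm{tr}(\mathcal E^1_{(k)}(GG^\top)^p)-a_p^1(s_k-s_{k-1})|\to0$ in probability for every $(s_k)\in\mathfrak S$. Moreover, $a_1^1>0$.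 (A5) For every integer $p\ge0$ there exist constants $f_p^{1,1},f_p^{1,2},f_p^{2,2}\ge0$ such that for every $(s_k)\in\mathfrak S$ the following three quantities converge to $0$ in probability: $$\max_{1\le k\le q_n}|\mathfrak I_1^\top\mathcal E^1_{(k)}(GG^\top)^p\mathfrak I_1-f_p^{1,1}(s_k-s_{k-1})|,$$ $$\max_{1\le k\le q_n}|\mathfrak I_1^\top\mathcal E^1_{(k)}(GG^\top)^pG\,\mathfrak I_2-f_p^{1,2}(s_k-s_{k-1})|,$$ $$\max_{1\le k\le q_n}|\mathfrak I_2^\top\mathcal E^2_{(k)}(G^\top G)^p\mathfrak I_2-f_p^{2,2}(s_k-s_{k-1})|.$$ -/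

import Mathlib

open MeasureTheory Filter Set
open scoped ENNReal Topology Matrix

namespace NonsyncSampling

noncomputable section

variable {Ω : Type*} [MeasurableSpace Ω]

/-! ### Two-component point processes on `[0, ∞)`

The two components `l = 1, 2` are indexed by `Fin 2` (`0` for the first, `1` for the second). Only
times `t ≥ 0` matter. -/

/-- `Nbar = (Nbar 0, Nbar 1)` is a pair of point processes on `(0, ∞)`, given by their counting
functions: `Nbar l t ω` is the number of points of the `l`-th component in `(0, t]`. -/
structure IsPointProcess (P : Measure Ω) (Nbar : Fin 2 → ℝ → Ω → ℕ) : Prop where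
  measurable : ∀ l t, 0 ≤ t → Measurable (Nbar l t)
  zero : ∀ᵐ ω ∂P, ∀ l, Nbar l 0 ω = 0
  mono : ∀ᵐ ω ∂P, ∀ l, MonotoneOn (fun t => Nbar l t ω) (Ici 0)
  rightCts : ∀ᵐ ω ∂P, ∀ l t, 0 ≤ t → ContinuousWithinAt (fun t => Nbar l t ω) (Ici t) t

/-- Joint stationarity of the increments of both components: for `0 ≤ τ₀ < ⋯ < τ_K` the law of
`(Nbar l (t + τ_k) - Nbar l (t + τ_{k-1}))_{1 ≤ k ≤ K, l}` does not depend on `t ≥ 0`. -/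
def HasStationaryIncrements (P : Measure Ω) (Nbar : Fin 2 → ℝ → Ω → ℕ) : Prop :=
  ∀ (K : ℕ) (τ : Fin (K + 1) → ℝ), 0 ≤ τ 0 → StrictMono τ → ∀ t : ℝ, 0 ≤ t →
    P.map (fun ω (x : Fin K × Fin 2) =>
        (Nbar x.2 (t + τ x.1.succ) ω : ℤ) - (Nbar x.2 (t + τ x.1.castSucc) ω : ℤ)) =
      P.map (fun ω (x : Fin K × Fin 2) =>
        (Nbar x.2 (τ x.1.succ) ω : ℤ) - (Nbar x.2 (τ x.1.castSucc) ω : ℤ))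

/-- The σ-algebra generated by the increments of both components over subintervals of `I`. -/
abbrev incrementSigma (Nbar : Fin 2 → ℝ → Ω → ℕ) (I : Set ℝ) : MeasurableSpace Ω :=
  ⨆ (l : Fin 2) (s ∈ I) (t ∈ I) (_ : s < t),
    MeasurableSpace.comap (fun ω => (Nbar l t ω : ℤ) - (Nbar l s ω : ℤ)) ⊤

/-- The strong (α-)mixing coefficient at lag `u` of the two-component process `Nbar`. -/
def alphaCoeff (P : Measure Ω) (Nbar : Fin 2 → ℝ → Ω → ℕ) (u : ℝ) : ℝ≥0∞ :=
  ⨆ (s : ℝ) (_ : 0 ≤ s)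
    (A : Set Ω) (_ : MeasurableSet[incrementSigma Nbar (Icc 0 s)] A)
    (B : Set Ω) (_ : MeasurableSet[incrementSigma Nbar (Ici (s + u))] B),
    ENNReal.ofReal |P.real (A ∩ B) - P.real A * P.real B|

/-- Exponential α-mixing. -/
def IsExpAlphaMixing (P : Measure Ω) (Nbar : Fin 2 → ℝ → Ω → ℕ) : Prop :=
  ∃ c₁ c₂ : ℝ, 0 < c₁ ∧ 0 < c₂ ∧
    ∀ u : ℝ, 0 ≤ u → alphaCoeff P Nbar u ≤ ENNReal.ofReal (c₁ * Real.exp (-c₂ * u))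

/-! ### Sampling schemes -/

/-- Random observation times `0 = S_0 < S_1 < ⋯ < S_M = n h_n` for `n ≥ 1` and both components `l`.
`S n l i` is meaningful for `i ≤ M n l` only. -/
structure SamplingScheme (Ω : Type*) [MeasurableSpace Ω] (h : ℕ → ℝ) where
  M : ℕ → Fin 2 → Ω → ℕ
  S : ℕ → Fin 2 → ℕ → Ω → ℝ
  measurable_M : ∀ n l, Measurable (M n l)
  measurable_S : ∀ n l i, Measurable (S n l i)
  M_pos : ∀ n, 1 ≤ n → ∀ l ω, 0 < M n l ω
  S_zero : ∀ n, 1 ≤ n → ∀ l ω, S n l 0 ω = 0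
  S_last : ∀ n, 1 ≤ n → ∀ l ω, S n l (M n l ω) ω = n * h n
  S_lt : ∀ n, 1 ≤ n → ∀ l ω i, i < M n l ω → S n l i ω < S n l (i + 1) ω

namespace SamplingScheme

variable {h : ℕ → ℝ} (D : SamplingScheme Ω h)

/-- The counting process `𝒩^{n,l}_t = ∑_{i=1}^{M_l} 1_{S_i^{n,l} ≤ t}`. -/
def count (n : ℕ) (l : Fin 2) (t : ℝ) (ω : Ω) : ℕ :=
  ∑ i : Fin (D.M n l ω), (Iic t).indicator (fun _ => 1) (D.S n l (i + 1) ω)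

/-- The length `|I_{i+1}^l| = S_{i+1} - S_i` (indices in `Fin M` start at `0`). -/
def len (n : ℕ) (l : Fin 2) (ω : Ω) (i : Fin (D.M n l ω)) : ℝ :=
  D.S n l (i + 1) ω - D.S n l i ω

/-- The mesh `r_n = max_{i,l} |I_i^l|`. -/
def mesh (n : ℕ) (ω : Ω) : ℝ := ⨆ (l : Fin 2) (i : Fin (D.M n l ω)), D.len n l ω i

/-- The matrix `G = (|I_i^1 ∩ I_j^2| / (|I_i^1|^{1/2} |I_j^2|^{1/2}))_{i,j}`. -/
def G (n : ℕ) (ω : Ω) : Matrix (Fin (D.M n 0 ω)) (Fin (D.M n 1 ω)) ℝ :=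
  Matrix.of fun i j =>
    max (min (D.S n 0 (i + 1) ω) (D.S n 1 (j + 1) ω) - max (D.S n 0 i ω) (D.S n 1 j ω)) 0 /
      (√(D.len n 0 ω i) * √(D.len n 1 ω j))

/-- The vector `𝔍_l = (|I_i^l|^{1/2})_i`. -/
def sqrtLen (n : ℕ) (l : Fin 2) (ω : Ω) : Fin (D.M n l ω) → ℝ := fun i => √(D.len n l ω i)

/-- `M_{l,k} = #{i ; S_i ∈ (s_{k-1}, s_k]}`, for `k ≥ 1`. -/
def blockCount (s : ℕ → ℝ) (n : ℕ) (l : Fin 2) (k : ℕ) (ω : Ω) : ℕ :=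
  {i : Fin (D.M n l ω) | D.S n l (i + 1) ω ∈ Ioc (s (k - 1)) (s k)}.ncard

/-- The diagonal matrix `ℰ^l_{(k)}` with `(i,i)` entry `1_{S_i ∈ (s_{k-1}, s_k]}`, for `k ≥ 1`. -/
def blockMatrix (s : ℕ → ℝ) (n : ℕ) (l : Fin 2) (k : ℕ) (ω : Ω) :
    Matrix (Fin (D.M n l ω)) (Fin (D.M n l ω)) ℝ :=
  Matrix.diagonal fun i => (Ioc (s (k - 1)) (s k)).indicator (fun _ => 1) (D.S n l (i + 1) ω)

end SamplingScheme

/-- The class `𝔖` of partitions `0 = s_0 < s_1 < ⋯` of `[0, ∞)` whose cells have length at most `1`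
and bounded away from `0`. -/
def IsPartition (s : ℕ → ℝ) : Prop :=
  s 0 = 0 ∧ (∀ k, s (k + 1) - s k ≤ 1) ∧ ∃ δ : ℝ, 0 < δ ∧ ∀ k, δ ≤ s (k + 1) - s k

/-- `q_n = max {k ; s_k ≤ n h_n}`. -/
def lastIndex (h : ℕ → ℝ) (s : ℕ → ℝ) (n : ℕ) : ℕ := sSup {k : ℕ | s k ≤ n * h n}

/-- `max_{1 ≤ k ≤ q_n} |Y_{n,k} - a (s_k - s_{k-1})| → 0` in probability. -/
def BlockConv (P : Measure Ω) (h s : ℕ → ℝ) (Y : ℕ → ℕ → Ω → ℝ) (a : ℝ) : Prop :=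
  TendstoInMeasure P
    (fun n ω => ⨆ k : Finset.Icc 1 (lastIndex h s n), |Y n k ω - a * (s k - s (k - 1))|)
    atTop (fun _ => 0)

/-- `P`-tightness of the sequence `(Y_n)_{n ≥ 1}`. -/
def IsPTight (P : Measure Ω) (Y : ℕ → Ω → ℝ) : Prop :=
  ∀ ε : ℝ≥0∞, 0 < ε → ∃ K : ℝ, ∀ n, 1 ≤ n → P {ω | K < |Y n ω|} ≤ ε

namespace SamplingScheme

variable {h : ℕ → ℝ} (D : SamplingScheme Ω h)

/-- (B1-`q`). -/
def B1 (P : Measure Ω) (q : ℝ) : Prop :=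
  (⨆ (n : ℕ) (_ : 1 ≤ n) (l : Fin 2) (t ∈ Icc 0 (((n : ℝ) - 1) * h n)),
    ∫⁻ ω, ENNReal.ofReal (((D.count n l (t + h n) ω : ℝ) - D.count n l t ω) ^ q) ∂P) < ∞

/-- (B2-`q`). -/
def B2 (P : Measure Ω) (q : ℝ) : Prop :=
  limsup (fun u : ℝ =>
    ⨆ (n : ℕ) (_ : 1 ≤ n) (l : Fin 2) (t ∈ Icc 0 (n * h n - u * h n)),
      ENNReal.ofReal (u ^ q) * P {ω | D.count n l (t + u * h n) ω - D.count n l t ω = 0})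
    atTop < ∞

/-- (A2). -/
def A2 (P : Measure Ω) : Prop := TendstoInMeasure P D.mesh atTop (fun _ => 0)

/-- (A4), with constants `a₀ l = a_0^l` and `a p = a_p^1` (`p ≥ 1`). -/
def A4 (P : Measure Ω) (a₀ : Fin 2 → ℝ) (a : ℕ → ℝ) : Prop :=
  (∀ l, 0 < a₀ l ∧ ∀ s, IsPartition s →
    IsPTight P (fun n ω => h n * D.blockCount s n l (lastIndex h s n + 1) ω) ∧
    BlockConv P h s (fun n k ω => h n * D.blockCount s n l k ω) (a₀ l)) ∧
  ∀ p : ℕ, 1 ≤ p → 0 ≤ a p ∧ ∀ s, IsPartition s →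
    BlockConv P h s
      (fun n k ω => h n * (D.blockMatrix s n 0 k ω * (D.G n ω * (D.G n ω)ᵀ) ^ p).trace) (a p)

/-- (A5). -/
def A5 (P : Measure Ω) : Prop :=
  ∀ p : ℕ, ∃ f₁₁ f₁₂ f₂₂ : ℝ, 0 ≤ f₁₁ ∧ 0 ≤ f₁₂ ∧ 0 ≤ f₂₂ ∧ ∀ s, IsPartition s →
    BlockConv P h s (fun n k ω => D.sqrtLen n 0 ω ⬝ᵥ
      (D.blockMatrix s n 0 k ω * (D.G n ω * (D.G n ω)ᵀ) ^ p) *ᵥ D.sqrtLen n 0 ω) f₁₁ ∧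
    BlockConv P h s (fun n k ω => D.sqrtLen n 0 ω ⬝ᵥ
      (D.blockMatrix s n 0 k ω * (D.G n ω * (D.G n ω)ᵀ) ^ p * D.G n ω) *ᵥ D.sqrtLen n 1 ω) f₁₂ ∧
    BlockConv P h s (fun n k ω => D.sqrtLen n 1 ω ⬝ᵥ
      (D.blockMatrix s n 1 k ω * ((D.G n ω)ᵀ * D.G n ω) ^ p) *ᵥ D.sqrtLen n 1 ω) f₂₂

/-- The observation times in `(0, n h_n)` are those of `Nbar` after the time change `t ↦ t / h_n`:
`𝒩^{n,l}_t = Nbar^l_{t / h_n}` for `0 ≤ t < n h_n`. The time `t = n h_n` is left out, since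
`n h_n` is always an observation time, whereas `Nbar` need not jump at `n`. -/
def IsRescaling (P : Measure Ω) (Nbar : Fin 2 → ℝ → Ω → ℕ) : Prop :=
  ∀ᵐ ω ∂P, ∀ n, 1 ≤ n → ∀ l, ∀ t ∈ Ico 0 (n * h n), D.count n l t ω = Nbar l (t / h n) ω

end SamplingScheme

end

end NonsyncSampling

namespace NonsyncSampling

noncomputable section

variable {Ω : Type*} [MeasurableSpace Ω]

/-! ### Covariance and exponential moment bounds under strong mixing -/

section Mixing

/-! After dividing time by `h n`, the observation times before the horizon `n` are exactly the
points of `Nbar`, and `G` does not change because overlap ratios are invariant under scaling and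
translation.

(A5) is deterministic up to the mesh. Each component's intervals tile `[0, n h_n]`, so `G` maps the
vector of square-root lengths of the second component to that of the first, and its transpose maps
it back (`G_mulVec_sqrtLen`). All three quadratic forms therefore equal the total length of the
intervals ending in the cell, which is the cell length up to the mesh, and every limit constant is
1. The mesh vanishes by a union bound over a fixed grid: there are of order `n h_n` grid cells, each
empty with probability of order `h_n ^ κ` by (B2-κ).

(A4) is a law of large numbers. The matrix `G Gᵀ` is nonnegative and fixes a positive vector, so
diagonal entries of its powers are at most 1. Keeping only the intervals complete inside a window
then changes the trace over that window by a bounded amount: the walks that are lost must pass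
through one of at most four boundary intervals, and cyclic rotation turns each loss into a diagonal
entry of a matrix with a positive fixed vector (`sum_pow_le_trace_submatrix`, `traceCum_local`).
Hence the trace is a sum of stationary window functionals up to a bounded error per window, and the
means of these are linear in the window length up to a bounded error, which defines `a p`. The
counts are the same situation with no error.

To be uniform over the cells, whose number is of order `n h_n`, deviation probabilities must beat
`n`. `exists_measure_blockSum_le` bounds them by every negative power of `d` for sums of `d ^ 8`
blocks, by truncation, by splitting into widely spaced residue classes, and by a Hoeffding bound
under mixing. Taking `d` of order `h_n ^ (-1/16)`, the assumption `n h_n ^ κ → 0` absorbs the union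
bound, while superblocks remain short compared with a cell.

The constants are positive because the slope dominates the normalized mean over any window, and the
gap bounds make some mean positive. -/

lemma integrableOn_Ioc_meas_le (μ : Measure Ω) [IsFiniteMeasure μ] (V : Ω → ℝ) (b : ℝ) :
    IntegrableOn (fun t => μ.real {ω | t ≤ V ω}) (Ioc 0 b) := by
  have h : Antitone fun t => μ.real {ω | t ≤ V ω} := fun s t hst =>
    measureReal_mono fun ω (hω : t ≤ V ω) => hst.trans hω
  exact ((h.antitoneOn _).integrableOn_isCompact (isCompact_Icc (a := 0) (b := b))).mono_set
    Ioc_subset_Icc_self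

/-- Covariance inequality between an event and a bounded nonnegative variable. -/
lemma abs_setIntegral_sub_le_of_mixing {Ω : Type*} {m₂ m₀ : MeasurableSpace Ω}
    {P : Measure Ω} [IsProbabilityMeasure P] (hm₂ : m₂ ≤ m₀) {A : Set Ω} {α : ℝ}
    (hα : ∀ B, MeasurableSet[m₂] B → |P.real (A ∩ B) - P.real A * P.real B| ≤ α)
    {V : Ω → ℝ} (hV : Measurable[m₂] V) {b : ℝ} (hb : 0 ≤ b) (hV0 : ∀ ω, 0 ≤ V ω)
    (hVb : ∀ ω, V ω ≤ b) :
    |∫ ω in A, V ω ∂P - P.real A * ∫ ω, V ω ∂P| ≤ b * α := by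
  have hVm : Measurable V := hV.mono hm₂ le_rfl
  have hint : Integrable V P :=
    Integrable.of_mem_Icc 0 b hVm.aemeasurable (ae_of_all _ fun ω => ⟨hV0 ω, hVb ω⟩)
  -- Layer cake: both integrals become integrals of tail probabilities over `(0, b]`, and mixing
  -- bounds the difference of the integrands pointwise by `α`.
  rw [hint.restrict.integral_eq_integral_Ioc_meas_le (M := b) (ae_of_all _ hV0) (ae_of_all _ hVb),
    hint.integral_eq_integral_Ioc_meas_le (M := b) (ae_of_all _ hV0) (ae_of_all _ hVb),
    ← integral_const_mul, ← integral_sub (integrableOn_Ioc_meas_le _ _ _)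
      ((integrableOn_Ioc_meas_le _ _ _).const_mul _), ← Real.norm_eq_abs]
  refine (norm_setIntegral_le_of_norm_le_const (μ := volume) (s := Ioc 0 b) (C := α) measure_Ioc_lt_top fun t _ => ?_).trans ?_
  · have hB : MeasurableSet[m₂] {ω | t ≤ V ω} := hV measurableSet_Ici
    have := hα _ hB
    rwa [Real.norm_eq_abs, measureReal_restrict_apply (hm₂ _ hB), inter_comm]
  · rw [Real.volume_real_Ioc_of_le hb, sub_zero, mul_comm]

/-- Covariance inequality for bounded nonnegative variables. -/
lemma abs_integral_mul_sub_le_of_mixing {Ω : Type*} {m₁ m₂ m₀ : MeasurableSpace Ω}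
    {P : Measure Ω} [IsProbabilityMeasure P] (hm₁ : m₁ ≤ m₀) (hm₂ : m₂ ≤ m₀) {α : ℝ}
    (hα : ∀ A B, MeasurableSet[m₁] A → MeasurableSet[m₂] B →
      |P.real (A ∩ B) - P.real A * P.real B| ≤ α)
    {U V : Ω → ℝ} (hU : Measurable[m₁] U) (hV : Measurable[m₂] V) {b₁ b₂ : ℝ} (hb₁ : 0 ≤ b₁)
    (hb₂ : 0 ≤ b₂) (hU0 : ∀ ω, 0 ≤ U ω) (hUb : ∀ ω, U ω ≤ b₁) (hV0 : ∀ ω, 0 ≤ V ω)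
    (hVb : ∀ ω, V ω ≤ b₂) :
    |∫ ω, U ω * V ω ∂P - (∫ ω, U ω ∂P) * ∫ ω, V ω ∂P| ≤ b₁ * b₂ * α := by
  have hUm : Measurable U := hU.mono hm₁ le_rfl
  have hVm : Measurable V := hV.mono hm₂ le_rfl
  have hUi : Integrable U P :=
    Integrable.of_mem_Icc 0 b₁ hUm.aemeasurable (ae_of_all _ fun ω => ⟨hU0 ω, hUb ω⟩)
  have hVi : Integrable V P :=
    Integrable.of_mem_Icc 0 b₂ hVm.aemeasurable (ae_of_all _ fun ω => ⟨hV0 ω, hVb ω⟩)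
  -- Absorbing `V` into the measure turns the mean of `U V` into a mean of `U` alone, so a second
  -- layer cake reduces to events in the first σ-algebra.
  set ν := P.withDensity fun ω => ENNReal.ofReal (V ω) with hν
  have : IsFiniteMeasure ν := isFiniteMeasure_withDensity_ofReal hVi.2
  have hνU : Integrable U ν :=
    Integrable.of_mem_Icc 0 b₁ hUm.aemeasurable (ae_of_all _ fun ω => ⟨hU0 ω, hUb ω⟩)
  have h1 : ∫ ω, U ω * V ω ∂P = ∫ ω, U ω ∂ν := by
    rw [hν, integral_withDensity_eq_integral_toReal_smul (by fun_prop) (by simp)]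
    refine integral_congr_ae (ae_of_all _ fun ω => ?_)
    simp [ENNReal.toReal_ofReal (hV0 ω), mul_comm]
  have hνA : ∀ A, MeasurableSet A → ν.real A = ∫ ω in A, V ω ∂P := by
    intro A hA
    rw [measureReal_def, hν, withDensity_apply _ hA,
      integral_eq_lintegral_of_nonneg_ae (ae_of_all _ hV0) hVm.aestronglyMeasurable]
  rw [h1, hνU.integral_eq_integral_Ioc_meas_le (M := b₁) (ae_of_all _ hU0) (ae_of_all _ hUb),
    hUi.integral_eq_integral_Ioc_meas_le (M := b₁) (ae_of_all _ hU0) (ae_of_all _ hUb),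
    ← integral_mul_const, ← integral_sub (integrableOn_Ioc_meas_le _ _ _)
      ((integrableOn_Ioc_meas_le _ _ _).mul_const _), ← Real.norm_eq_abs]
  refine (norm_setIntegral_le_of_norm_le_const (μ := volume) (s := Ioc 0 b₁) (C := b₂ * α)
    measure_Ioc_lt_top fun t _ => ?_).trans ?_
  · have hA : MeasurableSet[m₁] {ω | t ≤ U ω} := hU measurableSet_Ici
    rw [Real.norm_eq_abs, hνA _ (hm₁ _ hA)]
    exact abs_setIntegral_sub_le_of_mixing hm₂ (fun B hB => hα _ B hA hB) hV hb₂ hV0 hVb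
  · rw [Real.volume_real_Ioc_of_le hb₁]
    exact le_of_eq (by ring)

/-- `F j` contains the past of `X j`, which is measurable with respect to `H j`, and the two
σ-algebras are `α`-mixing. -/
structure IsChainMixing (P : Measure Ω) (X : ℕ → Ω → ℝ) (F H : ℕ → MeasurableSpace Ω)
    (α : ℝ) : Prop where
  F_le : ∀ j, F j ≤ ‹MeasurableSpace Ω›
  H_le : ∀ j, H j ≤ ‹MeasurableSpace Ω›
  past : ∀ i j, i < j → Measurable[F j] (X i)
  present : ∀ j, Measurable[H j] (X j)
  mixing : ∀ j A B, MeasurableSet[F j] A → MeasurableSet[H j] B →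
    |P.real (A ∩ B) - P.real A * P.real B| ≤ α

variable {P : Measure Ω}

/-- Reflection `X ↦ b - X` turns lower tails into upper tails. -/
lemma IsChainMixing.const_sub {X : ℕ → Ω → ℝ} {F H : ℕ → MeasurableSpace Ω} {α : ℝ}
    (h : IsChainMixing P X F H α) (b : ℝ) : IsChainMixing P (fun j ω => b - X j ω) F H α where
  F_le := h.F_le
  H_le := h.H_le
  past i j hij := (h.past i j hij).const_sub b
  present j := (h.present j).const_sub b
  mixing := h.mixing

variable [IsProbabilityMeasure P]

/-- Peel off the last factor: decoupling it from the past costs the product of the two sup bounds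
times `α`, that is `exp (lam * b * (k + 1)) * α`. Earlier costs are multiplied by at most `exp (lam
* b)`, so all `k` of them end up bounded by the same exponential. -/
lemma IsChainMixing.integral_exp_sum_le {X : ℕ → Ω → ℝ} {F H : ℕ → MeasurableSpace Ω} {α : ℝ}
    (h : IsChainMixing P X F H α) {b : ℝ} (hXb : ∀ j ω, X j ω ≤ b) {lam ρ : ℝ} (hlam : 0 ≤ lam)
    (hρ : ∀ j, ∫ ω, Real.exp (lam * X j ω) ∂P ≤ ρ) (k : ℕ) :
    ∫ ω, Real.exp (lam * ∑ j ∈ Finset.range k, X j ω) ∂P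
      ≤ ρ ^ k + k * Real.exp (lam * b * k) * α := by
  have hα : 0 ≤ α := (abs_nonneg _).trans (h.mixing 0 ∅ ∅ (by simp) (by simp))
  have hρ0 : 0 ≤ ρ := (integral_nonneg fun ω => (Real.exp_pos _).le).trans (hρ 0)
  induction k with
  | zero => simp
  | succ k ih =>
    have hSb : ∀ ω, ∑ j ∈ Finset.range k, X j ω ≤ k * b := fun ω => by
      simpa using Finset.sum_le_card_nsmul (Finset.range k) (fun j => X j ω) b
        (fun j _ => hXb j ω)
    have hU : Measurable[F k] fun ω => Real.exp (lam * ∑ j ∈ Finset.range k, X j ω) :=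
      Real.measurable_exp.comp ((Finset.measurable_fun_sum _ fun j hj =>
        h.past j k (Finset.mem_range.1 hj)).const_mul lam)
    have hV : Measurable[H k] fun ω => Real.exp (lam * X k ω) :=
      Real.measurable_exp.comp ((h.present k).const_mul lam)
    have hVb : ∀ ω, Real.exp (lam * X k ω) ≤ Real.exp (lam * b) := fun ω =>
      Real.exp_le_exp.2 (mul_le_mul_of_nonneg_left (hXb k ω) hlam)
    have hcov := abs_integral_mul_sub_le_of_mixing (h.F_le k) (h.H_le k) (h.mixing k) hU hV
      (Real.exp_pos (lam * b * k)).le (Real.exp_pos (lam * b)).le (fun ω => (Real.exp_pos _).le)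
      (fun ω => Real.exp_le_exp.2 (by
        have := mul_le_mul_of_nonneg_left (hSb ω) hlam
        linarith)) (fun ω => (Real.exp_pos _).le) hVb
    have hVle : ∫ ω, Real.exp (lam * X k ω) ∂P ≤ Real.exp (lam * b) := by
      have := integral_mono_of_nonneg (ae_of_all P fun ω => (Real.exp_pos (lam * X k ω)).le)
        (integrable_const (Real.exp (lam * b))) (ae_of_all _ hVb)
      simpa using this
    have hV0 : 0 ≤ ∫ ω, Real.exp (lam * X k ω) ∂P := integral_nonneg fun ω => (Real.exp_pos _).le
    have heq : ∫ ω, Real.exp (lam * ∑ j ∈ Finset.range (k + 1), X j ω) ∂P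
        = ∫ ω, Real.exp (lam * ∑ j ∈ Finset.range k, X j ω) * Real.exp (lam * X k ω) ∂P := by
      refine integral_congr_ae (ae_of_all _ fun ω => ?_)
      simp only [Finset.sum_range_succ, mul_add, Real.exp_add]
    have h1 := (abs_le.1 hcov).2
    have h2 : (∫ ω, Real.exp (lam * ∑ j ∈ Finset.range k, X j ω) ∂P)
        * ∫ ω, Real.exp (lam * X k ω) ∂P
        ≤ ρ ^ k * ρ + k * Real.exp (lam * b * k) * α * Real.exp (lam * b) := by
      refine (mul_le_mul_of_nonneg_right ih hV0).trans ?_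
      rw [add_mul]
      gcongr
      exact hρ k
    rw [heq]
    have hexp : Real.exp (lam * b * ((k + 1 : ℕ) : ℝ))
        = Real.exp (lam * b * k) * Real.exp (lam * b) := by
      rw [← Real.exp_add]; push_cast; ring_nf
    rw [hexp, pow_succ]
    push_cast
    nlinarith [h1, h2]

/-- Hoeffding's lemma, uncentered. -/
lemma integral_exp_le_of_mem_Icc {X : Ω → ℝ} (hX : Measurable X) {b : ℝ} (hb : 0 ≤ b)
    (hX0 : ∀ ω, 0 ≤ X ω) (hXb : ∀ ω, X ω ≤ b) (lam : ℝ) :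
    ∫ ω, Real.exp (lam * X ω) ∂P ≤ Real.exp (lam * ∫ ω, X ω ∂P + lam ^ 2 * b ^ 2 / 8) := by
  have hs := ProbabilityTheory.hasSubgaussianMGF_of_mem_Icc (μ := P) hX.aemeasurable
    (ae_of_all _ fun ω => (⟨hX0 ω, hXb ω⟩ : X ω ∈ Icc 0 b))
  have h1 := hs.mgf_le lam
  have h2 : ∫ ω, Real.exp (lam * X ω) ∂P
      = Real.exp (lam * ∫ ω, X ω ∂P) *
        ProbabilityTheory.mgf (fun ω => X ω - ∫ ω, X ω ∂P) P lam := by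
    rw [ProbabilityTheory.mgf, ← integral_const_mul]
    refine integral_congr_ae (ae_of_all _ fun ω => ?_)
    simp only [← Real.exp_add]
    ring_nf
  rw [h2, Real.exp_add]
  refine mul_le_mul_of_nonneg_left (h1.trans (le_of_eq ?_)) (Real.exp_pos _).le
  congr 1
  simp only [NNReal.coe_pow, NNReal.coe_div, coe_nnnorm, sub_zero, Real.norm_eq_abs, abs_of_nonneg hb]
  push_cast
  ring

/-- One-sided Hoeffding inequality under mixing. -/
lemma IsChainMixing.measure_sum_ge_le {X : ℕ → Ω → ℝ} {F H : ℕ → MeasurableSpace Ω} {α : ℝ}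
    (h : IsChainMixing P X F H α) {b : ℝ} (hb : 0 < b) (hX0 : ∀ j ω, 0 ≤ X j ω)
    (hXb : ∀ j ω, X j ω ≤ b) {μ : ℝ} (hμ : ∀ j, ∫ ω, X j ω ∂P = μ) {ε : ℝ} (hε : 0 ≤ ε) (k : ℕ) :
    P.real {ω | k * (μ + ε) ≤ ∑ j ∈ Finset.range k, X j ω}
      ≤ Real.exp (-(k * ε ^ 2 / (2 * b ^ 2))) + k * Real.exp (k * ε / b) * α := by
  have hα : 0 ≤ α := (abs_nonneg _).trans (h.mixing 0 ∅ ∅ (by simp) (by simp))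
  have hXm : ∀ j, Measurable (X j) := fun j => (h.present j).mono (h.H_le j) le_rfl
  have hμ0 : 0 ≤ μ := by rw [← hμ 0]; exact integral_nonneg fun ω => hX0 0 ω
  -- With this choice the main exponent is `-(7/8) k ε² / b²`, better than required, and the mixing
  -- error grows only like `exp (k ε / b)`.
  set lam := ε / b ^ 2 with hlam
  have hlam0 : 0 ≤ lam := by positivity
  have hSm : Measurable fun ω => ∑ j ∈ Finset.range k, X j ω :=
    Finset.measurable_fun_sum _ fun j _ => hXm j
  have hint : Integrable (fun ω => Real.exp (lam * ∑ j ∈ Finset.range k, X j ω)) P := by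
    refine Integrable.of_mem_Icc 0 (Real.exp (lam * (k * b))) (by fun_prop)
      (ae_of_all _ fun ω => ⟨(Real.exp_pos _).le, Real.exp_le_exp.2 ?_⟩)
    refine mul_le_mul_of_nonneg_left ?_ hlam0
    simpa using Finset.sum_le_card_nsmul (Finset.range k) (fun j => X j ω) b (fun j _ => hXb j ω)
  have h1 := ProbabilityTheory.measure_ge_le_exp_mul_mgf (μ := P)
    (X := fun ω => ∑ j ∈ Finset.range k, X j ω) (k * (μ + ε)) hlam0 hint
  have h2 := h.integral_exp_sum_le hXb hlam0 (fun j =>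
    (integral_exp_le_of_mem_Icc (P := P) (hXm j) hb.le (hX0 j) (hXb j) lam).trans
      (le_of_eq (by rw [hμ j]))) k
  refine h1.trans ?_
  rw [ProbabilityTheory.mgf]
  refine (mul_le_mul_of_nonneg_left h2 (Real.exp_pos _).le).trans ?_
  rw [mul_add]
  refine add_le_add ?_ ?_
  · rw [← Real.exp_nat_mul, ← Real.exp_add, Real.exp_le_exp]
    have hbb : lam * b ^ 2 = ε := by rw [hlam]; field_simp
    have e1 : ε ^ 2 / (2 * b ^ 2) = lam * ε / 2 := by rw [hlam]; field_simp
    have e2 : lam ^ 2 * b ^ 2 = lam * ε := by rw [← hbb]; ring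
    have e3 : (k : ℝ) * ε ^ 2 / (2 * b ^ 2) = k * (lam * ε / 2) := by rw [← e1]; ring
    rw [e3, e2]
    have : 0 ≤ (k : ℝ) * (lam * ε) := by positivity
    nlinarith
  · have e4 : lam * b * k = k * ε / b := by rw [hlam]; field_simp
    rw [e4]
    have : Real.exp (-lam * (k * (μ + ε))) ≤ 1 := by
      rw [Real.exp_le_one_iff]
      have : 0 ≤ lam * (k * (μ + ε)) := by positivity
      linarith
    calc _ ≤ 1 * (k * Real.exp (k * ε / b) * α) := by gcongr
      _ = _ := one_mul _

/-- Two-sided Hoeffding inequality under mixing. -/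
lemma IsChainMixing.measure_abs_sum_ge_le {X : ℕ → Ω → ℝ} {F H : ℕ → MeasurableSpace Ω} {α : ℝ}
    (h : IsChainMixing P X F H α) {b : ℝ} (hb : 0 < b) (hX0 : ∀ j ω, 0 ≤ X j ω)
    (hXb : ∀ j ω, X j ω ≤ b) {μ : ℝ} (hμ : ∀ j, ∫ ω, X j ω ∂P = μ) {ε : ℝ} (hε : 0 ≤ ε) (k : ℕ) :
    P.real {ω | k * ε ≤ |∑ j ∈ Finset.range k, X j ω - k * μ|}
      ≤ 2 * (Real.exp (-(k * ε ^ 2 / (2 * b ^ 2))) + k * Real.exp (k * ε / b) * α) := by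
  have hXm : ∀ j, Measurable (X j) := fun j => (h.present j).mono (h.H_le j) le_rfl
  have h1 := h.measure_sum_ge_le hb hX0 hXb hμ hε k
  have h2 := (h.const_sub b).measure_sum_ge_le hb (fun j ω => sub_nonneg.2 (hXb j ω))
    (fun j ω => by linarith [hX0 j ω]) (μ := b - μ) (fun j => by
      rw [integral_sub (integrable_const _) (Integrable.of_mem_Icc 0 b (hXm j).aemeasurable
        (ae_of_all _ fun ω => ⟨hX0 j ω, hXb j ω⟩)), hμ j]
      simp) hε k
  have hsub : {ω | k * ε ≤ |∑ j ∈ Finset.range k, X j ω - k * μ|}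
      ⊆ {ω | k * (μ + ε) ≤ ∑ j ∈ Finset.range k, X j ω}
        ∪ {ω | k * (b - μ + ε) ≤ ∑ j ∈ Finset.range k, (b - X j ω)} := by
    intro ω hω
    rcases le_abs.1 (show (k : ℝ) * ε ≤ _ from hω) with hω | hω
    · left
      change (k : ℝ) * (μ + ε) ≤ _
      linarith
    · right
      change (k : ℝ) * (b - μ + ε) ≤ _
      simp only [Finset.sum_sub_distrib, Finset.sum_const, Finset.card_range,
        nsmul_eq_mul]
      linarith
  calc _ ≤ _ := measureReal_mono hsub
    _ ≤ _ := measureReal_union_le _ _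
    _ ≤ _ := by linarith

end Mixing

/-! ### A law of large numbers with polynomial rates for block functionals -/

section BlockLLN

lemma incrementSigma_mono {Ω : Type*} {Nbar : Fin 2 → ℝ → Ω → ℕ} {I J : Set ℝ} (h : I ⊆ J) :
    incrementSigma Nbar I ≤ incrementSigma Nbar J :=
  iSup_mono fun _ => iSup₂_le fun s hs => iSup₂_le fun t ht =>
    le_iSup₂_of_le s (h hs) (le_iSup₂_of_le t (h ht) le_rfl)

lemma measurable_increment {Ω : Type*} {Nbar : Fin 2 → ℝ → Ω → ℕ} {I : Set ℝ} (l : Fin 2) {s t : ℝ}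
    (hs : s ∈ I) (ht : t ∈ I) (hst : s ≤ t) :
    Measurable[incrementSigma Nbar I] fun ω => (Nbar l t ω : ℤ) - (Nbar l s ω : ℤ) := by
  rcases hst.eq_or_lt with rfl | hst
  · simp
  · rw [measurable_iff_comap_le]
    exact le_iSup_of_le l (le_iSup₂_of_le s hs (le_iSup₂_of_le t ht (le_iSup_of_le hst le_rfl)))

variable {P : Measure Ω} {Nbar : Fin 2 → ℝ → Ω → ℕ}

lemma IsPointProcess.incrementSigma_le (hN : IsPointProcess P Nbar) {I : Set ℝ} (hI : I ⊆ Ici 0) :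
    incrementSigma Nbar I ≤ ‹MeasurableSpace Ω› := by
  refine iSup_le fun l => iSup₂_le fun s hs => iSup₂_le fun t ht => iSup_le fun _ => ?_
  rw [← measurable_iff_comap_le]
  have h1 := hN.measurable l t (hI ht)
  have h2 := hN.measurable l s (hI hs)
  exact (measurable_from_top.comp h1).sub (measurable_from_top.comp h2)

lemma abs_sub_le_of_alphaCoeff {c₁ c₂ : ℝ} (hc₁ : 0 < c₁)
    (h : ∀ u : ℝ, 0 ≤ u → alphaCoeff P Nbar u ≤ ENNReal.ofReal (c₁ * Real.exp (-c₂ * u)))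
    {s u : ℝ} (hs : 0 ≤ s) (hu : 0 ≤ u) {A B : Set Ω}
    (hA : MeasurableSet[incrementSigma Nbar (Icc 0 s)] A)
    (hB : MeasurableSet[incrementSigma Nbar (Ici (s + u))] B) :
    |P.real (A ∩ B) - P.real A * P.real B| ≤ c₁ * Real.exp (-c₂ * u) := by
  have h1 : ENNReal.ofReal |P.real (A ∩ B) - P.real A * P.real B| ≤ alphaCoeff P Nbar u :=
    le_iSup₂_of_le s hs (le_iSup₂_of_le A hA (le_iSup₂_of_le B hB le_rfl))
  exact (ENNReal.ofReal_le_ofReal_iff (by positivity)).1 (h1.trans (h u hu))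

/-- Regroups a sum by residue classes modulo `g`, so that consecutive terms in a class are `g`
indices apart. -/
lemma sum_range_mul {M : Type*} [AddCommMonoid M] (f : ℕ → M) (g k : ℕ) :
    ∑ b ∈ Finset.range (g * k), f b
      = ∑ r ∈ Finset.range g, ∑ j ∈ Finset.range k, f (r + g * j) := by
  rw [Finset.sum_comm]
  induction k with
  | zero => simp
  | succ k ih =>
    rw [Nat.mul_succ, Finset.sum_range_add, ih, Finset.sum_range_succ]
    simp [add_comm]

lemma pow_mul_exp_neg_le {c : ℝ} (hc : 0 < c) (k : ℕ) {x : ℝ} (hx : 0 ≤ x) :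
    x ^ k * Real.exp (-(c * x)) ≤ k.factorial / c ^ k := by
  have h := Real.pow_div_factorial_le_exp (c * x) (by positivity) k
  rw [div_le_iff₀ (by positivity), mul_pow] at h
  rw [Real.exp_neg, ← div_eq_mul_inv, div_le_div_iff₀ (Real.exp_pos _) (by positivity)]
  linarith

/-- The exponential terms in the block law of large numbers decay faster than any power. -/
lemma exists_exp_terms_le {c₁ c₂ : ℝ} (hc₁ : 0 < c₁) (hc₂ : 0 < c₂) (Q : ℕ) :
    ∃ C : ℝ, ∀ d : ℝ, 1 ≤ d →
      d ^ 4 * (2 * (Real.exp (-(d ^ 4 * (1 / 4) ^ 2 / (2 * d ^ 2)))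
        + d ^ 4 * Real.exp (d ^ 4 * (1 / 4) / d) * (c₁ * Real.exp (-c₂ * (d ^ 4 - 1))))) ≤ C / d ^ Q := by
  -- `K` bounds `(5/4) d³ - c₂ d⁴`, which can be positive only for `d < 5 / (4 c₂)`. The coefficient
  -- is `1/4 + 1`: the growth `d³ / 4` plus the wanted decay exponent `d ≤ d³`.
  set K : ℝ := 5 / 4 * (5 / (4 * c₂)) ^ 3 with hK
  refine ⟨2 * ((Q + 4).factorial / (1 / 32) ^ (Q + 4)
    + c₁ * Real.exp (c₂ + K) * ((Q + 8).factorial / 1 ^ (Q + 8))), fun d hd => ?_⟩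
  have hd0 : 0 < d := by linarith
  rw [le_div_iff₀ (by positivity)]
  have h1 : Real.exp (-(d ^ 4 * (1 / 4) ^ 2 / (2 * d ^ 2))) ≤ Real.exp (-(1 / 32 * d)) := by
    rw [Real.exp_le_exp]
    have e : d ^ 4 * (1 / 4) ^ 2 / (2 * d ^ 2) = 1 / 32 * d ^ 2 := by field_simp; norm_num
    rw [e]
    nlinarith
  have h2 : Real.exp (d ^ 4 * (1 / 4) / d) * Real.exp (-c₂ * (d ^ 4 - 1))
      ≤ Real.exp (c₂ + K) * Real.exp (-(1 * d)) := by
    rw [← Real.exp_add, ← Real.exp_add, Real.exp_le_exp]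
    have e : d ^ 4 * (1 / 4) / d = d ^ 3 / 4 := by field_simp
    rw [e]
    have hd3 : d ≤ d ^ 3 := le_self_pow₀ hd (by norm_num)
    have key : 5 / 4 * d ^ 3 - c₂ * d ^ 4 ≤ K := by
      rcases le_total d (5 / (4 * c₂)) with h | h
      · have h3 : d ^ 3 ≤ (5 / (4 * c₂)) ^ 3 := by gcongr
        have h4 : 0 ≤ c₂ * d ^ 4 := by positivity
        rw [hK]
        linarith
      · have h3 : 5 / 4 ≤ c₂ * d := by
          rw [div_le_iff₀ (by positivity)] at h
          linarith
        have h4 : 5 / 4 * d ^ 3 ≤ c₂ * d * d ^ 3 := by gcongr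
        have h5 : 0 ≤ K := by positivity
        nlinarith
    nlinarith
  have h3 := pow_mul_exp_neg_le (c := 1 / 32) (by norm_num) (Q + 4) hd0.le
  have h4 := pow_mul_exp_neg_le (c := 1) (by norm_num) (Q + 8) hd0.le
  calc _ = 2 * (d ^ (Q + 4) * Real.exp (-(d ^ 4 * (1 / 4) ^ 2 / (2 * d ^ 2)))
        + c₁ * (Real.exp (d ^ 4 * (1 / 4) / d) * Real.exp (-c₂ * (d ^ 4 - 1))) * d ^ (Q + 8)) := by
        ring
    _ ≤ 2 * (d ^ (Q + 4) * Real.exp (-(1 / 32 * d))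
        + c₁ * (Real.exp (c₂ + K) * Real.exp (-(1 * d))) * d ^ (Q + 8)) := by gcongr
    _ = 2 * (d ^ (Q + 4) * Real.exp (-(1 / 32 * d))
        + c₁ * Real.exp (c₂ + K) * (d ^ (Q + 8) * Real.exp (-(1 * d)))) := by ring
    _ ≤ _ := by gcongr

variable [IsProbabilityMeasure P]

/-- Block functionals spaced at distance `g` blocks form a mixing chain. -/
lemma isChainMixing_blocks (hN : IsPointProcess P Nbar) {c₁ c₂ : ℝ} (hc₁ : 0 < c₁)
    (h : ∀ u : ℝ, 0 ≤ u → alphaCoeff P Nbar u ≤ ENNReal.ofReal (c₁ * Real.exp (-c₂ * u)))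
    {ℓ : ℕ} {Z : ℕ → Ω → ℝ}
    (hZ : ∀ b : ℕ, Measurable[incrementSigma Nbar (Icc (b * ℓ : ℝ) ((b + 1) * ℓ))] (Z b))
    (a g : ℕ) (hg : 1 ≤ g) :
    IsChainMixing P (fun j => Z (a + g * j))
      (fun j => Nat.casesOn j ⊥ fun i => incrementSigma Nbar (Icc 0 ((a + g * i + 1 : ℝ) * ℓ)))
      (fun j => incrementSigma Nbar (Ici ((a + g * j : ℝ) * ℓ)))
      (c₁ * Real.exp (-c₂ * ((g - 1) * ℓ))) where
  F_le j := by
    cases j with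
    | zero => exact bot_le
    | succ i => exact hN.incrementSigma_le Icc_subset_Ici_self
  H_le j := hN.incrementSigma_le (Ici_subset_Ici.2 (by positivity))
  past i j hij := by
    obtain ⟨j, rfl⟩ : ∃ k, j = k + 1 := ⟨j - 1, by omega⟩
    refine (hZ (a + g * i)).mono (incrementSigma_mono (Icc_subset_Icc (by positivity) ?_)) le_rfl
    have : (i : ℝ) ≤ j := by exact_mod_cast Nat.lt_succ_iff.1 hij
    push_cast
    gcongr
  present j := by
    refine (hZ (a + g * j)).mono (incrementSigma_mono ?_) le_rfl
    refine Icc_subset_Ici_self.trans (Ici_subset_Ici.2 ?_)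
    push_cast
    exact le_rfl
  mixing j A B hA hB := by
    have hg' : (1 : ℝ) ≤ g := by exact_mod_cast hg
    cases j with
    -- The first block has no past: its past σ-algebra is trivial, and covariances with `∅` and
    -- `univ` vanish.
    | zero =>
      have hA' : A = ∅ ∨ A = univ := MeasurableSpace.measurableSet_bot_iff.1 hA
      rcases hA' with rfl | rfl
      · simp; positivity
      · simp; positivity
    | succ i =>
      have hu : (0 : ℝ) ≤ (g - 1) * ℓ := mul_nonneg (by linarith) (by positivity)
      refine abs_sub_le_of_alphaCoeff hc₁ h (by positivity) hu hA ?_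
      have e : ((a : ℝ) + g * i + 1) * ℓ + (g - 1) * ℓ = (a + g * ((i + 1 : ℕ) : ℝ)) * ℓ := by
        push_cast; ring
      rw [e]
      exact hB

/-- Markov's inequality at order `q`, with the moment carried by a fixed copy so that the bound is
uniform over the blocks. -/
lemma measureReal_lt_le_of_identDistrib {Y Z : Ω → ℝ}
    (hid : ProbabilityTheory.IdentDistrib Y Z P P) (hZ0 : ∀ ω, 0 ≤ Z ω) (q : ℕ)
    (hint : Integrable (fun ω => Z ω ^ q) P) {d : ℝ} (hd : 0 < d) :
    P.real {ω | d < Y ω} ≤ (∫ ω, Z ω ^ q ∂P) / d ^ q := by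
  have h1 : P.real {ω | d < Y ω} = P.real {ω | d < Z ω} := by
    rw [measureReal_def, measureReal_def]
    exact congrArg _ (hid.measure_mem_eq (measurableSet_Ioi (a := d)))
  rw [h1, le_div_iff₀ (by positivity), mul_comm]
  refine le_trans ?_ (mul_meas_ge_le_integral_of_nonneg
    (ae_of_all _ fun ω => pow_nonneg (hZ0 ω) q) hint (d ^ q))
  refine mul_le_mul_of_nonneg_left (measureReal_mono fun ω (hω : d < Z ω) => ?_) (by positivity)
  exact pow_le_pow_left₀ hd.le hω.le q

/-- Law of large numbers for stationary block functionals of an exponentially mixing point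
process, with polynomial rates of every order. -/
theorem exists_measure_blockSum_le (hN : IsPointProcess P Nbar) (hmix : IsExpAlphaMixing P Nbar)
    {ℓ : ℕ} (hℓ : 1 ≤ ℓ) {Z : ℕ → Ω → ℝ}
    (hZ : ∀ b : ℕ, Measurable[incrementSigma Nbar (Icc (b * ℓ : ℝ) ((b + 1) * ℓ))] (Z b))
    (hid : ∀ b, ProbabilityTheory.IdentDistrib (Z b) (Z 0) P P) (hZ0 : ∀ b ω, 0 ≤ Z b ω)
    (hmom : ∀ q : ℕ, Integrable (fun ω => Z 0 ω ^ q) P) (Q : ℕ) :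
    ∃ C : ℝ, ∀ a d : ℕ, 1 ≤ d →
      P.real {ω | (d : ℝ) ^ 8 ≤
        |∑ b ∈ Finset.range (d ^ 8), Z (a + b) ω - (d : ℝ) ^ 8 * ∫ ω, Z 0 ω ∂P|} ≤ C / (d : ℝ) ^ Q := by
  obtain ⟨c₁, c₂, hc₁, hc₂, hα⟩ := hmix
  have hZm : ∀ b, Measurable (Z b) := fun b =>
    (hZ b).mono (hN.incrementSigma_le (Icc_subset_Ici_self.trans
      (Ici_subset_Ici.2 (by positivity)))) le_rfl
  have hint0 : Integrable (Z 0) P := by simpa using hmom 1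
  set μ := ∫ ω, Z 0 ω ∂P with hμ
  have htrunc : Tendsto (fun d : ℕ => ∫ ω, min (Z 0 ω) d ∂P) atTop (𝓝 μ) := by
    refine tendsto_integral_of_dominated_convergence (Z 0)
      (fun d => ((hZm 0).min measurable_const).aestronglyMeasurable) hint0
      (fun d => ae_of_all _ fun ω => ?_) (ae_of_all _ fun ω => ?_)
    · rw [Real.norm_eq_abs, abs_of_nonneg (le_min (hZ0 0 ω) (by positivity))]
      exact min_le_left _ _
    · refine tendsto_const_nhds.congr' ?_
      filter_upwards [eventually_ge_atTop ⌈Z 0 ω⌉₊] with d hd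
      exact (min_eq_left ((Nat.le_ceil _).trans (by exact_mod_cast hd))).symm
  -- From `D` on, truncation at `d` moves the mean by less than `1/4`. Smaller `d` are covered by
  -- the term `D ^ Q` of the constant, which makes the bound at least 1.
  obtain ⟨D, hD⟩ := (Metric.tendsto_atTop.1 htrunc) (1 / 4) (by norm_num)
  obtain ⟨C₁, hC₁⟩ := exists_exp_terms_le hc₁ hc₂ Q
  -- The eight extra moments pay for the union over `d ^ 8` blocks in the event that truncation
  -- matters.
  set K := ∫ ω, Z 0 ω ^ (Q + 8) ∂P with hK
  have hK0 : 0 ≤ K := integral_nonneg fun ω => pow_nonneg (hZ0 0 ω) _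
  have hC₁0 : 0 ≤ C₁ := by
    have := hC₁ 1 le_rfl
    rw [one_pow 4, one_pow Q, div_one C₁] at this
    exact le_trans (by positivity) this
  refine ⟨(D : ℝ) ^ Q + K + C₁, fun a d hd => ?_⟩
  have hd1 : (1 : ℝ) ≤ d := by exact_mod_cast hd
  have hd0 : (0 : ℝ) < d := by linarith
  rcases lt_or_ge d D with hdD | hdD
  · refine measureReal_le_one.trans ?_
    rw [le_div_iff₀ (by positivity), one_mul]
    have : (d : ℝ) ^ Q ≤ (D : ℝ) ^ Q := by gcongr
    linarith
  set μd := ∫ ω, min (Z 0 ω) d ∂P with hμd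
  have hμdμ : |μd - μ| < 1 / 4 := hD d hdD
  -- Class `r` consists of `d ^ 4` truncated blocks spaced `d ^ 4` apart: the mixing decay `exp (-c₂
  -- (d⁴ - 1))` beats the Hoeffding loss `exp (d³ / 4)`.
  let X : ℕ → ℕ → Ω → ℝ := fun r j ω => min (Z (a + r + d ^ 4 * j) ω) d
  have hchain : ∀ r, P.real {ω | ((d ^ 4 : ℕ) : ℝ) * (1 / 4) ≤
      |∑ j ∈ Finset.range (d ^ 4), X r j ω - ((d ^ 4 : ℕ) : ℝ) * μd|}
      ≤ 2 * (Real.exp (-((d : ℝ) ^ 4 * (1 / 4) ^ 2 / (2 * (d : ℝ) ^ 2)))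
        + (d : ℝ) ^ 4 * Real.exp ((d : ℝ) ^ 4 * (1 / 4) / d)
          * (c₁ * Real.exp (-c₂ * ((d : ℝ) ^ 4 - 1)))) := by
    intro r
    have hch := isChainMixing_blocks (Z := fun b ω => min (Z b ω) d) hN hc₁ hα
      (fun b => (hZ b).min measurable_const) (a + r) (d ^ 4) (Nat.one_le_pow _ _ hd)
    have := hch.measure_abs_sum_ge_le hd0 (fun j ω => le_min (hZ0 _ ω) hd0.le)
      (fun j ω => min_le_right _ _) (μ := μd) (fun j => ?_) (ε := 1 / 4) (by norm_num) (d ^ 4)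
    · refine this.trans ?_
      push_cast
      have hℓ' : (1 : ℝ) ≤ ℓ := by exact_mod_cast hℓ
      have hd4 : (0 : ℝ) ≤ (d : ℝ) ^ 4 - 1 := sub_nonneg.2 (one_le_pow₀ hd1)
      have : Real.exp (-c₂ * (((d : ℝ) ^ 4 - 1) * ℓ)) ≤ Real.exp (-c₂ * ((d : ℝ) ^ 4 - 1)) := by
        rw [Real.exp_le_exp]
        have : c₂ * ((d : ℝ) ^ 4 - 1) * 1 ≤ c₂ * ((d : ℝ) ^ 4 - 1) * ℓ := by gcongr
        linarith
      gcongr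
    · exact ((hid _).comp (measurable_id.min measurable_const)).integral_eq
  -- If no block exceeds `d` and every class is within a quarter of its mean per term, the total
  -- error is at most `d ^ 8 / 4` from fluctuations plus `d ^ 8 / 4` from truncation.
  have hsub : {ω | (d : ℝ) ^ 8 ≤ |∑ b ∈ Finset.range (d ^ 8), Z (a + b) ω - (d : ℝ) ^ 8 * μ|}
      ⊆ (⋃ b ∈ Finset.range (d ^ 8), {ω | (d : ℝ) < Z (a + b) ω})
        ∪ ⋃ r ∈ Finset.range (d ^ 4), {ω | ((d ^ 4 : ℕ) : ℝ) * (1 / 4) ≤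
          |∑ j ∈ Finset.range (d ^ 4), X r j ω - ((d ^ 4 : ℕ) : ℝ) * μd|} := by
    intro ω hω
    by_contra hcon
    simp only [mem_union, mem_iUnion, not_or, not_exists] at hcon
    obtain ⟨hA, hB⟩ := hcon
    have hA' : ∀ b ∈ Finset.range (d ^ 8), Z (a + b) ω ≤ d := fun b hb => not_lt.1 (hA b hb)
    have hB' : ∀ r ∈ Finset.range (d ^ 4),
        |∑ j ∈ Finset.range (d ^ 4), X r j ω - ((d ^ 4 : ℕ) : ℝ) * μd|
          ≤ ((d ^ 4 : ℕ) : ℝ) * (1 / 4) := fun r hr => (not_le.1 (hB r hr)).le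
    have e1 : ∑ b ∈ Finset.range (d ^ 8), Z (a + b) ω
        = ∑ r ∈ Finset.range (d ^ 4), ∑ j ∈ Finset.range (d ^ 4), X r j ω := by
      rw [Finset.sum_congr rfl fun b hb => (min_eq_left (hA' b hb)).symm,
        show d ^ 8 = d ^ 4 * d ^ 4 by ring, sum_range_mul]
      simp only [X, add_assoc]
    have e2 : ∑ r ∈ Finset.range (d ^ 4), ∑ j ∈ Finset.range (d ^ 4), X r j ω - (d : ℝ) ^ 8 * μ
        = ∑ r ∈ Finset.range (d ^ 4),
            (∑ j ∈ Finset.range (d ^ 4), X r j ω - ((d ^ 4 : ℕ) : ℝ) * μd)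
          + (d : ℝ) ^ 8 * (μd - μ) := by
      rw [Finset.sum_sub_distrib, Finset.sum_const, Finset.card_range, nsmul_eq_mul]
      push_cast
      ring
    have e3 : |∑ r ∈ Finset.range (d ^ 4),
        (∑ j ∈ Finset.range (d ^ 4), X r j ω - ((d ^ 4 : ℕ) : ℝ) * μd)| ≤ (d : ℝ) ^ 8 * (1 / 4) := by
      refine (Finset.abs_sum_le_sum_abs _ _).trans ((Finset.sum_le_card_nsmul _ _ _ hB').trans ?_)
      rw [Finset.card_range, nsmul_eq_mul]
      push_cast
      exact le_of_eq (by ring)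
    have e4 : |(d : ℝ) ^ 8 * (μd - μ)| ≤ (d : ℝ) ^ 8 * (1 / 4) := by
      rw [abs_mul, abs_of_pos (by positivity : (0 : ℝ) < (d : ℝ) ^ 8)]
      gcongr
    have hω' : (d : ℝ) ^ 8 ≤ |∑ b ∈ Finset.range (d ^ 8), Z (a + b) ω - (d : ℝ) ^ 8 * μ| := hω
    rw [e1, e2] at hω'
    have h8 : (0 : ℝ) < (d : ℝ) ^ 8 := by positivity
    linarith [abs_add_le (∑ r ∈ Finset.range (d ^ 4),
        (∑ j ∈ Finset.range (d ^ 4), X r j ω - ((d ^ 4 : ℕ) : ℝ) * μd)) ((d : ℝ) ^ 8 * (μd - μ))]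
  refine (measureReal_mono hsub).trans ((measureReal_union_le _ _).trans ?_)
  have hb1 : P.real (⋃ b ∈ Finset.range (d ^ 8), {ω | (d : ℝ) < Z (a + b) ω}) ≤ K / (d : ℝ) ^ Q := by
    refine (measureReal_biUnion_finset_le _ _).trans ((Finset.sum_le_card_nsmul _ _ _ fun b _ =>
      measureReal_lt_le_of_identDistrib (hid (a + b)) (hZ0 0) (Q + 8) (hmom _) hd0).trans ?_)
    rw [Finset.card_range, nsmul_eq_mul]
    push_cast
    refine le_of_eq ?_
    rw [← hK, pow_add]
    field_simp
  have hb2 : P.real (⋃ r ∈ Finset.range (d ^ 4), {ω | ((d ^ 4 : ℕ) : ℝ) * (1 / 4) ≤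
      |∑ j ∈ Finset.range (d ^ 4), X r j ω - ((d ^ 4 : ℕ) : ℝ) * μd|}) ≤ C₁ / (d : ℝ) ^ Q := by
    refine (measureReal_biUnion_finset_le _ _).trans ((Finset.sum_le_card_nsmul _ _ _ fun r _ =>
      hchain r).trans ?_)
    rw [Finset.card_range, nsmul_eq_mul]
    push_cast
    exact hC₁ d hd1
  have hD0 : 0 ≤ (D : ℝ) ^ Q / (d : ℝ) ^ Q := by positivity
  calc _ ≤ K / (d : ℝ) ^ Q + C₁ / (d : ℝ) ^ Q := add_le_add hb1 hb2
    _ ≤ _ := by rw [add_div, add_div]; linarith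

end BlockLLN

/-! ### Block convergence of nearly local additive functionals -/

section Abstract

/-- A family `Z ℓ b` of nonnegative functionals of the increments over the window
`[b ℓ, (b + 1) ℓ]`, identically distributed in `b`, with finite moments. -/
structure IsBlockFunctional (P : Measure Ω) (Nbar : Fin 2 → ℝ → Ω → ℕ)
    (Z : ℕ → ℕ → Ω → ℝ) : Prop where
  meas : ∀ ℓ b : ℕ, Measurable[incrementSigma Nbar (Icc (b * ℓ : ℝ) ((b + 1) * ℓ))] (Z ℓ b)
  ident : ∀ ℓ b, ProbabilityTheory.IdentDistrib (Z ℓ b) (Z ℓ 0) P P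
  nonneg : ∀ ℓ b ω, 0 ≤ Z ℓ b ω
  moments : ∀ ℓ q : ℕ, Integrable (fun ω => Z ℓ 0 ω ^ q) P

/-- The number of points in `(b ℓ, (b + 1) ℓ]`. -/
def blockInc (Nbar : Fin 2 → ℝ → Ω → ℕ) (l : Fin 2) (ℓ b : ℕ) (ω : Ω) : ℝ :=
  ((Nbar l ((b + 1) * ℓ) ω - Nbar l (b * ℓ) ω : ℕ) : ℝ)

lemma IsBlockFunctional.integrable {P : Measure Ω} {Nbar : Fin 2 → ℝ → Ω → ℕ}
    {Z : ℕ → ℕ → Ω → ℝ} (hZ : IsBlockFunctional P Nbar Z) (ℓ b : ℕ) : Integrable (Z ℓ b) P :=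
  (hZ.ident ℓ b).integrable_iff.2 (by simpa using hZ.moments ℓ 1)

/-- An almost superadditive and almost subadditive sequence is linear up to a bounded error. -/
lemma exists_linear_of_almost_additive {e : ℕ → ℝ} {C : ℝ} (hC : 0 ≤ C) (he : ∀ ℓ, 0 ≤ e ℓ)
    (h1 : ∀ ℓ k : ℕ, 1 ≤ ℓ → 1 ≤ k → k * e ℓ ≤ e (k * ℓ) + C)
    (h2 : ∀ ℓ k : ℕ, 1 ≤ ℓ → 1 ≤ k → e (k * ℓ) ≤ k * e ℓ + k * C) :
    ∃ a : ℝ, 0 ≤ a ∧ ∀ ℓ : ℕ, 1 ≤ ℓ → e ℓ ≤ a * ℓ ∧ a * ℓ ≤ e ℓ + 2 * C := by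
  -- Compare both `e ℓ` and `e k` with `e` at the common multiple `k ℓ`. The supremum of `e ℓ / ℓ`
  -- then has both required properties.
  have key : ∀ ℓ k : ℕ, 1 ≤ ℓ → 1 ≤ k → e ℓ / ℓ ≤ (e k + 2 * C) / k := by
    intro ℓ k hℓ hk
    have hℓ' : (1 : ℝ) ≤ ℓ := by exact_mod_cast hℓ
    have hk' : (1 : ℝ) ≤ k := by exact_mod_cast hk
    have a1 := h1 ℓ k hℓ hk
    have a2 := h2 k ℓ hk hℓ
    rw [mul_comm ℓ k] at a2
    rw [div_le_div_iff₀ (by linarith) (by linarith)]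
    nlinarith
  have hbdd : BddAbove (range fun ℓ : {ℓ : ℕ // 1 ≤ ℓ} => e ℓ / (ℓ : ℕ)) :=
    ⟨(e 1 + 2 * C) / (1 : ℕ), by rintro _ ⟨ℓ, rfl⟩; exact key ℓ 1 ℓ.2 le_rfl⟩
  have : Nonempty {ℓ : ℕ // 1 ≤ ℓ} := ⟨⟨1, le_rfl⟩⟩
  refine ⟨⨆ ℓ : {ℓ : ℕ // 1 ≤ ℓ}, e ℓ / (ℓ : ℕ),
    Real.iSup_nonneg fun ℓ => div_nonneg (he _) (by positivity), fun k hk => ?_⟩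
  have hk' : (0 : ℝ) < k := by exact_mod_cast hk
  constructor
  · rw [← div_le_iff₀ hk']
    exact le_ciSup hbdd ⟨k, hk⟩
  · rw [← le_div_iff₀ hk']
    exact ciSup_le fun ℓ => key ℓ k ℓ.2 hk

/-- Deterministic control of an additive functional over a cell from its control over a grid. -/
lemma abs_cell_sub_le {F N : ℝ → ℝ} {n : ℕ} {R a ν D : ℝ} (hR : 0 < R) (ha : 0 ≤ a) (hν : 0 ≤ ν)
    (hD : 0 ≤ D)
    (hF : ∀ x y : ℝ, 0 ≤ x → x ≤ y → y ≤ n → 0 ≤ F y - F x ∧ F y - F x ≤ N y - N x + 1)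
    (hN : MonotoneOn N (Ici 0))
    (hblock : ∀ v : ℕ, (v + 1) * R < n → |F ((v + 1) * R) - F (v * R) - a * R| ≤ D)
    (hcount : ∀ v : ℕ, v * R ≤ n → N ((v + 1) * R) - N (v * R) ≤ ν * R)
    {x y : ℝ} (hx : 0 ≤ x) (hxy : x < y) (hy : y ≤ n) :
    |F y - F x - a * (y - x)| ≤ (y - x) / R * D + 2 * (ν * R + 1) + 2 * (a * R) := by
  have hνR : 0 ≤ ν * R := by positivity
  have haR : 0 ≤ a * R := by positivity
  have hyR : 0 < y / R := div_pos (by linarith) hR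
  -- The last grid point `v₁ R` is taken strictly below `y`, hence strictly below `n`, because
  -- `hblock` excludes superblocks reaching the horizon.
  obtain ⟨v₁, hv₁⟩ : ∃ v₁ : ℕ, ⌈y / R⌉₊ = v₁ + 1 :=
    ⟨⌈y / R⌉₊ - 1, by have := Nat.ceil_pos.2 hyR; omega⟩
  have hv₁y : v₁ * R < y := by
    have : (v₁ : ℝ) < y / R := Nat.lt_ceil.1 (by omega)
    rwa [lt_div_iff₀ hR] at this
  have hyv₁ : y ≤ (v₁ + 1) * R := by
    have := Nat.le_ceil (y / R)
    rw [hv₁, div_le_iff₀ hR] at this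
    push_cast at this
    exact this
  have small : ∀ v : ℕ, v * R ≤ n → ∀ u w, v * R ≤ u → u ≤ w → w ≤ (v + 1) * R → w ≤ n →
      0 ≤ F w - F u ∧ F w - F u ≤ ν * R + 1 := by
    intro v hvn u w hu huw hw hwn
    have hv0 : 0 ≤ v * R := by positivity
    have h1 := hF u w (hv0.trans hu) huw hwn
    have h2 := hcount v hvn
    have h3 := hN (mem_Ici.2 hv0) (mem_Ici.2 (hv0.trans hu)) hu
    have h4 := hN (mem_Ici.2 ((hv0.trans hu).trans huw)) (mem_Ici.2
      (((hv0.trans hu).trans huw).trans hw)) hw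
    exact ⟨h1.1, by linarith [h1.2]⟩
  have hright := fun u hu huy => small v₁ (hv₁y.le.trans hy) u y hu huy hyv₁ hy
  set v₀ := ⌈x / R⌉₊ with hv₀
  have hxv₀ : x ≤ v₀ * R := by
    have := Nat.le_ceil (x / R)
    rwa [div_le_iff₀ hR] at this
  have hyx : 0 ≤ (y - x) / R * D := mul_nonneg (div_nonneg (by linarith) hR.le) hD
  -- Either a grid point lies in `[x, y)`, and the cell splits into full superblocks and two end
  -- pieces, or the whole cell sits inside one superblock.
  rcases le_or_gt v₀ v₁ with hle | hlt
  · have hle' : (v₀ : ℝ) ≤ v₁ := by exact_mod_cast hle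
    have hvR : (v₀ : ℝ) * R ≤ v₁ * R := by gcongr
    have hleft : 0 ≤ F (v₀ * R) - F x ∧ F (v₀ * R) - F x ≤ ν * R + 1 ∧ v₀ * R ≤ x + R := by
      rcases Nat.eq_zero_or_pos v₀ with h0 | h0
      · have hx0 : x = 0 := by
          rw [h0] at hxv₀
          simp at hxv₀
          linarith
        rw [h0, hx0]
        simp
        constructor <;> linarith
      · obtain ⟨w, hw⟩ : ∃ w, v₀ = w + 1 := ⟨v₀ - 1, by omega⟩
        have hwx : w * R < x := by
          have : (w : ℝ) < x / R := Nat.lt_ceil.1 (by omega)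
          rwa [lt_div_iff₀ hR] at this
        rw [hw] at hxv₀ hvR ⊢
        push_cast at hxv₀ hvR ⊢
        have := small w (by linarith) x ((w + 1) * R) hwx.le hxv₀ le_rfl (by linarith)
        exact ⟨this.1, this.2, by linarith⟩
    have hr := hright (v₁ * R) le_rfl hv₁y.le
    have hmid : |F (v₁ * R) - F (v₀ * R) - (v₁ - v₀) * (a * R)| ≤ (v₁ - v₀) * D := by
      have e : F (v₁ * R) - F (v₀ * R) - (v₁ - v₀) * (a * R)
          = ∑ v ∈ Finset.Ico v₀ v₁, (F ((v + 1) * R) - F (v * R) - a * R) := by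
        rw [Finset.sum_sub_distrib, Finset.sum_const, Nat.card_Ico, nsmul_eq_mul,
          Nat.cast_sub hle]
        have := Finset.sum_Ico_sub (fun v : ℕ => F (v * R)) hle
        push_cast at this
        rw [this]
      rw [e]
      refine (Finset.abs_sum_le_sum_abs _ _).trans ((Finset.sum_le_card_nsmul _ _ D
        fun v hv => hblock v ?_).trans ?_)
      · have : (v : ℝ) + 1 ≤ v₁ := by exact_mod_cast (Finset.mem_Ico.1 hv).2
        have : ((v : ℝ) + 1) * R ≤ v₁ * R := by gcongr
        linarith
      · rw [Nat.card_Ico, nsmul_eq_mul, Nat.cast_sub hle]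
    have hcard : ((v₁ : ℝ) - v₀) * D ≤ (y - x) / R * D := by
      refine mul_le_mul_of_nonneg_right ?_ hD
      rw [le_div_iff₀ hR]
      linarith
    have hs1 : a * ((y - x) - (v₁ - v₀) * R) ≤ a * (2 * R) :=
      mul_le_mul_of_nonneg_left (by linarith) ha
    have hs2 : 0 ≤ a * ((y - x) - (v₁ - v₀) * R) := mul_nonneg ha (by linarith)
    have hm := abs_le.1 hmid
    rw [abs_le]
    constructor <;> nlinarith [hm.1, hm.2, hleft.1, hleft.2.1, hr.1, hr.2]
  · have hx1 : v₁ * R ≤ x := by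
      have : (v₁ : ℝ) < x / R := Nat.lt_ceil.1 hlt
      rw [lt_div_iff₀ hR] at this
      exact this.le
    have hr := hright x hx1 hxy.le
    have hs1 : a * (y - x) ≤ a * R := mul_le_mul_of_nonneg_left (by linarith) ha
    have hs2 : 0 ≤ a * (y - x) := mul_nonneg ha (by linarith)
    rw [abs_le]
    constructor <;> linarith [hr.1, hr.2]

/-- Superblock sizes adapted to the sampling rate. -/
lemma exists_superblock_scale {h : ℕ → ℝ} (h_pos : ∀ n, 1 ≤ n → 0 < h n)
    (h_zero : Tendsto h atTop (𝓝 0))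
    (h_rate : ∃ κ : ℝ, 0 < κ ∧ Tendsto (fun n : ℕ => n * h n ^ κ) atTop (𝓝 0)) :
    ∃ (d : ℕ → ℕ) (Q : ℕ), (∀ᶠ n in atTop, 1 ≤ d n) ∧
      Tendsto (fun n => h n * (d n : ℝ) ^ 8) atTop (𝓝 0) ∧
      Tendsto (fun n : ℕ => (n + 1 : ℝ) / (d n : ℝ) ^ Q) atTop (𝓝 0) := by
  obtain ⟨κ, hκ, hrate⟩ := h_rate
  have hpos : ∀ᶠ n in atTop, 0 < h n := by
    filter_upwards [eventually_ge_atTop 1] with n hn using h_pos n hn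
  -- With `d = ⌊x⌋`, `h d ^ 8 ≤ h ^ (1/2)`; an exponent `Q ≥ 16 κ` makes `d ^ Q` at least a constant
  -- times `h ^ (-κ)`, the constant coming from `⌊x⌋ ≥ x / 2`.
  set x : ℕ → ℝ := fun n => h n ^ (-(1 / 16) : ℝ) with hx
  have hxtop : Tendsto x atTop atTop :=
    (tendsto_rpow_neg_nhdsGT_zero (by norm_num)).comp
      (tendsto_nhdsWithin_iff.2 ⟨h_zero, hpos⟩)
  have hx2 : ∀ᶠ n in atTop, 2 ≤ x n := hxtop.eventually_ge_atTop 2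
  refine ⟨fun n => ⌊x n⌋₊, ⌈16 * κ⌉₊, ?_, ?_, ?_⟩
  · filter_upwards [hx2] with n hn
    exact Nat.one_le_floor_iff _ |>.2 (by linarith)
  · have hlim : Tendsto (fun n => (x n ^ 8)⁻¹) atTop (𝓝 0) :=
      ((tendsto_pow_atTop (by norm_num)).comp hxtop).inv_tendsto_atTop
    refine squeeze_zero' ?_ ?_ hlim
    · filter_upwards [hpos] with n hn using by positivity
    · filter_upwards [hpos, hx2] with n hn hn2
      have hxh : h n = (x n ^ 16)⁻¹ := by
        rw [hx, ← Real.rpow_natCast, ← Real.rpow_mul hn.le, ← Real.rpow_neg hn.le]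
        norm_num
      have hxpos : 0 < x n := by linarith
      have hfl : ((⌊x n⌋₊ : ℕ) : ℝ) ^ 8 ≤ x n ^ 8 := by
        gcongr
        exact Nat.floor_le hxpos.le
      calc h n * ((⌊x n⌋₊ : ℕ) : ℝ) ^ 8 ≤ (x n ^ 16)⁻¹ * x n ^ 8 := by rw [← hxh]; gcongr
        _ = (x n ^ 8)⁻¹ := by field_simp
  · have hlim : Tendsto (fun n : ℕ => 2 ^ (⌈16 * κ⌉₊ + 1) * (n * h n ^ κ)) atTop (𝓝 0) := by
      simpa using hrate.const_mul (2 ^ (⌈16 * κ⌉₊ + 1) : ℝ)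
    refine squeeze_zero' (Eventually.of_forall fun n => by positivity) ?_ hlim
    filter_upwards [hpos, hx2, eventually_ge_atTop 1] with n hn hn2 hn1
    have hn1' : (1 : ℝ) ≤ n := by exact_mod_cast hn1
    have hxpos : 0 < x n := by linarith
    have hfl : x n / 2 ≤ ((⌊x n⌋₊ : ℕ) : ℝ) := by
      have := Nat.lt_floor_add_one (x n)
      linarith
    have hxκ : (x n ^ ⌈16 * κ⌉₊)⁻¹ ≤ h n ^ κ := by
      have e : h n ^ κ = (x n ^ (16 * κ))⁻¹ := by
        rw [hx, ← Real.rpow_mul hn.le, ← Real.rpow_neg hn.le]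
        ring_nf
      rw [e, ← Real.rpow_natCast]
      refine inv_anti₀ (by positivity) (Real.rpow_le_rpow_of_exponent_le (by linarith)
        (Nat.le_ceil _))
    calc (n + 1 : ℝ) / ((⌊x n⌋₊ : ℕ) : ℝ) ^ ⌈16 * κ⌉₊
        ≤ (2 * n) / (x n / 2) ^ ⌈16 * κ⌉₊ := by gcongr; linarith
      _ = 2 ^ (⌈16 * κ⌉₊ + 1) * (n * (x n ^ ⌈16 * κ⌉₊)⁻¹) := by
        rw [div_pow, pow_succ]; field_simp
      _ ≤ _ := by gcongr

end Abstract

/-! ### Uniform convergence over the cells of a partition. -/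

section AbstractConvergence

variable {P : Measure Ω} {Nbar : Fin 2 → ℝ → Ω → ℕ}

lemma IsPartition.strictMono {s : ℕ → ℝ} (hs : IsPartition s) : StrictMono s := by
  obtain ⟨δ, hδ, h⟩ := hs.2.2
  exact strictMono_nat_of_lt_succ fun k => by linarith [h k]

lemma IsPartition.bddAbove {s : ℕ → ℝ} (hs : IsPartition s) (T : ℝ) :
    BddAbove {k : ℕ | s k ≤ T} := by
  obtain ⟨δ, hδ, h⟩ := hs.2.2
  have hk : ∀ k : ℕ, k * δ ≤ s k := by
    intro k
    induction k with
    | zero => simp [hs.1]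
    | succ k ih => push_cast; linarith [h k]
  refine ⟨⌈T / δ⌉₊, fun k (hkT : s k ≤ T) => ?_⟩
  have : (k : ℝ) ≤ T / δ := by rw [le_div_iff₀ hδ]; exact (hk k).trans hkT
  exact_mod_cast this.trans (Nat.le_ceil _)

lemma IsPartition.lastIndex_spec {h s : ℕ → ℝ} (hs : IsPartition s) {n : ℕ} (hn : 0 ≤ n * h n) :
    s (lastIndex h s n) ≤ n * h n :=
  Nat.sSup_mem ⟨0, by simpa [hs.1] using hn⟩ (hs.bddAbove (n * h n))

lemma IsPartition.lt_lastIndex_succ {h s : ℕ → ℝ} (hs : IsPartition s) (n : ℕ) :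
    n * h n < s (lastIndex h s n + 1) := by
  by_contra hcon
  have := le_csSup (hs.bddAbove (n * h n)) (not_lt.1 hcon)
  exact absurd this (by simp [lastIndex])

/-- Convergence of block functionals from a bound on the cells off events of vanishing
probability. -/
lemma blockConv_of_eventually_bound {h s : ℕ → ℝ} {Y : ℕ → ℕ → Ω → ℝ} {a : ℝ}
    (H : ∀ ε : ℝ, 0 < ε → ∃ E : ℕ → Set Ω, Tendsto (fun n => P (E n)) atTop (𝓝 0) ∧
      ∀ᶠ n in atTop, ∀ ω ∉ E n, ∀ k, 1 ≤ k → k ≤ lastIndex h s n →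
        |Y n k ω - a * (s k - s (k - 1))| ≤ ε) : BlockConv P h s Y a := by
  rw [BlockConv, tendstoInMeasure_iff_norm]
  intro ε hε
  obtain ⟨E, hE, hY⟩ := H (ε / 2) (by linarith)
  refine tendsto_of_tendsto_of_tendsto_of_le_of_le' tendsto_const_nhds hE
    (Eventually.of_forall fun n => zero_le) ?_
  filter_upwards [hY] with n hn
  refine measure_mono fun ω hω => ?_
  by_contra hcon
  have h1 : (⨆ k : Finset.Icc 1 (lastIndex h s n), |Y n k ω - a * (s k - s (k - 1))|) ≤ ε / 2 :=
    Real.iSup_le (fun k => hn ω hcon k (Finset.mem_Icc.1 k.2).1 (Finset.mem_Icc.1 k.2).2)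
      (by linarith)
  have h2 : 0 ≤ ⨆ k : Finset.Icc 1 (lastIndex h s n), |Y n k ω - a * (s k - s (k - 1))| :=
    Real.iSup_nonneg fun k => abs_nonneg _
  have h3 : ε ≤ ‖(⨆ k : Finset.Icc 1 (lastIndex h s n), |Y n k ω - a * (s k - s (k - 1))|) - 0‖ := hω
  rw [sub_zero, Real.norm_of_nonneg h2] at h3
  linarith

variable [IsProbabilityMeasure P]

/-- `F n` is an increasing additive functional, dominated by the counts of the `l`-th component
and approximated by the block functionals `Z` up to a bounded error per block. -/
structure IsNearlyLocal (P : Measure Ω) (Nbar : Fin 2 → ℝ → Ω → ℕ) (l : Fin 2)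
    (F : ℕ → ℝ → Ω → ℝ) (Z : ℕ → ℕ → Ω → ℝ) (C : ℝ) : Prop where
  bound : ∀ᵐ ω ∂P, ∀ n : ℕ, 1 ≤ n → ∀ x y : ℝ, 0 ≤ x → x ≤ y → y ≤ n →
    0 ≤ F n y ω - F n x ω ∧ F n y ω - F n x ω ≤ Nbar l y ω - Nbar l x ω + 1
  local_le : ∀ᵐ ω ∂P, ∀ n : ℕ, 1 ≤ n → ∀ ℓ b : ℕ, 1 ≤ ℓ → ((b : ℝ) + 1) * ℓ < n →
    Z ℓ b ω ≤ F n ((b + 1) * ℓ) ω - F n (b * ℓ) ω ∧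
      F n ((b + 1) * ℓ) ω - F n (b * ℓ) ω ≤ Z ℓ b ω + C

variable {l : Fin 2} {F : ℕ → ℝ → Ω → ℝ} {Z : ℕ → ℕ → Ω → ℝ} {C : ℝ}

/-- One window of length `k ℓ` and the `k` windows of length `ℓ` inside it approximate the same
increment of `F`, with errors `C` and `k C`. Taking means and using stationarity gives an almost
additive sequence. -/
lemma IsNearlyLocal.exists_rate (hF : IsNearlyLocal P Nbar l F Z C)
    (hZ : IsBlockFunctional P Nbar Z) (hC : 0 ≤ C) :
    ∃ a : ℝ, 0 ≤ a ∧ ∀ ℓ : ℕ, 1 ≤ ℓ →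
      ∫ ω, Z ℓ 0 ω ∂P ≤ a * ℓ ∧ a * ℓ ≤ ∫ ω, Z ℓ 0 ω ∂P + 2 * C := by
  have hae : ∀ ℓ k : ℕ, 1 ≤ ℓ → 1 ≤ k → ∀ᵐ ω ∂P,
      ∑ b ∈ Finset.range k, Z ℓ b ω ≤ Z (k * ℓ) 0 ω + C ∧
      Z (k * ℓ) 0 ω ≤ ∑ b ∈ Finset.range k, Z ℓ b ω + k * C := by
    intro ℓ k hℓ hk
    filter_upwards [hF.local_le] with ω hω
    -- The horizon `k ℓ + 1` keeps the window strictly before the final time.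
    have h1 := hω (k * ℓ + 1) (by omega) (k * ℓ) 0 (Nat.mul_pos hk hℓ) (by push_cast; linarith)
    have h2 : ∀ b ∈ Finset.range k, Z ℓ b ω ≤ F (k * ℓ + 1) ((b + 1) * ℓ) ω - F (k * ℓ + 1) (b * ℓ) ω ∧
        F (k * ℓ + 1) ((b + 1) * ℓ) ω - F (k * ℓ + 1) (b * ℓ) ω ≤ Z ℓ b ω + C := by
      intro b hb
      refine hω (k * ℓ + 1) (by omega) ℓ b hℓ ?_
      have : (b : ℝ) + 1 ≤ k := by exact_mod_cast Finset.mem_range.1 hb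
      push_cast
      have : ((b : ℝ) + 1) * ℓ ≤ k * ℓ := by gcongr
      linarith
    have h3 := Finset.sum_range_sub (fun b : ℕ => F (k * ℓ + 1) (b * ℓ) ω) k
    push_cast at h3 h1
    simp only [zero_add, one_mul] at h1
    have h4 := Finset.sum_le_sum fun b hb => (h2 b hb).1
    have h5 := Finset.sum_le_sum fun b hb => (h2 b hb).2
    rw [Finset.sum_add_distrib, Finset.sum_const, Finset.card_range, nsmul_eq_mul] at h5
    rw [h3] at h4 h5
    simp only [zero_mul] at h1 h4 h5
    exact ⟨by linarith, by linarith⟩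
  have hsum : ∀ ℓ k, ∫ ω, ∑ b ∈ Finset.range k, Z ℓ b ω ∂P = k * ∫ ω, Z ℓ 0 ω ∂P := by
    intro ℓ k
    rw [integral_finsetSum _ fun b _ => hZ.integrable ℓ b,
      Finset.sum_congr rfl fun b _ => (hZ.ident ℓ b).integral_eq]
    simp
  have hsi : ∀ ℓ k, Integrable (fun ω => ∑ b ∈ Finset.range k, Z ℓ b ω) P := fun ℓ k =>
    integrable_finsetSum _ fun b _ => hZ.integrable ℓ b
  refine exists_linear_of_almost_additive hC (fun ℓ => integral_nonneg fun ω => hZ.nonneg ℓ 0 ω)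
    (fun ℓ k hℓ hk => ?_) (fun ℓ k hℓ hk => ?_)
  · have := integral_mono_ae (hsi ℓ k) ((hZ.integrable (k * ℓ) 0).add (integrable_const C))
      ((hae ℓ k hℓ hk).mono fun ω h => h.1)
    rw [hsum] at this
    simpa [integral_add (hZ.integrable (k * ℓ) 0) (integrable_const C)] using this
  · have := integral_mono_ae (hZ.integrable (k * ℓ) 0) ((hsi ℓ k).add (integrable_const (k * C)))
      ((hae ℓ k hℓ hk).mono fun ω h => h.2)
    simpa [integral_add (hsi ℓ k) (integrable_const (k * C)), hsum] using this

/-- The superblock sums of `Z` over the horizon `n` all concentrate. -/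
lemma IsBlockFunctional.tendsto_measure_superblocks (hZ : IsBlockFunctional P Nbar Z)
    (hN : IsPointProcess P Nbar) (hmix : IsExpAlphaMixing P Nbar) {ℓ : ℕ} (hℓ : 1 ≤ ℓ)
    {d : ℕ → ℕ} {Q : ℕ} (hd1 : ∀ᶠ n in atTop, 1 ≤ d n)
    (hQ : Tendsto (fun n : ℕ => (n + 1 : ℝ) / (d n : ℝ) ^ Q) atTop (𝓝 0)) :
    Tendsto (fun n => P (⋃ v ∈ Finset.range (n + 1), {ω | (d n : ℝ) ^ 8 ≤
      |∑ b ∈ Finset.range (d n ^ 8), Z ℓ (v * d n ^ 8 + b) ω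
        - (d n : ℝ) ^ 8 * ∫ ω, Z ℓ 0 ω ∂P|})) atTop (𝓝 0) := by
  obtain ⟨C, hC⟩ := exists_measure_blockSum_le hN hmix hℓ (hZ.meas ℓ) (hZ.ident ℓ) (hZ.nonneg ℓ)
    (hZ.moments ℓ) Q
  have hlim : Tendsto (fun n : ℕ => ENNReal.ofReal (C * ((n + 1 : ℝ) / (d n : ℝ) ^ Q))) atTop
      (𝓝 0) := by
    have := ENNReal.tendsto_ofReal (hQ.const_mul C)
    simpa using this
  refine tendsto_of_tendsto_of_tendsto_of_le_of_le' tendsto_const_nhds hlim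
    (Eventually.of_forall fun n => zero_le) ?_
  filter_upwards [hd1] with n hn
  rw [← ofReal_measureReal (measure_ne_top _ _)]
  refine ENNReal.ofReal_le_ofReal ?_
  refine (measureReal_biUnion_finset_le _ _).trans ((Finset.sum_le_card_nsmul _ _ _ fun v _ =>
    hC (v * d n ^ 8) (d n) hn).trans (le_of_eq ?_))
  rw [Finset.card_range, nsmul_eq_mul]
  push_cast
  ring

/-- Nearly local additive functionals obey the law of large numbers uniformly over the cells. -/
theorem IsNearlyLocal.exists_blockConv {h : ℕ → ℝ} (h_pos : ∀ n, 1 ≤ n → 0 < h n)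
    (h_zero : Tendsto h atTop (𝓝 0))
    (h_rate : ∃ κ : ℝ, 0 < κ ∧ Tendsto (fun n : ℕ => n * h n ^ κ) atTop (𝓝 0))
    (hN : IsPointProcess P Nbar) (hmix : IsExpAlphaMixing P Nbar)
    (hI : IsBlockFunctional P Nbar (blockInc Nbar l)) (hZ : IsBlockFunctional P Nbar Z)
    (hC : 0 ≤ C) (hF : IsNearlyLocal P Nbar l F Z C) :
    ∃ a : ℝ, 0 ≤ a ∧ (∀ ℓ : ℕ, 1 ≤ ℓ → ∫ ω, Z ℓ 0 ω ∂P ≤ a * ℓ) ∧ ∀ s, IsPartition s →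
      BlockConv P h s (fun n k ω => h n * (F n (s k / h n) ω - F n (s (k - 1) / h n) ω)) a := by
  obtain ⟨a, ha0, ha⟩ := hF.exists_rate hZ hC
  refine ⟨a, ha0, fun ℓ hℓ => (ha ℓ hℓ).1, fun s hs => blockConv_of_eventually_bound fun ε hε => ?_⟩
  obtain ⟨d, Q, hd1, hd8, hdQ⟩ := exists_superblock_scale h_pos h_zero h_rate
  -- Each block of length `ℓ` contributes an error of at most `3 C + 1`: `C` from locality, `2 C`
  -- from linearity of the means, and 1 from the fluctuations. Long blocks make this at most `ε / 2`
  -- per unit of time.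
  obtain ⟨ℓ, hℓ⟩ : ∃ ℓ : ℕ, 2 * (3 * C + 1) / ε < ℓ := exists_nat_gt _
  have hℓ0 : (0 : ℝ) < ℓ := lt_of_le_of_lt (by positivity) hℓ
  have hℓ1 : 1 ≤ ℓ := by exact_mod_cast hℓ0
  -- On the good event a superblock of `d ^ 8` blocks contains at most `ν d ^ 8` points.
  set ν := ∫ ω, blockInc Nbar l ℓ 0 ω ∂P + 1 with hν
  have hν0 : 0 ≤ ν := add_nonneg (integral_nonneg fun ω => hI.nonneg ℓ 0 ω) zero_le_one
  set bad : ℕ → (ℕ → ℕ → Ω → ℝ) → Set Ω := fun n Z =>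
    ⋃ v ∈ Finset.range (n + 1), {ω | (d n : ℝ) ^ 8 ≤
      |∑ b ∈ Finset.range (d n ^ 8), Z ℓ (v * d n ^ 8 + b) ω
        - (d n : ℝ) ^ 8 * ∫ ω, Z ℓ 0 ω ∂P|} with hbad
  have hae : ∀ᵐ ω ∂P, (∀ n : ℕ, 1 ≤ n → ∀ x y : ℝ, 0 ≤ x → x ≤ y → y ≤ n →
      0 ≤ F n y ω - F n x ω ∧ F n y ω - F n x ω ≤ Nbar l y ω - Nbar l x ω + 1) ∧
      (∀ n : ℕ, 1 ≤ n → ∀ ℓ b : ℕ, 1 ≤ ℓ → ((b : ℝ) + 1) * ℓ < n →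
        Z ℓ b ω ≤ F n ((b + 1) * ℓ) ω - F n (b * ℓ) ω ∧
        F n ((b + 1) * ℓ) ω - F n (b * ℓ) ω ≤ Z ℓ b ω + C) ∧
      MonotoneOn (fun t => Nbar l t ω) (Ici 0) := by
    filter_upwards [hF.bound, hF.local_le, hN.mono] with ω h1 h2 h3 using ⟨h1, h2, h3 l⟩
  rw [ae_iff] at hae
  set null : Set Ω := _ with hnull
  refine ⟨fun n => (bad n Z ∪ bad n (blockInc Nbar l)) ∪ null, ?_, ?_⟩
  · have h1 := (hZ.tendsto_measure_superblocks hN hmix hℓ1 hd1 hdQ).add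
      (hI.tendsto_measure_superblocks hN hmix hℓ1 hd1 hdQ)
    rw [add_zero] at h1
    refine tendsto_of_tendsto_of_tendsto_of_le_of_le tendsto_const_nhds h1
      (fun n => zero_le) fun n => ?_
    refine (measure_union_le _ _).trans ?_
    rw [hae, add_zero]
    exact measure_union_le _ _
  · have hsmall : Tendsto (fun n => 2 * (ν + a) * ℓ * (h n * (d n : ℝ) ^ 8) + 2 * h n) atTop
        (𝓝 0) := by
      simpa using (hd8.const_mul (2 * (ν + a) * ℓ)).add (h_zero.const_mul 2)
    filter_upwards [hd1, hsmall.eventually (gt_mem_nhds (half_pos hε)), eventually_ge_atTop 1]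
      with n hdn hsm hn1 ω hω k hk1 hkq
    simp only [mem_union, not_or] at hω
    obtain ⟨⟨hbZ, hbI⟩, hω0⟩ := hω
    have hω0' := not_not.1 hω0
    obtain ⟨hω1, hω2, hω3⟩ := hω0'
    have hh := h_pos n hn1
    have hd0 : (1 : ℝ) ≤ d n := by exact_mod_cast hdn
    set R : ℝ := ℓ * (d n : ℝ) ^ 8 with hR
    have hR1 : (1 : ℝ) ≤ R := by
      have : (1 : ℝ) ≤ ℓ := by exact_mod_cast hℓ1
      have := one_le_pow₀ (n := 8) hd0
      rw [hR]
      nlinarith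
    have hvn : ∀ v : ℕ, v * R ≤ n → v ∈ Finset.range (n + 1) := by
      intro v hv
      have : (v : ℝ) ≤ n := by nlinarith [(Nat.cast_nonneg v : (0 : ℝ) ≤ v)]
      exact Finset.mem_range.2 (Nat.lt_succ_iff.2 (by exact_mod_cast this))
    have hgood : ∀ Z : ℕ → ℕ → Ω → ℝ, ω ∉ bad n Z → ∀ v : ℕ, v * R ≤ n →
        |∑ b ∈ Finset.range (d n ^ 8), Z ℓ (v * d n ^ 8 + b) ω
          - (d n : ℝ) ^ 8 * ∫ ω, Z ℓ 0 ω ∂P| ≤ (d n : ℝ) ^ 8 := by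
      intro Z hZ v hv
      by_contra hcon
      exact hZ (mem_biUnion (hvn v hv) (not_le.1 hcon).le)
    have hblocksum : ∀ (f : ℝ → ℝ) (v : ℕ), ∑ b ∈ Finset.range (d n ^ 8),
        (f ((((v * d n ^ 8 + b : ℕ) : ℝ) + 1) * ℓ) - f (((v * d n ^ 8 + b : ℕ) : ℝ) * ℓ))
        = f ((v + 1) * R) - f (v * R) := by
      intro f v
      have := Finset.sum_range_sub (fun b : ℕ => f (((v * d n ^ 8 + b : ℕ) : ℝ) * ℓ)) (d n ^ 8)
      convert this using 2
      · push_cast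
        ring_nf
      · rw [hR]; push_cast; ring_nf
      · rw [hR]; push_cast; ring_nf
    have hblock : ∀ v : ℕ, (v + 1) * R < n →
        |F n ((v + 1) * R) ω - F n (v * R) ω - a * R| ≤ (3 * C + 1) * (d n : ℝ) ^ 8 := by
      intro v hv
      have h1 := abs_le.1 (hgood Z hbZ v (by nlinarith))
      have h2 : ∀ b ∈ Finset.range (d n ^ 8), _ := fun b hb =>
        hω2 n hn1 ℓ (v * d n ^ 8 + b) hℓ1 (by
          refine lt_of_le_of_lt ?_ hv
          have : (b : ℝ) + 1 ≤ (d n : ℝ) ^ 8 := by exact_mod_cast Finset.mem_range.1 hb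
          rw [hR]
          push_cast
          nlinarith)
      have h3 := Finset.sum_le_sum fun b hb => (h2 b hb).1
      have h4 := Finset.sum_le_sum fun b hb => (h2 b hb).2
      rw [hblocksum (fun x => F n x ω) v] at h3 h4
      rw [Finset.sum_add_distrib, Finset.sum_const, Finset.card_range, nsmul_eq_mul] at h4
      push_cast at h4
      have h5 := ha ℓ hℓ1
      have hd8 : (0 : ℝ) ≤ (d n : ℝ) ^ 8 := by positivity
      have h6 := mul_le_mul_of_nonneg_left h5.1 hd8
      have h7 := mul_le_mul_of_nonneg_left h5.2 hd8
      have hCd : 0 ≤ C * (d n : ℝ) ^ 8 := by positivity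
      rw [abs_le, hR]
      constructor <;> nlinarith [h1.1, h1.2]
    have hcount : ∀ v : ℕ, v * R ≤ n →
        (Nbar l ((v + 1) * R) ω : ℝ) - Nbar l (v * R) ω ≤ ν * R := by
      intro v hv
      have h1 := abs_le.1 (hgood _ hbI v hv)
      have h2 := hblocksum (fun x => (Nbar l x ω : ℝ)) v
      have h3 : ∑ b ∈ Finset.range (d n ^ 8), blockInc Nbar l ℓ (v * d n ^ 8 + b) ω
          = (Nbar l ((v + 1) * R) ω : ℝ) - Nbar l (v * R) ω := by
        rw [← h2]
        refine Finset.sum_congr rfl fun b _ => ?_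
        rw [blockInc, Nat.cast_sub]
        refine hω3 (mem_Ici.2 (by positivity)) (mem_Ici.2 (by positivity)) ?_
        gcongr
        linarith
      rw [h3] at h1
      have hd8 : (0 : ℝ) ≤ (d n : ℝ) ^ 8 := by positivity
      have : ν * (d n : ℝ) ^ 8 * 1 ≤ ν * (d n : ℝ) ^ 8 * ℓ := by
        gcongr
        exact_mod_cast hℓ1
      rw [hR]
      nlinarith [h1.2]
    have hsk : s (k - 1) < s k := hs.strictMono (by omega)
    have hs0 : 0 ≤ s (k - 1) := by
      have := hs.strictMono.monotone (Nat.zero_le (k - 1))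
      rwa [hs.1] at this
    have hskn : s k ≤ n * h n :=
      (hs.strictMono.monotone hkq).trans (hs.lastIndex_spec (by positivity))
    have hcell := abs_cell_sub_le (F := fun x => F n x ω) (N := fun x => (Nbar l x ω : ℝ))
      (n := n) (by linarith : 0 < R) ha0 hν0 (by positivity) (fun x y => hω1 n hn1 x y)
      (fun x hx y hy hxy => Nat.cast_le.2 (hω3 hx hy hxy)) hblock hcount
      (x := s (k - 1) / h n) (y := s k / h n) (by positivity) (by gcongr)
      (by rwa [div_le_iff₀ hh])
    have hs1 : s k - s (k - 1) ≤ 1 := by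
      have := hs.2.1 (k - 1)
      rwa [Nat.sub_add_cancel hk1] at this
    have e1 : h n * (F n (s k / h n) ω - F n (s (k - 1) / h n) ω) - a * (s k - s (k - 1))
        = h n * (F n (s k / h n) ω - F n (s (k - 1) / h n) ω
          - a * (s k / h n - s (k - 1) / h n)) := by
      field_simp
    have e2 : h n * ((s k / h n - s (k - 1) / h n) / R * ((3 * C + 1) * (d n : ℝ) ^ 8)
        + 2 * (ν * R + 1) + 2 * (a * R))
        = (s k - s (k - 1)) * ((3 * C + 1) / ℓ)
          + (2 * (ν + a) * ℓ * (h n * (d n : ℝ) ^ 8) + 2 * h n) := by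
      have : (d n : ℝ) ≠ 0 := by positivity
      rw [hR]
      field_simp
      ring
    have e3 : (3 * C + 1) / ℓ ≤ ε / 2 := by
      rw [div_lt_iff₀ hε] at hℓ
      rw [div_le_iff₀ hℓ0]
      linarith
    have e4 : (s k - s (k - 1)) * ((3 * C + 1) / ℓ) ≤ 1 * (ε / 2) := by
      gcongr
    rw [e1, abs_mul, abs_of_pos hh]
    calc _ ≤ _ := mul_le_mul_of_nonneg_left hcell hh.le
      _ ≤ ε := by rw [e2]; linarith

end AbstractConvergence

/-! ### Windows of the point process and local trace functionals -/

section Window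

/-- The point `r`, moved into `[0, ℓ]`. -/
def clamp (ℓ : ℕ) (r : ℚ) : ℝ := max 0 (min r ℓ)

lemma clamp_nonneg (ℓ : ℕ) (r : ℚ) : 0 ≤ clamp ℓ r := le_max_left _ _

lemma clamp_le (ℓ : ℕ) (r : ℚ) : clamp ℓ r ≤ ℓ := max_le (by positivity) (min_le_right _ _)

lemma clamp_of_mem {ℓ : ℕ} {r : ℚ} (h0 : 0 ≤ (r : ℝ)) (h1 : (r : ℝ) ≤ ℓ) : clamp ℓ r = r := by
  rw [clamp, min_eq_left h1, max_eq_right h0]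

/-- The increments of both components over the window `[t, t + ℓ]`, read at rational times. -/
def window (Nbar : Fin 2 → ℝ → Ω → ℕ) (ℓ : ℕ) (t : ℝ) (ω : Ω) (x : ℚ × Fin 2) : ℤ :=
  (Nbar x.2 (t + clamp ℓ x.1) ω : ℤ) - (Nbar x.2 t ω : ℤ)

lemma measurable_window {Ω : Type*} (Nbar : Fin 2 → ℝ → Ω → ℕ) (ℓ : ℕ) (t : ℝ) :
    Measurable[incrementSigma Nbar (Icc t (t + ℓ))] fun ω => window (Ω := Ω) Nbar ℓ t ω := by
  refine @measurable_pi_lambda _ _ _ (incrementSigma Nbar (Icc t (t + ℓ))) _ _ fun x => ?_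
  have h0 := clamp_nonneg ℓ x.1
  have h1 := clamp_le ℓ x.1
  exact measurable_increment x.2 ⟨le_rfl, by linarith [(Nat.cast_nonneg ℓ : (0 : ℝ) ≤ ℓ)]⟩
    ⟨by linarith, by linarith⟩ (by linarith)

/-- Recovers increments from the initial time out of consecutive increments, the form in which
stationarity is given. -/
lemma Fin.sum_filter_lt_sub {K : ℕ} (f : Fin (K + 1) → ℤ) (j : Fin (K + 1)) :
    ∑ i : Fin K with i.castSucc < j, (f i.succ - f i.castSucc) = f j - f 0 := by
  induction j using Fin.induction with
  | zero => simp
  | succ j ih =>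
    have : (Finset.univ.filter fun i : Fin K => i.castSucc < j.succ)
        = insert j (Finset.univ.filter fun i : Fin K => i.castSucc < j.castSucc) := by
      ext i
      simp only [Finset.mem_filter, Finset.mem_univ, true_and, Finset.mem_insert, Fin.lt_def,
        Fin.ext_iff, Fin.val_castSucc, Fin.val_succ]
      omega
    rw [this, Finset.sum_insert (by simp), ih]
    ring

/-- The law of a window is determined by its finite marginals, and each of these is a fixed sum map
`g` applied to consecutive increments along the sorted sampling times. -/
lemma HasStationaryIncrements.identDistrib_window {P : Measure Ω} [IsProbabilityMeasure P]
    {Nbar : Fin 2 → ℝ → Ω → ℕ} (hN : IsPointProcess P Nbar)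
    (hstat : HasStationaryIncrements P Nbar) (ℓ : ℕ) {t : ℝ} (ht : 0 ≤ t) :
    ProbabilityTheory.IdentDistrib (window Nbar ℓ t) (window Nbar ℓ 0) P P := by
  have hm : ∀ t, 0 ≤ t → Measurable (window (Ω := Ω) Nbar ℓ t) := fun t ht =>
    (measurable_window Nbar ℓ t).mono (hN.incrementSigma_le
      (Icc_subset_Ici_self.trans (Ici_subset_Ici.2 ht))) le_rfl
  refine (ProbabilityTheory.identDistrib_iff_forall_finset_identDistrib
    (X := fun x ω => window Nbar ℓ t ω x) (Y := fun x ω => window Nbar ℓ 0 ω x)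
    (hm t ht).aemeasurable (hm 0 le_rfl).aemeasurable).2 fun I => ?_
  -- The time 0 is added because a window counts from its left end.
  set S : Finset ℝ := insert 0 (I.image fun x => clamp ℓ x.1) with hS
  have hS0 : (0 : ℝ) ∈ S := Finset.mem_insert_self _ _
  obtain ⟨K, hK⟩ : ∃ K, S.card = K + 1 :=
    ⟨S.card - 1, by have := Finset.card_pos.2 ⟨0, hS0⟩; omega⟩
  set τ := S.orderEmbOfFin hK with hτ
  have hτ0 : τ 0 = 0 := by
    have h1 : 0 ≤ τ 0 := by
      have : τ 0 ∈ S := S.orderEmbOfFin_mem hK 0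
      rcases Finset.mem_insert.1 this with h | h
      · exact h.ge
      · obtain ⟨x, -, hx⟩ := Finset.mem_image.1 h
        rw [← hx]
        exact clamp_nonneg _ _
    obtain ⟨j, hj⟩ : (0 : ℝ) ∈ range τ := by
      rw [hτ, Finset.range_orderEmbOfFin]
      exact hS0
    exact le_antisymm (hj ▸ τ.monotone (Fin.zero_le j)) h1
  have hidx : ∀ x : I, ∃ j, τ j = clamp ℓ x.1.1 := by
    intro x
    have : clamp ℓ x.1.1 ∈ range τ := by
      rw [hτ, Finset.range_orderEmbOfFin]
      exact Finset.mem_insert_of_mem (Finset.mem_image_of_mem _ x.2)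
    exact this
  choose j hj using hidx
  set g : (Fin K × Fin 2 → ℤ) → (I → ℤ) := fun y x =>
    ∑ i : Fin K with i.castSucc < j x, y (i, x.1.2) with hg
  have hgm : Measurable g := measurable_pi_lambda _ fun x =>
    Finset.measurable_fun_sum _ fun i _ => measurable_pi_apply _
  have hcomp : ∀ t, (fun ω => I.restrict (window Nbar ℓ t ω))
      = g ∘ fun ω (x : Fin K × Fin 2) =>
        (Nbar x.2 (t + τ x.1.succ) ω : ℤ) - (Nbar x.2 (t + τ x.1.castSucc) ω : ℤ) := by
    intro t
    ext ω x
    have := Fin.sum_filter_lt_sub (fun i => (Nbar x.1.2 (t + τ i) ω : ℤ)) (j x)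
    simp only [hg, Function.comp_apply, this, Finset.restrict, window, hj, hτ0, add_zero]
  have hincm : ∀ t, 0 ≤ t → Measurable fun ω (x : Fin K × Fin 2) =>
        (Nbar x.2 (t + τ x.1.succ) ω : ℤ) - (Nbar x.2 (t + τ x.1.castSucc) ω : ℤ) := by
    intro t ht
    have hτn : ∀ i, 0 ≤ t + τ i := fun i =>
      add_nonneg ht (hτ0 ▸ τ.monotone (Fin.zero_le i))
    exact measurable_pi_lambda _ fun x =>
      (measurable_from_top.comp (hN.measurable x.2 _ (hτn _))).sub
        (measurable_from_top.comp (hN.measurable x.2 _ (hτn _)))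
  have hmap := hstat K τ hτ0.ge τ.strictMono t ht
  have hid : ProbabilityTheory.IdentDistrib
      (fun ω (x : Fin K × Fin 2) =>
        (Nbar x.2 (t + τ x.1.succ) ω : ℤ) - (Nbar x.2 (t + τ x.1.castSucc) ω : ℤ))
      (fun ω (x : Fin K × Fin 2) =>
        (Nbar x.2 (0 + τ x.1.succ) ω : ℤ) - (Nbar x.2 (0 + τ x.1.castSucc) ω : ℤ)) P P :=
    ⟨(hincm t ht).aemeasurable, (hincm 0 le_rfl).aemeasurable, by simpa only [zero_add] using hmap⟩
  have := hid.comp hgm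
  rw [← hcomp t, ← hcomp 0] at this
  exact this

/-- `|I ∩ J| / (|I|^{1/2} |J|^{1/2})` for `I = (a, b]` and `J = (c, d]`. -/
def overlapRatio (a b c d : ℝ) : ℝ := max (min b d - max a c) 0 / (√(b - a) * √(d - c))

lemma overlapRatio_nonneg (a b c d : ℝ) : 0 ≤ overlapRatio a b c d := by
  unfold overlapRatio
  positivity

/-- This invariance is what lets the entries of `G` be read from a window of `Nbar`, whatever the
value of `h n` and the position of the window. -/
lemma overlapRatio_affine {h : ℝ} (hh : 0 < h) (x a b c d : ℝ) :
    overlapRatio (h * (x + a)) (h * (x + b)) (h * (x + c)) (h * (x + d)) = overlapRatio a b c d := by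
  unfold overlapRatio
  rw [← mul_min_of_nonneg _ _ hh.le, ← mul_max_of_nonneg _ _ hh.le, min_add_add_left,
    max_add_add_left, ← mul_sub, ← mul_sub, ← mul_sub, add_sub_add_left_eq_sub,
    add_sub_add_left_eq_sub, add_sub_add_left_eq_sub, Real.sqrt_mul hh.le, Real.sqrt_mul hh.le]
  have e : max (h * (min b d - max a c)) 0 = h * max (min b d - max a c) 0 := by
    rw [mul_max_of_nonneg _ _ hh.le, mul_zero]
  have e2 : √h * √(b - a) * (√h * √(d - c)) = h * (√(b - a) * √(d - c)) := by
    have := Real.mul_self_sqrt hh.le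
    linear_combination (√(b - a) * √(d - c)) * this
  rw [e, e2, mul_div_mul_left _ _ hh.ne']

/-- The `j`-th point of the `l`-th component in a window. -/
def windowPoint (ℓ : ℕ) (l : Fin 2) (j : ℕ) (c : ℚ × Fin 2 → ℤ) : ℝ :=
  ⨅ r : ℚ, if (j : ℤ) ≤ c (r, l) then clamp ℓ r else ℓ

/-- The number of points of the `l`-th component in a window. -/
def windowCount (ℓ : ℕ) (l : Fin 2) (c : ℚ × Fin 2 → ℤ) : ℕ := (c (ℓ, l)).toNat

lemma measurable_windowPoint (ℓ : ℕ) (l : Fin 2) (j : ℕ) : Measurable (windowPoint ℓ l j) :=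
  Measurable.iInf fun _ => Measurable.ite
    (measurableSet_le measurable_const (measurable_pi_apply _)) measurable_const measurable_const

lemma measurable_windowCount (ℓ : ℕ) (l : Fin 2) : Measurable (windowCount ℓ l) :=
  measurable_from_top.comp (measurable_pi_apply _)

/-- Rational times just above `y` already see `j` points, and none below `y` does. The default value
`ℓ` cannot lower the infimum since `y ≤ ℓ`, and it supplies the case `y = ℓ`. -/
lemma windowPoint_eq {ℓ : ℕ} {l : Fin 2} {j : ℕ} {c : ℚ × Fin 2 → ℤ} {y : ℝ}
    (hy0 : 0 ≤ y) (hyℓ : y ≤ ℓ)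
    (h : ∀ r : ℚ, (j : ℤ) ≤ c (r, l) ↔ y ≤ clamp ℓ r) : windowPoint ℓ l j c = y := by
  refine le_antisymm (le_of_forall_gt_imp_ge_of_dense fun z hz => ?_) (le_ciInf fun r => ?_)
  · have hbdd : BddBelow (range fun r : ℚ => if (j : ℤ) ≤ c (r, l) then clamp ℓ r else (ℓ : ℝ)) :=
      ⟨0, by rintro _ ⟨r, rfl⟩; dsimp only; split_ifs <;> simp [clamp_nonneg]⟩
    rcases hyℓ.eq_or_lt with rfl | hlt
    · exact (ciInf_le hbdd 0).trans ((by split_ifs <;> simp [clamp_le] :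
        (if (j : ℤ) ≤ c (0, l) then clamp ℓ 0 else (ℓ : ℝ)) ≤ ℓ).trans hz.le)
    · obtain ⟨r, hr1, hr2⟩ := exists_rat_btwn (lt_min hz hlt)
      have hc : clamp ℓ r = r := clamp_of_mem (by linarith) (hr2.le.trans (min_le_right _ _))
      refine (ciInf_le hbdd r).trans ?_
      rw [if_pos ((h r).2 (by rw [hc]; exact hr1.le)), hc]
      exact hr2.le.trans (min_le_left _ _)
  · split_ifs with hr
    · exact (h r).1 hr
    · exact hyℓ

/-- The overlap matrix of the first `k₁` and `k₂` complete intervals in a window. -/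
def windowMatrix (ℓ k₁ k₂ : ℕ) (c : ℚ × Fin 2 → ℤ) : Matrix (Fin k₁) (Fin k₂) ℝ :=
  Matrix.of fun i j => overlapRatio (windowPoint ℓ 0 (i + 1) c) (windowPoint ℓ 0 (i + 2) c)
    (windowPoint ℓ 1 (j + 1) c) (windowPoint ℓ 1 (j + 2) c)

/-- The trace functional of the complete intervals in a window. -/
def windowTrace (p ℓ : ℕ) (c : ℚ × Fin 2 → ℤ) : ℝ :=
  ((windowMatrix ℓ (windowCount ℓ 0 c - 1) (windowCount ℓ 1 c - 1) c *
    (windowMatrix ℓ (windowCount ℓ 0 c - 1) (windowCount ℓ 1 c - 1) c)ᵀ) ^ p).trace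

lemma measurable_pow_apply {α ι κ : Type*} [MeasurableSpace α] [Fintype ι] [Fintype κ]
    [DecidableEq ι] {G : α → Matrix ι κ ℝ} (hG : ∀ i j, Measurable fun c => G c i j) (p : ℕ)
    (i i' : ι) : Measurable fun c => ((G c * (G c)ᵀ) ^ p) i i' := by
  induction p generalizing i i' with
  | zero => simp
  | succ p ih =>
    simp only [pow_succ, Matrix.mul_apply, Matrix.transpose_apply]
    exact Finset.measurable_fun_sum _ fun k _ => (ih i k).mul
      (Finset.measurable_fun_sum _ fun j _ => (hG k j).mul (hG i' j))

lemma measurable_windowMatrix_trace (p ℓ k₁ k₂ : ℕ) : Measurable fun c =>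
    ((windowMatrix ℓ k₁ k₂ c * (windowMatrix ℓ k₁ k₂ c)ᵀ) ^ p).trace := by
  simp only [Matrix.trace, Matrix.diag]
  refine Finset.measurable_fun_sum _ fun i _ => measurable_pow_apply (fun i j => ?_) p i i
  have := measurable_windowPoint ℓ 0 (i + 1)
  have := measurable_windowPoint ℓ 0 (i + 2)
  have := measurable_windowPoint ℓ 1 (j + 1)
  have := measurable_windowPoint ℓ 1 (j + 2)
  simp only [windowMatrix, Matrix.of_apply, overlapRatio]
  fun_prop

/-- The size of the matrix is random, so the sizes are made a separate countable parameter and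
measurability is checked for each fixed pair. -/
lemma measurable_windowTrace (p ℓ : ℕ) : Measurable (windowTrace p ℓ) := by
  have h : Measurable fun x : (ℕ × ℕ) × (ℚ × Fin 2 → ℤ) =>
      ((windowMatrix ℓ x.1.1 x.1.2 x.2 * (windowMatrix ℓ x.1.1 x.1.2 x.2)ᵀ) ^ p).trace :=
    measurable_from_prod_countable_right fun k => measurable_windowMatrix_trace p ℓ k.1 k.2
  exact h.comp ((((measurable_windowCount ℓ 0).sub_const 1).prodMk
    ((measurable_windowCount ℓ 1).sub_const 1)).prodMk measurable_id)

end Window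

/-! ### Traces of powers of nonnegative matrices and their submatrices -/

section TraceLoss

variable {m n m' n' : Type*} [Fintype m] [Fintype n] [Fintype m'] [Fintype n']

lemma sum_comp_le_sum {ι κ : Type*} [Fintype ι] [Fintype κ] {e : ι → κ}
    (he : Function.Injective e) {φ : κ → ℝ} (hφ : ∀ k, 0 ≤ φ k) : ∑ i, φ (e i) ≤ ∑ k, φ k := by
  classical
  rw [← Finset.sum_image (s := Finset.univ) (g := e) (f := φ) (he.injOn)]
  exact Finset.sum_le_univ_sum_of_nonneg hφ

/-- Splitting a sum of nonnegative terms along an injection, when the remaining nonzero terms lie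
in `B`. -/
lemma sum_le_sum_comp_add {ι κ : Type*} [Fintype ι] [Fintype κ] {e : ι → κ}
    (he : Function.Injective e) {φ : κ → ℝ} (hφ : ∀ k, 0 ≤ φ k) (B : Finset κ)
    (hB : ∀ k, k ∉ range e → φ k ≠ 0 → k ∈ B) : ∑ k, φ k ≤ ∑ i, φ (e i) + ∑ k ∈ B, φ k := by
  classical
  rw [← Finset.sum_image (s := Finset.univ) (g := e) (f := φ) (he.injOn)]
  rw [← Finset.sum_union_inter]
  refine le_trans (le_of_eq ?_) (le_add_of_nonneg_right (Finset.sum_nonneg fun k _ => hφ k))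
  refine (Finset.sum_subset (Finset.subset_univ _) fun k _ hk => ?_).symm
  by_contra hne
  refine hk (Finset.mem_union.2 ?_)
  by_cases hr : k ∈ range e
  · obtain ⟨i, rfl⟩ := hr
    exact Or.inl (Finset.mem_image_of_mem _ (Finset.mem_univ _))
  · exact Or.inr (hB k hr hne)

lemma mul_nonneg_apply {m n m' : Type*} [Fintype n] {A : Matrix m n ℝ} {B : Matrix n m' ℝ} (hA : ∀ i j, 0 ≤ A i j)
    (hB : ∀ i j, 0 ≤ B i j) (i : m) (j : m') : 0 ≤ (A * B) i j :=
  Finset.sum_nonneg fun k _ => mul_nonneg (hA i k) (hB k j)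

lemma pow_nonneg_apply [DecidableEq m] {A : Matrix m m ℝ} (hA : ∀ i j, 0 ≤ A i j) (p : ℕ)
    (i j : m) : 0 ≤ (A ^ p) i j := by
  induction p generalizing i j with
  | zero => rw [pow_zero, Matrix.one_apply]; split_ifs <;> norm_num
  | succ p ih => rw [pow_succ]; exact mul_nonneg_apply ih hA i j

/-- The term `A i i * v i` is one of the nonnegative summands of `(A v) i = v i`. This replaces any
use of operator norms. -/
lemma diag_le_one_of_mulVec_eq {A : Matrix m m ℝ} (hA : ∀ i j, 0 ≤ A i j) {v : m → ℝ}
    (hv : ∀ i, 0 < v i) (h : A *ᵥ v = v) (i : m) : A i i ≤ 1 := by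
  have h1 : A i i * v i ≤ (A *ᵥ v) i :=
    Finset.single_le_sum (f := fun j => A i j * v j)
      (fun j _ => mul_nonneg (hA i j) (hv j).le) (Finset.mem_univ i)
  rw [h] at h1
  exact le_of_mul_le_mul_right (by linarith) (hv i)

lemma pow_mulVec_eq [DecidableEq m] {A : Matrix m m ℝ} {v : m → ℝ} (h : A *ᵥ v = v) (p : ℕ) :
    (A ^ p) *ᵥ v = v := by
  induction p with
  | zero => simp
  | succ p ih => rw [pow_succ, ← Matrix.mulVec_mulVec, h, ih]

variable [DecidableEq m] [DecidableEq m']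

/-- Entries of powers sum nonnegative weights of walks, and a submatrix keeps only some of the
walks. -/
lemma pow_submatrix_le {G : Matrix m n ℝ} (hG : ∀ i j, 0 ≤ G i j) {e : m' → m} {f : n' → n}
    (he : Function.Injective e) (hf : Function.Injective f) (p : ℕ) (i i' : m') :
    ((G.submatrix e f * (G.submatrix e f)ᵀ) ^ p) i i' ≤ ((G * Gᵀ) ^ p) (e i) (e i') := by
  have hX : ∀ i j, 0 ≤ (G * Gᵀ) i j := mul_nonneg_apply hG fun i j => hG j i
  have h1 : ∀ i i', (G.submatrix e f * (G.submatrix e f)ᵀ) i i' ≤ (G * Gᵀ) (e i) (e i') :=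
    fun i i' => sum_comp_le_sum hf (φ := fun j => G (e i) j * Gᵀ j (e i'))
      fun j => mul_nonneg (hG _ _) (hG _ _)
  induction p generalizing i i' with
  | zero => simp [Matrix.one_apply, he.eq_iff]
  | succ p ih =>
    rw [pow_succ, pow_succ]
    refine le_trans (Finset.sum_le_sum fun k _ => ?_) (sum_comp_le_sum he
      (φ := fun k => ((G * Gᵀ) ^ p) (e i) k * (G * Gᵀ) k (e i'))
      fun k => mul_nonneg (pow_nonneg_apply hX p _ _) (hX _ _))
    exact mul_le_mul (ih i k) (h1 k i') (mul_nonneg_apply (fun _ _ => hG _ _) (fun _ _ => hG _ _) _ _)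
      (pow_nonneg_apply hX p _ _)

lemma trace_submatrix_pow_le {G : Matrix m n ℝ} (hG : ∀ i j, 0 ≤ G i j) {e : m' → m}
    {f : n' → n} (he : Function.Injective e) (hf : Function.Injective f) (p : ℕ) :
    ((G.submatrix e f * (G.submatrix e f)ᵀ) ^ p).trace ≤ ∑ i, ((G * Gᵀ) ^ p) (e i) (e i) :=
  Finset.sum_le_sum fun i _ => pow_submatrix_le hG he hf p i i

/-- Controls the weight of closed walks through a prescribed index `j`: rotated cyclically, they
start and end at `j`, so they are part of a diagonal entry of the full product. -/
lemma sum_submatrix_pow_mul_le {k : Type*} {G : Matrix m n ℝ} (hG : ∀ i j, 0 ≤ G i j)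
    {e : m' → m} {f : n' → n} (he : Function.Injective e) (hf : Function.Injective f)
    (A : Matrix m k ℝ) (B : Matrix k m ℝ) (s : ℕ) (j : k) (hA : ∀ i j, 0 ≤ A i j)
    (hB : ∀ i j, 0 ≤ B i j) :
    ∑ i', ∑ a, ((G.submatrix e f * (G.submatrix e f)ᵀ) ^ s) i' a * (A (e a) j * B j (e i'))
      ≤ (B * (G * Gᵀ) ^ s * A) j j := by
  have hX : ∀ i j, 0 ≤ (G * Gᵀ) i j := mul_nonneg_apply hG fun i j => hG j i
  have hn : ∀ i a, 0 ≤ ((G * Gᵀ) ^ s) i a * (A a j * B j i) := fun i a =>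
    mul_nonneg (pow_nonneg_apply hX s _ _) (mul_nonneg (hA _ _) (hB _ _))
  have h1 : ∑ i', ∑ a, ((G.submatrix e f * (G.submatrix e f)ᵀ) ^ s) i' a
        * (A (e a) j * B j (e i'))
      ≤ ∑ i', ∑ a, ((G * Gᵀ) ^ s) (e i') (e a) * (A (e a) j * B j (e i')) :=
    Finset.sum_le_sum fun i' _ => Finset.sum_le_sum fun a _ =>
      mul_le_mul_of_nonneg_right (pow_submatrix_le hG he hf s i' a)
        (mul_nonneg (hA _ _) (hB _ _))
  have h2 : ∑ i', ∑ a, ((G * Gᵀ) ^ s) (e i') (e a) * (A (e a) j * B j (e i'))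
      ≤ ∑ i, ∑ a, ((G * Gᵀ) ^ s) i a * (A a j * B j i) :=
    (Finset.sum_le_sum fun i' _ => sum_comp_le_sum he
      (φ := fun a => ((G * Gᵀ) ^ s) (e i') a * (A a j * B j (e i'))) (hn _)).trans
    (sum_comp_le_sum he (φ := fun i => ∑ a, ((G * Gᵀ) ^ s) i a * (A a j * B j i))
      fun i => Finset.sum_nonneg fun a _ => hn i a)
  refine h1.trans (h2.trans (le_of_eq ?_))
  rw [Matrix.mul_assoc, Matrix.mul_apply]
  refine Finset.sum_congr rfl fun i _ => ?_
  rw [Matrix.mul_apply, Finset.mul_sum]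
  exact Finset.sum_congr rfl fun a _ => by ring

/-- Passing to a submatrix loses at most one unit of trace per boundary index and step. -/
lemma sum_pow_le_trace_submatrix {G : Matrix m n ℝ} (hG : ∀ i j, 0 ≤ G i j) {u : m → ℝ}
    {v : n → ℝ} (hu : ∀ i, 0 < u i) (hv : ∀ j, 0 < v j) (hGv : G *ᵥ v = u) (hGu : Gᵀ *ᵥ u = v)
    {e : m' → m} {f : n' → n} (he : Function.Injective e) (hf : Function.Injective f)
    (B₁ : Finset m) (B₂ : Finset n)
    (hB₁ : ∀ i j, i ∉ range e → G i (f j) ≠ 0 → i ∈ B₁)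
    (hB₂ : ∀ i j, j ∉ range f → G (e i) j ≠ 0 → j ∈ B₂) (p : ℕ) :
    ∑ i, ((G * Gᵀ) ^ p) (e i) (e i)
      ≤ ((G.submatrix e f * (G.submatrix e f)ᵀ) ^ p).trace + p * (B₁.card + B₂.card) := by
  set X := G * Gᵀ with hX_def
  set Y := G.submatrix e f * (G.submatrix e f)ᵀ with hY_def
  have hX : ∀ i j, 0 ≤ X i j := mul_nonneg_apply hG fun i j => hG j i
  have hY : ∀ i j, 0 ≤ Y i j := mul_nonneg_apply (fun _ _ => hG _ _) (fun _ _ => hG _ _)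
  have hXp := fun p => pow_nonneg_apply hX p
  have hYp := fun p => pow_nonneg_apply hY p
  have hXu : X *ᵥ u = u := by rw [hX_def, ← Matrix.mulVec_mulVec, hGu, hGv]
  have hGT : ∀ i j, 0 ≤ Gᵀ i j := fun i j => hG j i
  -- One factor `G Gᵀ` of a walk starting inside the submatrix either stays inside, or leaves
  -- through a column in `B₂`, or leaves through a row in `B₁`.
  have step : ∀ (r : ℕ) (a : m') (b : m), (X ^ (r + 1)) (e a) b ≤
      ∑ a', Y a a' * (X ^ r) (e a') b
      + ∑ j ∈ B₂, G (e a) j * (Gᵀ * X ^ r) j b + ∑ i ∈ B₁, X (e a) i * (X ^ r) i b := by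
    intro r a b
    have e1 : (X ^ (r + 1)) (e a) b = ∑ j, G (e a) j * (Gᵀ * X ^ r) j b := by
      rw [pow_succ', hX_def, Matrix.mul_assoc, Matrix.mul_apply]
    have e2 := sum_le_sum_comp_add hf (φ := fun j => G (e a) j * (Gᵀ * X ^ r) j b)
      (fun j => mul_nonneg (hG _ _) (mul_nonneg_apply hGT (hXp r) _ _)) B₂
      (fun j hj hne => hB₂ a j hj (left_ne_zero_of_mul hne))
    have e3 : ∀ j', G (e a) (f j') * (Gᵀ * X ^ r) (f j') b
        ≤ ∑ a', G (e a) (f j') * (G (e a') (f j') * (X ^ r) (e a') b)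
          + ∑ i ∈ B₁, G (e a) (f j') * (G i (f j') * (X ^ r) i b) := by
      intro j'
      rw [← Finset.mul_sum, ← Finset.mul_sum, ← mul_add]
      refine mul_le_mul_of_nonneg_left ?_ (hG _ _)
      exact sum_le_sum_comp_add he (φ := fun i => G i (f j') * (X ^ r) i b)
        (fun i => mul_nonneg (hG _ _) (hXp r _ _)) B₁
        (fun i hi hne => hB₁ i j' hi (left_ne_zero_of_mul hne))
    have e4 : ∑ j', ∑ a', G (e a) (f j') * (G (e a') (f j') * (X ^ r) (e a') b)
        = ∑ a', Y a a' * (X ^ r) (e a') b := by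
      rw [Finset.sum_comm]
      refine Finset.sum_congr rfl fun a' _ => ?_
      rw [hY_def, Matrix.mul_apply, Finset.sum_mul]
      exact Finset.sum_congr rfl fun j' _ => (mul_assoc _ _ _).symm
    have e5 : ∑ j', ∑ i ∈ B₁, G (e a) (f j') * (G i (f j') * (X ^ r) i b)
        ≤ ∑ i ∈ B₁, X (e a) i * (X ^ r) i b := by
      rw [Finset.sum_comm]
      refine Finset.sum_le_sum fun i _ => ?_
      simp only [← mul_assoc]
      rw [← Finset.sum_mul]
      refine mul_le_mul_of_nonneg_right ?_ (hXp r _ _)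
      exact sum_comp_le_sum hf (φ := fun j => G (e a) j * Gᵀ j i)
        fun j => mul_nonneg (hG _ _) (hG _ _)
    have e6 := Finset.sum_le_sum fun j' (_ : j' ∈ Finset.univ) => e3 j'
    rw [Finset.sum_add_distrib, e4] at e6
    rw [e1]
    linarith
  -- `T s r` takes `s` steps in the submatrix and `r` in the full matrix, interpolating between the
  -- two sides of the claim.
  set T : ℕ → ℕ → ℝ := fun s r => ∑ i', ∑ a, (Y ^ s) i' a * (X ^ r) (e a) (e i') with hT
  have hstep : ∀ s r, T s (r + 1) ≤ T (s + 1) r + (B₁.card + B₂.card) := by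
    intro s r
    have h1 : T s (r + 1) ≤ ∑ i', ∑ a, (Y ^ s) i' a * (∑ a', Y a a' * (X ^ r) (e a') (e i')
        + ∑ j ∈ B₂, G (e a) j * (Gᵀ * X ^ r) j (e i')
        + ∑ i ∈ B₁, X (e a) i * (X ^ r) i (e i')) :=
      Finset.sum_le_sum fun i' _ => Finset.sum_le_sum fun a _ =>
        mul_le_mul_of_nonneg_left (step r a (e i')) (hYp s _ _)
    simp only [mul_add, Finset.sum_add_distrib] at h1
    have h2 : ∑ i', ∑ a, (Y ^ s) i' a * ∑ a', Y a a' * (X ^ r) (e a') (e i') = T (s + 1) r := by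
      refine Finset.sum_congr rfl fun i' _ => ?_
      simp only [pow_succ, Matrix.mul_apply, Finset.sum_mul, Finset.mul_sum]
      rw [Finset.sum_comm]
      exact Finset.sum_congr rfl fun _ _ => Finset.sum_congr rfl fun _ _ => by ring
    have h3 : ∑ i', ∑ a, (Y ^ s) i' a * ∑ j ∈ B₂, G (e a) j * (Gᵀ * X ^ r) j (e i') ≤ B₂.card := by
      have : ∑ i', ∑ a, (Y ^ s) i' a * ∑ j ∈ B₂, G (e a) j * (Gᵀ * X ^ r) j (e i')
          = ∑ j ∈ B₂, ∑ i', ∑ a, (Y ^ s) i' a * (G (e a) j * (Gᵀ * X ^ r) j (e i')) := by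
        simp only [Finset.mul_sum]
        rw [Finset.sum_comm]
        refine (Finset.sum_congr rfl fun a _ => Finset.sum_comm).trans ?_
        rw [Finset.sum_comm]
        exact Finset.sum_congr rfl fun j _ => Finset.sum_comm
      rw [this]
      refine (Finset.sum_le_card_nsmul _ _ 1 fun j _ => ?_).trans (by simp)
      refine (sum_submatrix_pow_mul_le hG he hf G (Gᵀ * X ^ r) s j hG (mul_nonneg_apply hGT (hXp r))).trans ?_
      -- The rotated product runs from columns to columns, so its positive fixed vector is `v`; for
      -- losses through `B₁` it is `u`.
      refine diag_le_one_of_mulVec_eq (mul_nonneg_apply (mul_nonneg_apply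
        (mul_nonneg_apply hGT (hXp r)) (hXp s)) hG) hv ?_ j
      rw [← Matrix.mulVec_mulVec, ← Matrix.mulVec_mulVec, ← Matrix.mulVec_mulVec, hGv,
        pow_mulVec_eq hXu, pow_mulVec_eq hXu, hGu]
    have h4 : ∑ i', ∑ a, (Y ^ s) i' a * ∑ i ∈ B₁, X (e a) i * (X ^ r) i (e i') ≤ B₁.card := by
      have : ∑ i', ∑ a, (Y ^ s) i' a * ∑ i ∈ B₁, X (e a) i * (X ^ r) i (e i')
          = ∑ i ∈ B₁, ∑ i', ∑ a, (Y ^ s) i' a * (X (e a) i * (X ^ r) i (e i')) := by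
        simp only [Finset.mul_sum]
        rw [Finset.sum_comm]
        refine (Finset.sum_congr rfl fun a _ => Finset.sum_comm).trans ?_
        rw [Finset.sum_comm]
        exact Finset.sum_congr rfl fun j _ => Finset.sum_comm
      rw [this]
      refine (Finset.sum_le_card_nsmul _ _ 1 fun i _ => ?_).trans (by simp)
      refine (sum_submatrix_pow_mul_le hG he hf X (X ^ r) s i hX (hXp r)).trans ?_
      refine diag_le_one_of_mulVec_eq (mul_nonneg_apply (mul_nonneg_apply (hXp r) (hXp s)) hX)
        hu ?_ i
      rw [← Matrix.mulVec_mulVec, ← Matrix.mulVec_mulVec, hXu,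
        pow_mulVec_eq hXu, pow_mulVec_eq hXu]
    linarith
  have hind : ∀ r s, T s r ≤ T (s + r) 0 + r * (B₁.card + B₂.card) := by
    intro r
    induction r with
    | zero => intro s; simp
    | succ r ih =>
      intro s
      have h1 := hstep s r
      have h2 := ih (s + 1)
      rw [show s + 1 + r = s + (r + 1) by ring] at h2
      push_cast
      linarith
  have h0 : T 0 p = ∑ i, (X ^ p) (e i) (e i) := by
    simp [hT, Matrix.one_apply]
  have hp : T p 0 = (Y ^ p).trace := by
    simp [hT, Matrix.one_apply, he.eq_iff, Matrix.trace]
  have := hind p 0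
  rwa [zero_add, h0, hp] at this

end TraceLoss

/-! ### Combinatorics of a sampling scheme -/

section Scheme

/-- Writes an overlap as an increment of `z ↦ max a (min b z)`, so that overlaps with consecutive
intervals telescope. -/
lemma max_min_sub_eq {a b c d : ℝ} (hab : a ≤ b) (hcd : c ≤ d) :
    max (min b d - max a c) 0 = max a (min b d) - max a (min b c) := by
  simp only [max_def, min_def]
  split_ifs <;> linarith

namespace SamplingScheme

variable {h : ℕ → ℝ} (D : SamplingScheme Ω h) {n : ℕ} {l : Fin 2} {ω : Ω}

lemma S_lt_of_lt (hn : 1 ≤ n) {i j : ℕ} (hij : i < j) (hj : j ≤ D.M n l ω) :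
    D.S n l i ω < D.S n l j ω := by
  induction j, hij using Nat.le_induction with
  | base => exact D.S_lt n hn l ω i hj
  | succ j hij ih => exact (ih (by omega)).trans (D.S_lt n hn l ω j hj)

lemma S_le_of_le (hn : 1 ≤ n) {i j : ℕ} (hij : i ≤ j) (hj : j ≤ D.M n l ω) :
    D.S n l i ω ≤ D.S n l j ω := by
  rcases hij.eq_or_lt with rfl | hij
  · exact le_rfl
  · exact (D.S_lt_of_lt hn hij hj).le

lemma S_nonneg (hn : 1 ≤ n) {i : ℕ} (hi : i ≤ D.M n l ω) : 0 ≤ D.S n l i ω :=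
  (D.S_zero n hn l ω).ge.trans (D.S_le_of_le hn (Nat.zero_le i) hi)

lemma S_le_horizon (hn : 1 ≤ n) {i : ℕ} (hi : i ≤ D.M n l ω) : D.S n l i ω ≤ n * h n :=
  (D.S_le_of_le hn hi le_rfl).trans (D.S_last n hn l ω).le

lemma len_pos (hn : 1 ≤ n) (i : Fin (D.M n l ω)) : 0 < D.len n l ω i :=
  sub_pos.2 (D.S_lt n hn l ω i i.2)

lemma count_eq_card (t : ℝ) :
    D.count n l t ω = (Finset.univ.filter fun i : Fin (D.M n l ω) => D.S n l (i + 1) ω ≤ t).card := by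
  rw [count, Finset.card_filter]
  exact Finset.sum_congr rfl fun i _ => by simp [indicator_apply]

lemma count_le (t : ℝ) : D.count n l t ω ≤ D.M n l ω := by
  rw [count_eq_card]
  exact (Finset.card_le_univ _).trans (by simp)

lemma count_mono {t t' : ℝ} (htt' : t ≤ t') : D.count n l t ω ≤ D.count n l t' ω := by
  rw [count_eq_card, count_eq_card]
  exact Finset.card_le_card fun i hi => by
    simp only [Finset.mem_filter, Finset.mem_univ, true_and] at hi ⊢
    exact hi.trans htt'

/-- Counts and observation times are inverse to each other. Nonnegativity of `t` serves `i = 0`,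
since `S_0 = 0` is not counted. -/
lemma S_le_iff_le_count (hn : 1 ≤ n) {t : ℝ} (ht : 0 ≤ t) {i : ℕ} (hi : i ≤ D.M n l ω) :
    D.S n l i ω ≤ t ↔ i ≤ D.count n l t ω := by
  rw [count_eq_card]
  constructor
  · intro hS
    have : (Finset.univ.image (Fin.castLE hi)).card = i := by
      rw [Finset.card_image_of_injective _ (Fin.castLE_injective hi), Finset.card_univ,
        Fintype.card_fin]
    rw [← this]
    refine Finset.card_le_card fun j hj => ?_
    obtain ⟨k, -, rfl⟩ := Finset.mem_image.1 hj
    simp only [Finset.mem_filter, Finset.mem_univ, true_and, Fin.val_castLE]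
    exact (D.S_le_of_le hn k.2 hi).trans hS
  · intro hc
    rcases Nat.eq_zero_or_pos i with rfl | hi0
    · rwa [D.S_zero n hn]
    by_contra hS
    rw [not_le] at hS
    have : (Finset.univ.filter fun j : Fin (D.M n l ω) => D.S n l (j + 1) ω ≤ t).card ≤ i - 1 := by
      rw [← Finset.card_range (i - 1)]
      refine Finset.card_le_card_of_injOn Fin.val (fun j hj => ?_) Fin.val_injective.injOn
      simp only [Finset.coe_filter, Finset.mem_univ, true_and, mem_ofPred_eq] at hj
      simp only [Finset.coe_range, mem_Iio]
      by_contra hcon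
      have : D.S n l i ω ≤ D.S n l (j + 1) ω := D.S_le_of_le hn (by omega) j.2
      linarith
    omega

lemma G_apply (i : Fin (D.M n 0 ω)) (j : Fin (D.M n 1 ω)) :
    D.G n ω i j = overlapRatio (D.S n 0 i ω) (D.S n 0 (i + 1) ω) (D.S n 1 j ω)
      (D.S n 1 (j + 1) ω) := rfl

lemma G_nonneg (i : Fin (D.M n 0 ω)) (j : Fin (D.M n 1 ω)) : 0 ≤ D.G n ω i j :=
  overlapRatio_nonneg _ _ _ _

lemma sqrtLen_pos (hn : 1 ≤ n) (i : Fin (D.M n l ω)) : 0 < D.sqrtLen n l ω i :=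
  Real.sqrt_pos.2 (D.len_pos hn i)

lemma sum_overlap (hn : 1 ≤ n) {a b : ℝ} (ha : 0 ≤ a) (hab : a ≤ b) (hb : b ≤ n * h n) :
    ∑ j : Fin (D.M n l ω), max (min b (D.S n l (j + 1) ω) - max a (D.S n l j ω)) 0 = b - a := by
  rw [Finset.sum_congr rfl fun (j : Fin (D.M n l ω)) _ => max_min_sub_eq hab (D.S_lt n hn l ω j j.2).le,
    Fin.sum_univ_eq_sum_range (fun j => max a (min b (D.S n l (j + 1) ω))
      - max a (min b (D.S n l j ω))) (D.M n l ω),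
    Finset.sum_range_sub (fun j => max a (min b (D.S n l j ω))), D.S_last n hn, D.S_zero n hn,
    min_eq_left hb, max_eq_right hab, min_eq_right (ha.trans hab), max_eq_left ha]

/-- The square roots of the second component cancel, and the overlaps of a fixed interval with a
tiling sum to its length. -/
lemma G_mulVec_sqrtLen (hn : 1 ≤ n) : D.G n ω *ᵥ D.sqrtLen n 1 ω = D.sqrtLen n 0 ω := by
  ext i
  have hi := D.sqrtLen_pos hn i
  have e : ∀ j, D.G n ω i j * D.sqrtLen n 1 ω j
      = max (min (D.S n 0 (i + 1) ω) (D.S n 1 (j + 1) ω) - max (D.S n 0 i ω) (D.S n 1 j ω)) 0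
        / D.sqrtLen n 0 ω i := by
    intro j
    have hj := D.sqrtLen_pos hn j
    change _ / (D.sqrtLen n 0 ω i * D.sqrtLen n 1 ω j) * _ = _
    field_simp
  change ∑ j, D.G n ω i j * D.sqrtLen n 1 ω j = _
  rw [Finset.sum_congr rfl fun j _ => e j, ← Finset.sum_div, D.sum_overlap hn
    (D.S_nonneg hn i.2.le) (D.S_lt n hn 0 ω i i.2).le (D.S_le_horizon hn i.2), div_eq_iff hi.ne']
  exact (Real.mul_self_sqrt (D.len_pos hn i).le).symm

lemma transpose_G_mulVec_sqrtLen (hn : 1 ≤ n) :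
    (D.G n ω)ᵀ *ᵥ D.sqrtLen n 0 ω = D.sqrtLen n 1 ω := by
  ext j
  have hj := D.sqrtLen_pos hn j
  have e : ∀ i, D.G n ω i j * D.sqrtLen n 0 ω i
      = max (min (D.S n 1 (j + 1) ω) (D.S n 0 (i + 1) ω) - max (D.S n 1 j ω) (D.S n 0 i ω)) 0
        / D.sqrtLen n 1 ω j := by
    intro i
    have hi := D.sqrtLen_pos hn i
    change _ / (D.sqrtLen n 0 ω i * D.sqrtLen n 1 ω j) * _ = _
    rw [min_comm, max_comm (D.S n 0 i ω)]
    field_simp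
  change ∑ i, D.G n ω i j * D.sqrtLen n 0 ω i = _
  rw [Finset.sum_congr rfl fun i _ => e i, ← Finset.sum_div, D.sum_overlap hn
    (D.S_nonneg hn j.2.le) (D.S_lt n hn 1 ω j j.2).le (D.S_le_horizon hn j.2), div_eq_iff hj.ne']
  exact (Real.mul_self_sqrt (D.len_pos hn j).le).symm

lemma pow_diag_nonneg (p : ℕ) (i : Fin (D.M n 0 ω)) :
    0 ≤ ((D.G n ω * (D.G n ω)ᵀ) ^ p) i i :=
  pow_nonneg_apply (mul_nonneg_apply D.G_nonneg fun i j => D.G_nonneg j i) p i i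

lemma GGT_mulVec_sqrtLen (hn : 1 ≤ n) :
    (D.G n ω * (D.G n ω)ᵀ) *ᵥ D.sqrtLen n 0 ω = D.sqrtLen n 0 ω := by
  rw [← Matrix.mulVec_mulVec, D.transpose_G_mulVec_sqrtLen hn, D.G_mulVec_sqrtLen hn]

lemma pow_diag_le_one (hn : 1 ≤ n) (p : ℕ) (i : Fin (D.M n 0 ω)) :
    ((D.G n ω * (D.G n ω)ᵀ) ^ p) i i ≤ 1 :=
  diag_le_one_of_mulVec_eq
    (pow_nonneg_apply (mul_nonneg_apply D.G_nonneg fun i j => D.G_nonneg j i) p)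
    (D.sqrtLen_pos hn) (pow_mulVec_eq (D.GGT_mulVec_sqrtLen hn) p) i

/-- The counts of the scheme are the rescaled counts of the point process along `ω`. -/
structure IsRescaledAt (Nbar : Fin 2 → ℝ → Ω → ℕ) (ω : Ω) : Prop where
  h_pos : ∀ n, 1 ≤ n → 0 < h n
  mono : ∀ l, MonotoneOn (fun t => Nbar l t ω) (Ici 0)
  count_eq : ∀ n, 1 ≤ n → ∀ l, ∀ t ∈ Ico 0 (n * h n), D.count n l t ω = Nbar l (t / h n) ω

lemma ae_isRescaledAt (h_pos : ∀ n, 1 ≤ n → 0 < h n) {P : Measure Ω}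
    {Nbar : Fin 2 → ℝ → Ω → ℕ} (hN : IsPointProcess P Nbar) (hD : D.IsRescaling P Nbar) :
    ∀ᵐ ω ∂P, D.IsRescaledAt Nbar ω := by
  filter_upwards [hN.mono, hD] with ω h1 h2 using ⟨h_pos, h1, h2⟩

variable {D} {Nbar : Fin 2 → ℝ → Ω → ℕ}

lemma IsRescaledAt.count_mul (H : D.IsRescaledAt Nbar ω) (hn : 1 ≤ n) {x : ℝ} (hx : 0 ≤ x)
    (hxn : x < n) : D.count n l (x * h n) ω = Nbar l x ω := by
  have hh := H.h_pos n hn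
  rw [H.count_eq n hn l _ ⟨by positivity, by gcongr⟩, mul_div_cancel_right₀ _ hh.ne']

/-- Only `y = n` can give an excess: the forced observation at the horizon adds at most one point,
and the one preceding it is already covered by the rescaling. -/
lemma IsRescaledAt.count_mul_le (H : D.IsRescaledAt Nbar ω) (hn : 1 ≤ n) {y : ℝ} (hy : 0 ≤ y)
    (hyn : y ≤ n) : D.count n l (y * h n) ω ≤ Nbar l y ω + 1 := by
  have hh := H.h_pos n hn
  rcases hyn.eq_or_lt with rfl | hyn
  · have hM := D.M_pos n hn l ω
    have h1 := D.count_le (n := n) (l := l) (ω := ω) (n * h n)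
    have h0 := D.S_nonneg (l := l) (ω := ω) hn (Nat.sub_le (D.M n l ω) 1)
    have h2 : D.S n l (D.M n l ω - 1) ω < n * h n := by
      rw [← D.S_last n hn l ω]
      exact D.S_lt_of_lt hn (by omega) le_rfl
    have h3 := (D.S_le_iff_le_count (l := l) (ω := ω) hn h0 (Nat.sub_le (D.M n l ω) 1)).1 le_rfl
    rw [H.count_eq n hn l _ ⟨h0, h2⟩] at h3
    have h4 : Nbar l (D.S n l (D.M n l ω - 1) ω / h n) ω ≤ Nbar l n ω :=
      H.mono l (mem_Ici.2 (by positivity)) (mem_Ici.2 hy) (by rw [div_le_iff₀ hh]; exact h2.le)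
    omega
  · rw [H.count_mul hn hy hyn]
    omega

lemma IsRescaledAt.count_sub_le (H : D.IsRescaledAt Nbar ω) (hn : 1 ≤ n) {x y : ℝ} (hx : 0 ≤ x)
    (hxy : x ≤ y) (hyn : y ≤ n) :
    (D.count n l (y * h n) ω : ℝ) - D.count n l (x * h n) ω ≤ Nbar l y ω - Nbar l x ω + 1 := by
  rcases (hxy.trans hyn).eq_or_lt with hxn | hxn
  · have : x = y := by linarith
    rw [this]
    linarith
  · rw [H.count_mul hn hx hxn]
    have : (D.count n l (y * h n) ω : ℝ) ≤ Nbar l y ω + 1 := by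
      exact_mod_cast H.count_mul_le hn (hx.trans hxy) hyn
    linarith

/-- The indices and positions of the observation times inside a window. -/
structure IsWindowOf (D : SamplingScheme Ω h) (n : ℕ) (l : Fin 2) (ω : Ω) (x : ℝ) (ℓ : ℕ)
    (w : ℚ × Fin 2 → ℤ) (c k : ℕ) : Prop where
  le_M : c + k ≤ D.M n l ω
  le_left_iff : ∀ i ≤ D.M n l ω, D.S n l i ω ≤ x * h n ↔ i ≤ c
  le_right_iff : ∀ i ≤ D.M n l ω, D.S n l i ω ≤ (x + ℓ) * h n ↔ i ≤ c + k
  windowCount_eq : windowCount ℓ l w = k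
  S_eq : ∀ j, 1 ≤ j → j ≤ k → D.S n l (c + j) ω = h n * (x + windowPoint ℓ l j w)

/-- Strictly before the horizon, counts at both ends give the index range and counts at rational
times locate the points, so the window determines the rescaled observation times in it. -/
lemma IsRescaledAt.isWindowOf (H : D.IsRescaledAt Nbar ω) (hn : 1 ≤ n) (l : Fin 2) {x : ℝ}
    (hx : 0 ≤ x) {ℓ : ℕ} (hxn : x + ℓ < n) :
    D.IsWindowOf n l ω x ℓ (window Nbar ℓ x ω) (Nbar l x ω)
      (Nbar l (x + ℓ) ω - Nbar l x ω) := by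
  have hh := H.h_pos n hn
  have hℓ : (0 : ℝ) ≤ ℓ := by positivity
  have hcx : D.count n l (x * h n) ω = Nbar l x ω := H.count_mul hn hx (by linarith)
  have hcy : D.count n l ((x + ℓ) * h n) ω = Nbar l (x + ℓ) ω := H.count_mul hn (by positivity) hxn
  have hle : Nbar l x ω ≤ Nbar l (x + ℓ) ω :=
    H.mono l (mem_Ici.2 hx) (mem_Ici.2 (by positivity)) (by linarith)
  have hM : Nbar l (x + ℓ) ω ≤ D.M n l ω := hcy ▸ D.count_le _
  have e : Nbar l x ω + (Nbar l (x + ℓ) ω - Nbar l x ω) = Nbar l (x + ℓ) ω := by omega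
  have hL : ∀ i ≤ D.M n l ω, D.S n l i ω ≤ x * h n ↔ i ≤ Nbar l x ω := fun i hi => by
    rw [D.S_le_iff_le_count hn (by positivity) hi, hcx]
  have hR : ∀ i ≤ D.M n l ω, D.S n l i ω ≤ (x + ℓ) * h n ↔ i ≤ Nbar l (x + ℓ) ω := fun i hi => by
    rw [D.S_le_iff_le_count hn (by positivity) hi, hcy]
  refine ⟨by omega, hL, by rw [e]; exact hR, ?_, fun j hj1 hjk => ?_⟩
  · have : clamp ℓ (ℓ : ℚ) = ℓ := by
      have := clamp_of_mem (ℓ := ℓ) (r := ℓ) (by simp) (by simp)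
      simpa using this
    simp only [windowCount, window, this]
    omega
  · have hjM : Nbar l x ω + j ≤ D.M n l ω := by omega
    set S := D.S n l (Nbar l x ω + j) ω with hS
    have h1 : x * h n < S := by
      by_contra hcon
      have := (hL _ hjM).1 (not_lt.1 hcon)
      omega
    have h2 : S ≤ (x + ℓ) * h n := (hR _ hjM).2 (by omega)
    have hwp : windowPoint ℓ l j (window Nbar ℓ x ω) = S / h n - x := by
      refine windowPoint_eq ?_ ?_ fun r => ?_
      · have : x ≤ S / h n := by rw [le_div_iff₀ hh]; exact h1.le
        linarith
      · have : S / h n ≤ x + ℓ := by rwa [div_le_iff₀ hh]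
        linarith
      · have hr0 := clamp_nonneg ℓ r
        have hr1 := clamp_le ℓ r
        have hcr : D.count n l ((x + clamp ℓ r) * h n) ω = Nbar l (x + clamp ℓ r) ω :=
          H.count_mul hn (by positivity) (by linarith)
        have h3 := D.S_le_iff_le_count (l := l) (ω := ω) hn
          (by positivity : 0 ≤ (x + clamp ℓ r) * h n) hjM
        rw [hcr, ← hS, ← div_le_iff₀ hh] at h3
        rw [sub_le_iff_le_add', h3]
        simp only [window]
        omega
    rw [hwp]
    field_simp
    ring

end SamplingScheme

end Scheme

/-! ### Counts and traces as nearly local functionals. -/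

section NearlyLocal

namespace SamplingScheme

variable {h : ℕ → ℝ} {D : SamplingScheme Ω h} {n : ℕ} {l : Fin 2} {ω : Ω}
  {Nbar : Fin 2 → ℝ → Ω → ℕ}

/-- The sum of the diagonal entries of `(G Gᵀ)^p` over the observation times up to `x h_n`. -/
def traceCum (D : SamplingScheme Ω h) (p n : ℕ) (x : ℝ) (ω : Ω) : ℝ :=
  ∑ i : Fin (D.M n 0 ω), if D.S n 0 (i + 1) ω ≤ x * h n then ((D.G n ω * (D.G n ω)ᵀ) ^ p) i i else 0

/-- The trace functional of the complete intervals inside `[b ℓ, (b + 1) ℓ]`. -/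
def _root_.NonsyncSampling.blockTrace (Nbar : Fin 2 → ℝ → Ω → ℕ) (p ℓ b : ℕ) (ω : Ω) : ℝ :=
  windowTrace p ℓ (window Nbar ℓ (b * ℓ) ω)

lemma traceCum_sub (h0 : 0 ≤ h n) (p : ℕ) {x y : ℝ} (hxy : x ≤ y) :
    D.traceCum p n y ω - D.traceCum p n x ω = ∑ i : Fin (D.M n 0 ω),
      if x * h n < D.S n 0 (i + 1) ω ∧ D.S n 0 (i + 1) ω ≤ y * h n
        then ((D.G n ω * (D.G n ω)ᵀ) ^ p) i i else 0 := by
  rw [traceCum, traceCum, ← Finset.sum_sub_distrib]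
  refine Finset.sum_congr rfl fun i _ => ?_
  have hle : x * h n ≤ y * h n := by gcongr
  by_cases h1 : D.S n 0 (i + 1) ω ≤ x * h n
  · simp [h1, h1.trans hle]
  · simp [h1, not_le.1 h1]

lemma count_sub_eq_sum (h0 : 0 ≤ h n) {x y : ℝ} (hxy : x ≤ y) :
    (D.count n l (y * h n) ω : ℝ) - D.count n l (x * h n) ω = ∑ i : Fin (D.M n l ω),
      if x * h n < D.S n l (i + 1) ω ∧ D.S n l (i + 1) ω ≤ y * h n then (1 : ℝ) else 0 := by
  rw [count, count]
  push_cast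
  rw [← Finset.sum_sub_distrib]
  refine Finset.sum_congr rfl fun i _ => ?_
  have hle : x * h n ≤ y * h n := by gcongr
  by_cases h1 : D.S n l (i + 1) ω ≤ x * h n
  · simp [h1, h1.trans hle]
  · simp [h1, not_le.1 h1, indicator_apply]

/-- Diagonal entries lie in `[0, 1]`, so a trace increment is at most the number of observations;
the extra 1 is the possible observation at the horizon. -/
lemma IsRescaledAt.traceCum_bound (H : D.IsRescaledAt Nbar ω) (hn : 1 ≤ n) (p : ℕ) {x y : ℝ}
    (hx : 0 ≤ x) (hxy : x ≤ y) (hyn : y ≤ n) :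
    0 ≤ D.traceCum p n y ω - D.traceCum p n x ω ∧
      D.traceCum p n y ω - D.traceCum p n x ω ≤ Nbar 0 y ω - Nbar 0 x ω + 1 := by
  have hh := (H.h_pos n hn).le
  refine ⟨?_, le_trans ?_ (H.count_sub_le hn hx hxy hyn)⟩
  · rw [traceCum_sub hh p hxy]
    refine Finset.sum_nonneg fun i _ => ?_
    split_ifs
    · exact D.pow_diag_nonneg p i
    · exact le_rfl
  · rw [traceCum_sub hh p hxy, count_sub_eq_sum hh hxy]
    refine Finset.sum_le_sum fun i _ => ?_
    split_ifs
    · exact D.pow_diag_le_one hn p i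
    · exact le_rfl

/-- The embedding of the complete intervals of a window into all observation intervals. -/
def windowEmb {M c k : ℕ} (hM : c + k ≤ M) (i : Fin (k - 1)) : Fin M :=
  ⟨c + 1 + i, by have := i.2; omega⟩

lemma windowEmb_injective {M c k : ℕ} (hM : c + k ≤ M) :
    Function.Injective (windowEmb hM) := fun i j hij => by
  have := Fin.ext_iff.1 hij
  simp only [windowEmb] at this
  exact Fin.ext (by omega)

lemma mem_range_windowEmb {M c k : ℕ} (hM : c + k ≤ M) {i : Fin M} :
    i ∈ range (windowEmb hM) ↔ c + 1 ≤ (i : ℕ) ∧ (i : ℕ) < c + k := by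
  constructor
  · rintro ⟨j, rfl⟩
    have := j.2
    simp only [windowEmb]
    omega
  · rintro ⟨h1, h2⟩
    exact ⟨⟨i - (c + 1), by omega⟩, Fin.ext (by simp only [windowEmb]; omega)⟩

/-- The indices of the intervals that may straddle the boundary of a window. -/
def windowBoundary (M c k : ℕ) : Finset (Fin M) :=
  Finset.univ.filter fun i => (i : ℕ) = c ∨ (i : ℕ) = c + k

lemma card_windowBoundary_le (M c k : ℕ) : (windowBoundary M c k).card ≤ 2 := by
  refine (Finset.card_le_card_of_injOn (t := {c, c + k}) Fin.val (fun i hi => ?_)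
    Fin.val_injective.injOn).trans Finset.card_le_two
  simpa [windowBoundary] using hi

lemma overlapRatio_eq_zero {a b c d : ℝ} (h : min b d ≤ max a c) : overlapRatio a b c d = 0 := by
  rw [overlapRatio, max_eq_right (by linarith), zero_div]

lemma overlapRatio_comm (a b c d : ℝ) : overlapRatio a b c d = overlapRatio c d a b := by
  rw [overlapRatio, overlapRatio, min_comm, max_comm a c, mul_comm]

/-- An interval that is neither complete in the window nor at index `c` or `c + k` lies entirely to
one side of it, and cannot overlap a complete interval of the other component. -/
lemma IsWindowOf.mem_windowBoundary {l l' : Fin 2} {x : ℝ} {ℓ : ℕ} {w : ℚ × Fin 2 → ℤ}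
    {c k c' k' : ℕ} (W : D.IsWindowOf n l ω x ℓ w c k)
    (W' : D.IsWindowOf n l' ω x ℓ w c' k') (i : Fin (D.M n l ω)) (j : Fin (k' - 1))
    (hi : i ∉ range (windowEmb W.le_M))
    (hne : overlapRatio (D.S n l i ω) (D.S n l (i + 1) ω)
      (D.S n l' (windowEmb W'.le_M j) ω) (D.S n l' (windowEmb W'.le_M j + 1) ω) ≠ 0) :
    i ∈ windowBoundary (D.M n l ω) c k := by
  rw [mem_range_windowEmb] at hi
  simp only [windowBoundary, Finset.mem_filter, Finset.mem_univ, true_and]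
  by_contra hcon
  refine hne (overlapRatio_eq_zero ?_)
  have hj := j.2
  have hkM := W'.le_M
  rcases lt_or_ge (i : ℕ) c with hic | hic
  · have h1 := (W.le_left_iff (i + 1) i.2).2 hic
    have h2 : x * h n < D.S n l' (windowEmb W'.le_M j) ω := by
      by_contra hc
      have := (W'.le_left_iff _ (windowEmb W'.le_M j).2.le).1 (not_lt.1 hc)
      simp only [windowEmb] at this
      omega
    exact (min_le_left _ _).trans (h1.trans (h2.le.trans (le_max_right _ _)))
  · have h1 : (x + ℓ) * h n < D.S n l i ω := by
      by_contra hc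
      have := (W.le_right_iff _ i.2.le).1 (not_lt.1 hc)
      omega
    have h2 : D.S n l' (windowEmb W'.le_M j + 1) ω ≤ (x + ℓ) * h n := by
      refine (W'.le_right_iff _ (windowEmb W'.le_M j).2).2 ?_
      simp only [windowEmb]
      omega
    exact (min_le_right _ _).trans (h2.trans (h1.le.trans (le_max_left _ _)))

lemma IsWindowOf.windowMatrix_eq {x : ℝ} {ℓ : ℕ} {w : ℚ × Fin 2 → ℤ} {c k c' k' : ℕ}
    (hh : 0 < h n) (W : D.IsWindowOf n 0 ω x ℓ w c k) (W' : D.IsWindowOf n 1 ω x ℓ w c' k') :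
    windowMatrix ℓ (k - 1) (k' - 1) w
      = (D.G n ω).submatrix (windowEmb W.le_M) (windowEmb W'.le_M) := by
  ext i j
  have hi := i.2
  have hj := j.2
  rw [Matrix.submatrix_apply, G_apply]
  simp only [windowEmb, windowMatrix, Matrix.of_apply]
  rw [show c + 1 + (i : ℕ) = c + (i + 1) by omega, show c' + 1 + (j : ℕ) = c' + (j + 1) by omega,
    show c + ((i : ℕ) + 1) + 1 = c + (i + 2) by omega,
    show c' + ((j : ℕ) + 1) + 1 = c' + (j + 2) by omega,
    W.S_eq _ (by omega) (by omega), W.S_eq _ (by omega) (by omega),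
    W'.S_eq _ (by omega) (by omega), W'.S_eq _ (by omega) (by omega), overlapRatio_affine hh]

/-- The error `4 p` is one unit per step for each of at most two boundary intervals of each
component. The additional 1 is the interval straddling the left end: it may end in the window
without being complete there. -/
lemma IsRescaledAt.traceCum_local (H : D.IsRescaledAt Nbar ω) (hn : 1 ≤ n) (p : ℕ) {x : ℝ}
    (hx : 0 ≤ x) {ℓ : ℕ} (hxn : x + ℓ < n) :
    windowTrace p ℓ (window Nbar ℓ x ω) ≤ D.traceCum p n (x + ℓ) ω - D.traceCum p n x ω ∧
      D.traceCum p n (x + ℓ) ω - D.traceCum p n x ω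
        ≤ windowTrace p ℓ (window Nbar ℓ x ω) + (4 * p + 1) := by
  have hh := H.h_pos n hn
  have W := H.isWindowOf hn 0 hx hxn
  have W' := H.isWindowOf hn 1 hx hxn
  set w := window Nbar ℓ x ω
  set c := Nbar 0 x ω
  set k := Nbar 0 (x + ℓ) ω - c
  set c' := Nbar 1 x ω
  set k' := Nbar 1 (x + ℓ) ω - c'
  set e := windowEmb W.le_M with he_def
  set f := windowEmb W'.le_M with hf_def
  have he : Function.Injective e := windowEmb_injective _
  have hf : Function.Injective f := windowEmb_injective _
  have hwt : windowTrace p ℓ w = (((D.G n ω).submatrix e f * ((D.G n ω).submatrix e f)ᵀ) ^ p).trace := by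
    rw [windowTrace, W.windowCount_eq, W'.windowCount_eq, W.windowMatrix_eq hh W']
  set φ : Fin (D.M n 0 ω) → ℝ := fun i =>
    if x * h n < D.S n 0 (i + 1) ω ∧ D.S n 0 (i + 1) ω ≤ (x + ℓ) * h n
      then ((D.G n ω * (D.G n ω)ᵀ) ^ p) i i else 0 with hφ
  have hφ0 : ∀ i, 0 ≤ φ i := fun i => by
    simp only [hφ]
    split_ifs
    · exact D.pow_diag_nonneg p i
    · exact le_rfl
  have hφ1 : ∀ i, φ i ≤ 1 := fun i => by
    simp only [hφ]
    split_ifs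
    · exact D.pow_diag_le_one hn p i
    · exact zero_le_one
  have hiff : ∀ i : Fin (D.M n 0 ω), (x * h n < D.S n 0 (i + 1) ω ∧
      D.S n 0 (i + 1) ω ≤ (x + ℓ) * h n) ↔ c ≤ i ∧ (i : ℕ) < c + k := by
    intro i
    rw [W.le_right_iff _ i.2, ← not_le, W.le_left_iff _ i.2]
    omega
  have hφe : ∀ i, φ (e i) = ((D.G n ω * (D.G n ω)ᵀ) ^ p) (e i) (e i) := fun i => by
    refine if_pos ((hiff _).2 ?_)
    have := i.2
    simp only [he_def, windowEmb]
    omega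
  have hsum : D.traceCum p n (x + ℓ) ω - D.traceCum p n x ω = ∑ i, φ i :=
    traceCum_sub hh.le p (by linarith [(Nat.cast_nonneg ℓ : (0 : ℝ) ≤ ℓ)])
  rw [hsum, hwt]
  constructor
  · refine (trace_submatrix_pow_le D.G_nonneg he hf p).trans ?_
    rw [← Finset.sum_congr rfl fun i _ => hφe i]
    exact sum_comp_le_sum he hφ0
  · have h1 := sum_le_sum_comp_add he hφ0 (Finset.univ.filter fun i => (i : ℕ) = c)
      (fun i hi hne => by
        simp only [Finset.mem_filter, Finset.mem_univ, true_and]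
        have h2 : x * h n < D.S n 0 (i + 1) ω ∧ D.S n 0 (i + 1) ω ≤ (x + ℓ) * h n := by
          by_contra hcon
          exact hne (if_neg hcon)
        rw [hiff] at h2
        rw [he_def, mem_range_windowEmb] at hi
        omega)
    have hcard : (Finset.univ.filter fun i : Fin (D.M n 0 ω) => (i : ℕ) = c).card ≤ 1 :=
      Finset.card_le_one.2 fun i hi j hj => by
        simp only [Finset.mem_filter, Finset.mem_univ, true_and] at hi hj
        exact Fin.ext (hi.trans hj.symm)
    have h3 : ∑ i ∈ Finset.univ.filter (fun i : Fin (D.M n 0 ω) => (i : ℕ) = c), φ i ≤ 1 := by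
      refine (Finset.sum_le_card_nsmul _ _ 1 fun i _ => hφ1 i).trans ?_
      rw [nsmul_eq_mul, mul_one]
      exact_mod_cast hcard
    have h4 := sum_pow_le_trace_submatrix D.G_nonneg (D.sqrtLen_pos hn) (D.sqrtLen_pos hn)
      (D.G_mulVec_sqrtLen hn) (D.transpose_G_mulVec_sqrtLen hn) he hf
      (windowBoundary (D.M n 0 ω) c k) (windowBoundary (D.M n 1 ω) c' k')
      (fun i j hi hne => W.mem_windowBoundary W' i j hi hne)
      (fun i j hj hne => W'.mem_windowBoundary W j i hj (by
        rw [G_apply, overlapRatio_comm] at hne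
        exact hne)) p
    have h5 : ((windowBoundary (D.M n 0 ω) c k).card : ℝ) ≤ 2 := by
      exact_mod_cast card_windowBoundary_le _ _ _
    have h6 : ((windowBoundary (D.M n 1 ω) c' k').card : ℝ) ≤ 2 := by
      exact_mod_cast card_windowBoundary_le _ _ _
    have hp : (0 : ℝ) ≤ p := by positivity
    rw [Finset.sum_congr rfl fun i _ => hφe i] at h1
    nlinarith

lemma isNearlyLocal_traceCum {P : Measure Ω} (H : ∀ᵐ ω ∂P, D.IsRescaledAt Nbar ω) (p : ℕ) :
    IsNearlyLocal P Nbar 0 (D.traceCum p) (blockTrace Nbar p) (4 * p + 1) where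
  bound := H.mono fun ω H n hn x y hx hxy hy => H.traceCum_bound hn p hx hxy hy
  local_le := H.mono fun ω H n hn ℓ b hℓ hb => by
    have e : ((b : ℝ) + 1) * ℓ = b * ℓ + ℓ := by ring
    rw [e] at hb ⊢
    exact H.traceCum_local hn p (by positivity) hb

lemma isNearlyLocal_count {P : Measure Ω} (H : ∀ᵐ ω ∂P, D.IsRescaledAt Nbar ω) (l : Fin 2) :
    IsNearlyLocal P Nbar l (fun n x ω => D.count n l (x * h n) ω) (blockInc Nbar l) 0 where
  bound := H.mono fun ω H n hn x y hx hxy hy => by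
    have hh := (H.h_pos n hn).le
    refine ⟨sub_nonneg.2 (Nat.cast_le.2 (D.count_mono (by gcongr))), H.count_sub_le hn hx hxy hy⟩
  local_le := H.mono fun ω H n hn ℓ b hℓ hb => by
    have hle : (b : ℝ) * ℓ ≤ (b + 1) * ℓ := by gcongr; linarith
    rw [H.count_mul hn (by positivity) hb, H.count_mul hn (by positivity) (by linarith),
      blockInc, Nat.cast_sub (H.mono l (mem_Ici.2 (by positivity)) (mem_Ici.2 (by positivity)) hle)]
    simp

end SamplingScheme

end NearlyLocal

/-! ### Moments, gap probabilities and positivity -/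

section Moments

open ProbabilityTheory (IdentDistrib)

variable {P : Measure Ω} [IsProbabilityMeasure P] {Nbar : Fin 2 → ℝ → Ω → ℕ}

lemma blockInc_eq_windowCount {Ω : Type*} {Nbar : Fin 2 → ℝ → Ω → ℕ} (l : Fin 2) (ℓ b : ℕ) (ω : Ω) :
    blockInc Nbar l ℓ b ω = (windowCount ℓ l (window Nbar ℓ (b * ℓ) ω) : ℝ) := by
  have : clamp ℓ (ℓ : ℚ) = ℓ := by
    have := clamp_of_mem (ℓ := ℓ) (r := ℓ) (by simp) (by simp)
    simpa using this
  have e : ((b : ℝ) + 1) * ℓ = b * ℓ + ℓ := by ring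
  simp only [blockInc, windowCount, window, this, e]
  congr 1
  omega

lemma measurable_comp_window {Ω : Type*} {Nbar : Fin 2 → ℝ → Ω → ℕ} {Φ : (ℚ × Fin 2 → ℤ) → ℝ} (hΦ : Measurable Φ) (ℓ b : ℕ) :
    Measurable[incrementSigma Nbar (Icc (b * ℓ : ℝ) ((b + 1) * ℓ))]
      fun ω => Φ (window Nbar ℓ (b * ℓ) ω) := by
  have e : ((b : ℝ) + 1) * ℓ = b * ℓ + ℓ := by ring
  rw [e]
  exact hΦ.comp (measurable_window Nbar ℓ (b * ℓ))

lemma HasStationaryIncrements.identDistrib_comp_window (hN : IsPointProcess P Nbar)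
    (hstat : HasStationaryIncrements P Nbar) {Φ : (ℚ × Fin 2 → ℤ) → ℝ} (hΦ : Measurable Φ)
    (ℓ b : ℕ) : IdentDistrib (fun ω => Φ (window Nbar ℓ (b * ℓ) ω))
      (fun ω => Φ (window Nbar ℓ ((0 : ℕ) * ℓ) ω)) P P := by
  simp only [Nat.cast_zero, zero_mul]
  exact (hstat.identDistrib_window hN ℓ (t := b * ℓ) (by positivity)).comp hΦ

lemma measurable_windowCount_real (ℓ : ℕ) (l : Fin 2) :
    Measurable fun c => (windowCount ℓ l c : ℝ) :=
  measurable_from_top.comp (measurable_windowCount ℓ l)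

lemma blockInc_nonneg {Ω : Type*} {Nbar : Fin 2 → ℝ → Ω → ℕ} (l : Fin 2) (ℓ b : ℕ) (ω : Ω) : 0 ≤ blockInc Nbar l ℓ b ω :=
  Nat.cast_nonneg _

lemma identDistrib_blockInc (hN : IsPointProcess P Nbar) (hstat : HasStationaryIncrements P Nbar)
    (l : Fin 2) (ℓ b : ℕ) : IdentDistrib (blockInc Nbar l ℓ b) (blockInc Nbar l ℓ 0) P P := by
  have := hstat.identDistrib_comp_window hN (measurable_windowCount_real ℓ l) ℓ b
  simpa only [← blockInc_eq_windowCount] using this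

lemma measurable_blockInc {P : Measure Ω} (hN : IsPointProcess P Nbar) (l : Fin 2) (ℓ b : ℕ) :
    Measurable (blockInc Nbar l ℓ b) := by
  have := measurable_comp_window (Nbar := Nbar) (measurable_windowCount_real ℓ l) ℓ b
  simp only [← blockInc_eq_windowCount] at this
  exact this.mono (hN.incrementSigma_le
    (Icc_subset_Ici_self.trans (Ici_subset_Ici.2 (by positivity)))) le_rfl

variable {h : ℕ → ℝ} {D : SamplingScheme Ω h}

/-- Uses (B1-q) at `n = 2`, `t = 0`: the interval `[0, h 2]` ends before the horizon, so the count
there is that of `Nbar`. -/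
lemma memLp_blockInc_one {P : Measure Ω} (H : ∀ᵐ ω ∂P, D.IsRescaledAt Nbar ω) (h_pos : ∀ n, 1 ≤ n → 0 < h n)
    (hN : IsPointProcess P Nbar) {l : Fin 2} {q : ℕ} (hq : q ≠ 0) (hB1 : D.B1 P q) :
    MemLp (blockInc Nbar l 1 0) q P := by
  have hh := h_pos 2 (by norm_num)
  have h1 : ∫⁻ ω, ENNReal.ofReal (((D.count 2 l (0 + h 2) ω : ℝ) - D.count 2 l 0 ω) ^ (q : ℝ)) ∂P
      < ∞ := by
    refine lt_of_le_of_lt ?_ hB1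
    have h2 := le_refl (⨆ (n : ℕ) (_ : 1 ≤ n) (l : Fin 2) (t ∈ Icc 0 (((n : ℝ) - 1) * h n)),
      ∫⁻ ω, ENNReal.ofReal (((D.count n l (t + h n) ω : ℝ) - D.count n l t ω) ^ (q : ℝ)) ∂P)
    rw [iSup_le_iff] at h2
    replace h2 := h2 2
    rw [iSup_le_iff] at h2
    replace h2 := h2 (by norm_num)
    rw [iSup_le_iff] at h2
    replace h2 := h2 l
    rw [iSup_le_iff] at h2
    replace h2 := h2 0
    rw [iSup_le_iff] at h2
    exact h2 ⟨le_rfl, by push_cast; linarith⟩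
  have hae : (fun ω => ENNReal.ofReal (((D.count 2 l (0 + h 2) ω : ℝ) - D.count 2 l 0 ω) ^ (q : ℝ)))
      =ᵐ[P] fun ω => ENNReal.ofReal (blockInc Nbar l 1 0 ω ^ q) := by
    filter_upwards [H] with ω H
    have e1 := H.count_mul (n := 2) (l := l) (by norm_num) (zero_le_one' ℝ) (by norm_num)
    have e0 := H.count_mul (n := 2) (l := l) (by norm_num) (le_refl (0 : ℝ)) (by norm_num)
    rw [one_mul] at e1
    rw [zero_mul] at e0
    have hle : Nbar l 0 ω ≤ Nbar l 1 ω :=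
      H.mono l (mem_Ici.2 le_rfl) (mem_Ici.2 zero_le_one) zero_le_one
    rw [zero_add, e1, e0, Real.rpow_natCast]
    simp [blockInc, Nat.cast_sub hle]
  rw [lintegral_congr_ae hae] at h1
  rw [← integrable_norm_rpow_iff (measurable_blockInc hN l 1 0).aestronglyMeasurable
    (by exact_mod_cast hq) (by simp)]
  refine ⟨((measurable_blockInc hN l 1 0).norm.pow_const _).aestronglyMeasurable, ?_⟩
  rw [hasFiniteIntegral_iff_norm]
  convert h1 using 3 with ω
  simp [abs_of_nonneg (blockInc_nonneg (Nbar := Nbar) l 1 0 ω), blockInc_nonneg]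

lemma sum_blockInc_one {Ω : Type*} {Nbar : Fin 2 → ℝ → Ω → ℕ} {ω : Ω} (hmono : ∀ l, MonotoneOn (fun t => Nbar l t ω) (Ici 0)) (l : Fin 2)
    {a b : ℕ} (hab : a ≤ b) :
    ∑ i ∈ Finset.Ico a b, blockInc Nbar l 1 i ω = (Nbar l b ω : ℝ) - Nbar l a ω := by
  have := Finset.sum_Ico_sub (fun i : ℕ => (Nbar l i ω : ℝ)) hab
  rw [← this]
  refine Finset.sum_congr rfl fun i _ => ?_
  rw [blockInc, Nat.cast_sub (hmono l (mem_Ici.2 (by positivity)) (mem_Ici.2 (by positivity))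
    (by gcongr; linarith))]
  simp

lemma memLp_blockInc (H : ∀ᵐ ω ∂P, D.IsRescaledAt Nbar ω) (h_pos : ∀ n, 1 ≤ n → 0 < h n)
    (hN : IsPointProcess P Nbar) (hstat : HasStationaryIncrements P Nbar) (l : Fin 2) (ℓ : ℕ)
    {q : ℕ} (hq : q ≠ 0) (hB1 : D.B1 P q) : MemLp (blockInc Nbar l ℓ 0) q P := by
  have h1 : MemLp (fun ω => ∑ i ∈ Finset.Ico 0 ℓ, blockInc Nbar l 1 i ω) q P :=
    memLp_finsetSum _ fun i _ => (identDistrib_blockInc hN hstat l 1 i).memLp_iff.2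
      (memLp_blockInc_one H h_pos hN hq hB1)
  refine (memLp_congr_ae ?_).1 h1
  filter_upwards [H] with ω H
  have hle : Nbar l 0 ω ≤ Nbar l ℓ ω :=
    H.mono l (mem_Ici.2 le_rfl) (mem_Ici.2 (by positivity)) (by positivity)
  rw [sum_blockInc_one H.mono l (Nat.zero_le ℓ)]
  simp [blockInc, Nat.cast_sub hle]

lemma isBlockFunctional_blockInc (H : ∀ᵐ ω ∂P, D.IsRescaledAt Nbar ω)
    (h_pos : ∀ n, 1 ≤ n → 0 < h n) (hN : IsPointProcess P Nbar)
    (hstat : HasStationaryIncrements P Nbar) (hB1 : ∀ q : ℝ, 0 < q → D.B1 P q) (l : Fin 2) :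
    IsBlockFunctional P Nbar (blockInc Nbar l) where
  meas ℓ b := by
    have := measurable_comp_window (Nbar := Nbar) (measurable_windowCount_real ℓ l) ℓ b
    simpa only [← blockInc_eq_windowCount] using this
  ident := identDistrib_blockInc hN hstat l
  nonneg := blockInc_nonneg l
  moments ℓ q := by
    rcases eq_or_ne q 0 with rfl | hq
    · simp
    · have := (memLp_blockInc H h_pos hN hstat l ℓ hq
        (hB1 q (by exact_mod_cast Nat.pos_of_ne_zero hq))).integrable_norm_pow'
      simpa [abs_of_nonneg (blockInc_nonneg (Nbar := Nbar) l ℓ 0 _)] using this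

lemma windowTrace_nonneg (p ℓ : ℕ) (c : ℚ × Fin 2 → ℤ) : 0 ≤ windowTrace p ℓ c := by
  have h : ∀ k₁ k₂ i j, 0 ≤ windowMatrix ℓ k₁ k₂ c i j := fun _ _ _ _ =>
    overlapRatio_nonneg _ _ _ _
  unfold windowTrace
  set G := windowMatrix ℓ (windowCount ℓ 0 c - 1) (windowCount ℓ 1 c - 1) c
  exact Finset.sum_nonneg fun i _ => pow_nonneg_apply (A := G * Gᵀ)
    (mul_nonneg_apply (h _ _) fun i j => h _ _ j i) p i i

/-- Moments follow by domination: the window trace is at most the number of first-component points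
in the window plus 1. -/
lemma isBlockFunctional_blockTrace (H : ∀ᵐ ω ∂P, D.IsRescaledAt Nbar ω)
    (h_pos : ∀ n, 1 ≤ n → 0 < h n) (hN : IsPointProcess P Nbar)
    (hstat : HasStationaryIncrements P Nbar) (hB1 : ∀ q : ℝ, 0 < q → D.B1 P q) (p : ℕ) :
    IsBlockFunctional P Nbar (blockTrace Nbar p) where
  meas ℓ b := measurable_comp_window (measurable_windowTrace p ℓ) ℓ b
  ident ℓ b := hstat.identDistrib_comp_window hN (measurable_windowTrace p ℓ) ℓ b
  nonneg ℓ b ω := windowTrace_nonneg _ _ _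
  moments ℓ q := by
    rcases eq_or_ne q 0 with rfl | hq
    · simp
    have hm : Measurable (blockTrace Nbar p ℓ 0) :=
      (measurable_comp_window (Nbar := Nbar) (measurable_windowTrace p ℓ) ℓ 0).mono
        (hN.incrementSigma_le (Icc_subset_Ici_self.trans (Ici_subset_Ici.2 (by positivity)))) le_rfl
    have h1 : MemLp (fun ω => blockInc Nbar 0 ℓ 0 ω + 1) q P :=
      (memLp_blockInc H h_pos hN hstat 0 ℓ hq
        (hB1 q (by exact_mod_cast Nat.pos_of_ne_zero hq))).add (memLp_const 1)
    have h2 : MemLp (blockTrace Nbar p ℓ 0) q P := by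
      refine h1.mono' hm.aestronglyMeasurable ?_
      filter_upwards [H] with ω H
      have hle : Nbar 0 0 ω ≤ Nbar 0 ℓ ω :=
        H.mono 0 (mem_Ici.2 le_rfl) (mem_Ici.2 (by positivity)) (by positivity)
      have h3 := (H.traceCum_local (n := ℓ + 1) (by omega) p (le_refl (0 : ℝ)) (ℓ := ℓ)
        (by push_cast; linarith)).1
      have h4 := (H.traceCum_bound (n := ℓ + 1) (by omega) p (le_refl (0 : ℝ))
        (y := 0 + ℓ) (by simp) (by push_cast; linarith)).2
      rw [Real.norm_of_nonneg (show 0 ≤ blockTrace Nbar p ℓ 0 ω from windowTrace_nonneg _ _ _)]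
      simp only [blockTrace, blockInc, Nat.cast_zero, zero_mul, zero_add, one_mul,
        Nat.cast_sub hle] at h3 h4 ⊢
      linarith
    have := h2.integrable_norm_pow'
    simpa [abs_of_nonneg (windowTrace_nonneg p ℓ _), blockTrace] using this

/-- Gap probabilities decay at every polynomial rate. -/
lemma exists_gap_bound {P : Measure Ω} {q : ℝ} (hB2 : D.B2 P q) :
    ∃ C u₀ : ℝ, 0 < C ∧ 1 ≤ u₀ ∧ ∀ u, u₀ ≤ u → ∀ n : ℕ, 1 ≤ n → ∀ l : Fin 2,
      ∀ t ∈ Icc 0 (n * h n - u * h n),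
        P {ω | D.count n l (t + u * h n) ω - D.count n l t ω = 0}
          ≤ ENNReal.ofReal (C / u ^ q) := by
  obtain ⟨c, hc1, hc2⟩ := exists_between (show _ < ∞ from hB2)
  obtain ⟨u₁, hu₁⟩ := eventually_atTop.1 (eventually_lt_of_limsup_lt hc1)
  refine ⟨c.toReal + 1, max u₁ 1, by positivity, le_max_right _ _, fun u hu n hn l t ht => ?_⟩
  have hu0 : 0 < u := lt_of_lt_of_le one_pos ((le_max_right _ _).trans hu)
  have h1 : ENNReal.ofReal (u ^ q) * P {ω | D.count n l (t + u * h n) ω - D.count n l t ω = 0}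
      ≤ c := by
    have h2 := (hu₁ u ((le_max_left _ _).trans hu)).le
    simp only [iSup_le_iff] at h2
    exact h2 n hn l t ht
  have huq : 0 < u ^ q := Real.rpow_pos_of_pos hu0 q
  rw [ENNReal.ofReal_div_of_pos huq, ENNReal.le_div_iff_mul_le
    (Or.inl (by simpa using huq)) (Or.inl ENNReal.ofReal_ne_top), mul_comm]
  exact h1.trans ((ENNReal.ofReal_toReal hc2.ne).ge.trans
    (ENNReal.ofReal_le_ofReal (by linarith)))

/-- The value `1/8` leaves room for a union of four gap events, two components times two adjacent
intervals. -/
lemma exists_gap_le_eighth {P : Measure Ω} (hB2 : D.B2 P 1) : ∃ u : ℕ, 1 ≤ u ∧ ∀ n : ℕ, 1 ≤ n → ∀ l : Fin 2,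
    ∀ t ∈ Icc 0 (n * h n - u * h n),
      P {ω | D.count n l (t + u * h n) ω - D.count n l t ω = 0} ≤ ENNReal.ofReal (1 / 8) := by
  obtain ⟨C, u₀, hC, hu₀, hb⟩ := exists_gap_bound hB2
  obtain ⟨u, hu⟩ := exists_nat_ge (max u₀ (8 * C))
  have hu1 : u₀ ≤ u := (le_max_left _ _).trans hu
  have hu2 : 8 * C ≤ u := (le_max_right _ _).trans hu
  have hu3 : (1 : ℝ) ≤ u := hu₀.trans hu1
  refine ⟨u, by exact_mod_cast hu3, fun n hn l t ht => (hb u hu1 n hn l t ht).trans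
    (ENNReal.ofReal_le_ofReal ?_)⟩
  rw [Real.rpow_one, div_le_div_iff₀ (by linarith) (by norm_num)]
  linarith

/-- A functional which is positive off an event of probability less than one has positive mean. -/
lemma integral_pos_of_measure_lt_one {Y : Ω → ℝ} (hY0 : ∀ ω, 0 ≤ Y ω) (hY : Integrable Y P)
    {E : Set Ω} (hE : P E < 1) (h : ∀ᵐ ω ∂P, ω ∉ E → 0 < Y ω) : 0 < ∫ ω, Y ω ∂P := by
  rw [integral_pos_iff_support_of_nonneg hY0 hY, pos_iff_ne_zero]
  intro h0
  have h1 : P (univ : Set Ω) ≤ P E := by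
    refine measure_mono_ae ?_
    have h2 : ∀ᵐ ω ∂P, Y ω = 0 := by
      rw [ae_iff]
      exact h0
    filter_upwards [h, h2] with ω h3 h4 _
    by_contra hω
    exact (h3 hω).ne' h4
  rw [measure_univ] at h1
  exact absurd h1 (not_le.2 hE)

lemma exists_integral_blockInc_pos (H : ∀ᵐ ω ∂P, D.IsRescaledAt Nbar ω)
    (h_pos : ∀ n, 1 ≤ n → 0 < h n) {l : Fin 2} (hI : IsBlockFunctional P Nbar (blockInc Nbar l))
    (hB2 : D.B2 P 1) : ∃ ℓ : ℕ, 1 ≤ ℓ ∧ 0 < ∫ ω, blockInc Nbar l ℓ 0 ω ∂P := by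
  obtain ⟨u, hu, hgap⟩ := exists_gap_le_eighth hB2
  have hh := h_pos (u + 1) (by omega)
  refine ⟨u, hu, integral_pos_of_measure_lt_one (hI.nonneg u 0) (hI.integrable u 0)
    (lt_of_le_of_lt (hgap (u + 1) (by omega) l 0 ⟨le_rfl, ?_⟩) ?_) ?_⟩
  · push_cast
    nlinarith
  · rw [← ENNReal.ofReal_one, ENNReal.ofReal_lt_ofReal_iff one_pos]
    norm_num
  · filter_upwards [H] with ω H hω
    have e1 := H.count_mul (n := u + 1) (l := l) (by omega) (x := u) (by positivity)
      (by push_cast; linarith)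
    have e0 := H.count_mul (n := u + 1) (l := l) (by omega) (le_refl (0 : ℝ)) (by positivity)
    rw [zero_mul] at e0
    change ¬ (_ = 0) at hω
    rw [zero_add, e1, e0] at hω
    simp only [blockInc, Nat.cast_zero, zero_mul, zero_add, one_mul]
    exact_mod_cast Nat.pos_of_ne_zero hω

/-- The intervals of the two components straddling time `u` overlap just after `u`, and points on
both sides of `u` make them complete in the window. For `p = 1` the trace is a sum of squared
overlap ratios, so this one entry makes it positive. -/
lemma SamplingScheme.IsRescaledAt.blockTrace_one_pos {ω : Ω} (H : D.IsRescaledAt Nbar ω) {u : ℕ}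
    (hu : 1 ≤ u) (h0 : ∀ l, Nbar l 0 ω < Nbar l u ω)
    (h1 : ∀ l, Nbar l u ω < Nbar l (2 * u : ℕ) ω) : 0 < blockTrace Nbar 1 (2 * u) 0 ω := by
  set n := 2 * u + 1 with hn_def
  have hn : 1 ≤ n := by omega
  have hh := H.h_pos n hn
  have hun : (u : ℝ) < n := by rw [hn_def]; exact_mod_cast (by omega : u < 2 * u + 1)
  have hW : ∀ l, D.IsWindowOf n l ω 0 (2 * u) (window Nbar (2 * u) 0 ω) (Nbar l 0 ω)
      (Nbar l (2 * u : ℕ) ω - Nbar l 0 ω) := fun l => by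
    have := H.isWindowOf hn l (le_refl (0 : ℝ)) (ℓ := 2 * u)
      (by rw [zero_add, hn_def]; exact_mod_cast (by omega : 2 * u < 2 * u + 1))
    rwa [zero_add] at this
  have hiff : ∀ l, ∀ i ≤ D.M n l ω, D.S n l i ω ≤ u * h n ↔ i ≤ Nbar l u ω := fun l i hi => by
    rw [D.S_le_iff_le_count hn (by positivity) hi, H.count_mul hn (by positivity) hun]
  have hlt : ∀ l, Nbar l u ω < D.M n l ω := fun l => by
    have := (hW l).le_M
    have := h0 l
    have := h1 l
    omega
  have hpos : 0 < D.G n ω ⟨Nbar 0 u ω, hlt 0⟩ ⟨Nbar 1 u ω, hlt 1⟩ := by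
    have hS : ∀ l, D.S n l (Nbar l u ω) ω ≤ u * h n ∧ u * h n < D.S n l (Nbar l u ω + 1) ω :=
      fun l => ⟨(hiff l _ (hlt l).le).2 le_rfl, by
        by_contra hcon
        have := (hiff l _ (hlt l)).1 (not_lt.1 hcon)
        omega⟩
    rw [D.G_apply, overlapRatio]
    refine div_pos (lt_max_of_lt_left (sub_pos.2 ?_)) (mul_pos
      (D.sqrtLen_pos hn ⟨Nbar 0 u ω, hlt 0⟩) (D.sqrtLen_pos hn ⟨Nbar 1 u ω, hlt 1⟩))
    exact (max_le (hS 0).1 (hS 1).1).trans_lt (lt_min (hS 0).2 (hS 1).2)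
  have hmem : ∀ l, (⟨Nbar l u ω, hlt l⟩ : Fin (D.M n l ω)) ∈
      range (SamplingScheme.windowEmb (hW l).le_M) := fun l => by
    rw [SamplingScheme.mem_range_windowEmb]
    have := h0 l
    have := h1 l
    simp only
    omega
  obtain ⟨i, hi⟩ := hmem 0
  obtain ⟨j, hj⟩ := hmem 1
  have hbt : blockTrace Nbar 1 (2 * u) 0 ω
      = ∑ i, ∑ j, (D.G n ω).submatrix (SamplingScheme.windowEmb (hW 0).le_M)
          (SamplingScheme.windowEmb (hW 1).le_M) i j ^ 2 := by
    simp only [blockTrace, Nat.cast_zero, zero_mul]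
    rw [windowTrace, (hW 0).windowCount_eq, (hW 1).windowCount_eq,
      (hW 0).windowMatrix_eq hh (hW 1), pow_one, Matrix.trace]
    refine Finset.sum_congr rfl fun i _ => ?_
    rw [Matrix.diag, Matrix.mul_apply]
    exact Finset.sum_congr rfl fun j _ => by rw [Matrix.transpose_apply, sq]
  rw [hbt]
  refine Finset.sum_pos' (fun i _ => Finset.sum_nonneg fun j _ => sq_nonneg _)
    ⟨i, Finset.mem_univ _, Finset.sum_pos' (fun j _ => sq_nonneg _) ⟨j, Finset.mem_univ _, ?_⟩⟩
  rw [Matrix.submatrix_apply, hi, hj]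
  exact pow_pos hpos 2

lemma exists_integral_blockTrace_pos (H : ∀ᵐ ω ∂P, D.IsRescaledAt Nbar ω)
    (h_pos : ∀ n, 1 ≤ n → 0 < h n) (hZ : IsBlockFunctional P Nbar (blockTrace Nbar 1))
    (hB2 : D.B2 P 1) : ∃ ℓ : ℕ, 1 ≤ ℓ ∧ 0 < ∫ ω, blockTrace Nbar 1 ℓ 0 ω ∂P := by
  obtain ⟨u, hu, hgap⟩ := exists_gap_le_eighth hB2
  set n := 2 * u + 1 with hn_def
  have hn : 1 ≤ n := by omega
  have hh := h_pos n hn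
  have hnr : (n : ℝ) = 2 * u + 1 := by rw [hn_def]; push_cast; ring
  set E : Fin 2 → ℝ → Set Ω := fun l t =>
    {ω | D.count n l (t + u * h n) ω - D.count n l t ω = 0} with hE
  have hEle : ∀ l t, t ∈ Icc 0 (n * h n - u * h n) → P (E l t) ≤ ENNReal.ofReal (1 / 8) :=
    fun l t ht => hgap n hn l t ht
  have huh : 0 ≤ u * h n := by positivity
  have ht0 : (0 : ℝ) ∈ Icc 0 (n * h n - u * h n) := ⟨le_rfl, by rw [hnr]; nlinarith⟩
  have htu : u * h n ∈ Icc 0 (n * h n - u * h n) := ⟨huh, by rw [hnr]; nlinarith⟩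
  refine ⟨2 * u, by omega, integral_pos_of_measure_lt_one (hZ.nonneg (2 * u) 0)
    (hZ.integrable (2 * u) 0)
    (E := (E 0 0 ∪ E 1 0) ∪ (E 0 (u * h n) ∪ E 1 (u * h n))) ?_ ?_⟩
  · calc P ((E 0 0 ∪ E 1 0) ∪ (E 0 (u * h n) ∪ E 1 (u * h n)))
        ≤ (P (E 0 0) + P (E 1 0)) + (P (E 0 (u * h n)) + P (E 1 (u * h n))) :=
          (measure_union_le _ _).trans (add_le_add (measure_union_le _ _) (measure_union_le _ _))
      _ ≤ (ENNReal.ofReal (1 / 8) + ENNReal.ofReal (1 / 8))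
          + (ENNReal.ofReal (1 / 8) + ENNReal.ofReal (1 / 8)) := by
          gcongr <;> apply hEle <;> assumption
      _ < 1 := by
          rw [← ENNReal.ofReal_add (by norm_num) (by norm_num),
            ← ENNReal.ofReal_add (by norm_num) (by norm_num), ← ENNReal.ofReal_one,
            ENNReal.ofReal_lt_ofReal_iff one_pos]
          norm_num
  · filter_upwards [H] with ω H hω
    simp only [mem_union, not_or] at hω
    have c0 : ∀ l, D.count n l 0 ω = Nbar l 0 ω := fun l => by
      simpa using H.count_mul (l := l) hn (le_refl (0 : ℝ)) (by rw [hnr]; positivity)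
    have c1 : ∀ l, D.count n l (u * h n) ω = Nbar l u ω := fun l =>
      H.count_mul hn (by positivity) (by rw [hnr]; linarith [(Nat.cast_nonneg u : (0 : ℝ) ≤ u)])
    have c2 : ∀ l, D.count n l (u * h n + u * h n) ω = Nbar l (2 * u : ℕ) ω := fun l => by
      have e : (u : ℝ) * h n + u * h n = ((2 * u : ℕ) : ℝ) * h n := by push_cast; ring
      rw [e]
      exact H.count_mul hn (by positivity) (by rw [hnr]; push_cast; linarith)
    have key0 : ∀ l, ω ∉ E l 0 → Nbar l 0 ω < Nbar l u ω := fun l hl => by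
      change ¬ (_ = 0) at hl
      rw [zero_add, c0, c1] at hl
      omega
    have key1 : ∀ l, ω ∉ E l (u * h n) → Nbar l u ω < Nbar l (2 * u : ℕ) ω := fun l hl => by
      change ¬ (_ = 0) at hl
      rw [c1, c2] at hl
      omega
    refine H.blockTrace_one_pos hu (fun l => ?_) (fun l => ?_)
    · fin_cases l
      · exact key0 0 hω.1.1
      · exact key0 1 hω.1.2
    · fin_cases l
      · exact key1 0 hω.2.1
      · exact key1 1 hω.2.2

end Moments

/-! ### The mesh, the quadratic forms and tightness -/

section Mesh

namespace SamplingScheme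

variable {P : Measure Ω} [IsProbabilityMeasure P] {Nbar : Fin 2 → ℝ → Ω → ℕ} {h : ℕ → ℝ}
  {D : SamplingScheme Ω h}

/-- An interval longer than `2 η` would contain a whole grid cell, hence an observation time
strictly between its consecutive endpoints. -/
lemma len_le_of_grid {n : ℕ} (hn : 1 ≤ n) {l : Fin 2} {ω : Ω} {η : ℝ} (hη : 0 < η)
    (hg : ∀ j : ℕ, (j + 1) * η ≤ n * h n → D.count n l (j * η) ω < D.count n l ((j + 1) * η) ω)
    (i : Fin (D.M n l ω)) : D.len n l ω i ≤ 2 * η := by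
  by_contra hcon
  rw [len, not_le] at hcon
  have hS0 := D.S_nonneg (l := l) (ω := ω) hn i.2.le
  have hS1 := D.S_le_horizon (l := l) (ω := ω) hn i.2
  set j := ⌈D.S n l i ω / η⌉₊ with hj
  have h1 : D.S n l i ω ≤ j * η := by
    rw [← div_le_iff₀ hη]
    exact Nat.le_ceil _
  have h2 : (j + 1) * η < D.S n l (i + 1) ω := by
    have := Nat.ceil_lt_add_one (div_nonneg hS0 hη.le)
    rw [← hj, ← sub_lt_iff_lt_add, lt_div_iff₀ hη] at this
    linarith
  have h3 := hg j (by linarith)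
  set m := D.count n l ((j + 1) * η) ω with hm
  have hmM : m ≤ D.M n l ω := D.count_le _
  have h4 : D.S n l m ω ≤ (j + 1) * η := (D.S_le_iff_le_count hn (by positivity) hmM).2 le_rfl
  have h5 : j * η < D.S n l m ω := by
    by_contra hc
    have := (D.S_le_iff_le_count hn (by positivity) hmM).1 (not_lt.1 hc)
    omega
  have h6 : (i : ℕ) < m := by
    by_contra hc
    have := D.S_le_of_le (l := l) (ω := ω) hn (not_lt.1 hc) i.2.le
    linarith
  have := D.S_le_of_le (l := l) (ω := ω) hn h6 hmM
  linarith

/-- With probability tending to one, all observation intervals are short. -/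
lemma exists_len_le {P : Measure Ω} (h_pos : ∀ n, 1 ≤ n → 0 < h n) (h_zero : Tendsto h atTop (𝓝 0))
    (h_rate : ∃ κ : ℝ, 0 < κ ∧ Tendsto (fun n : ℕ => n * h n ^ κ) atTop (𝓝 0))
    (hB2 : ∀ q : ℝ, 0 < q → D.B2 P q) {ε : ℝ} (hε : 0 < ε) :
    ∃ E : ℕ → Set Ω, Tendsto (fun n => P (E n)) atTop (𝓝 0) ∧
      ∀ n, 1 ≤ n → ∀ ω ∉ E n, ∀ l i, D.len n l ω i ≤ ε := by
  obtain ⟨κ, hκ, hrate⟩ := h_rate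
  -- Order `κ` suffices: at most `n h_n / η` grid cells, each empty with probability at most `C (h_n
  -- / η) ^ κ`, give a bound of order `n h_n ^ κ * h_n`.
  obtain ⟨C, u₀, hC, hu₀, hb⟩ := exists_gap_bound (hB2 κ hκ)
  set η := ε / 2 with hη_def
  have hη : 0 < η := by positivity
  set bad : ℕ → Fin 2 → ℕ → Set Ω := fun n l j =>
    {ω | D.count n l ((j + 1) * η) ω - D.count n l (j * η) ω = 0} with hbad
  refine ⟨fun n => ⋃ x ∈ (Finset.univ : Finset (Fin 2)) ×ˢ Finset.range ⌊n * h n / η⌋₊,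
    bad n x.1 x.2, ?_, fun n hn ω hω l i => ?_⟩
  · have hlim : Tendsto (fun n : ℕ => ENNReal.ofReal (2 * C / η ^ (κ + 1) * ((n * h n ^ κ) * h n)))
        atTop (𝓝 0) := by
      have := ENNReal.tendsto_ofReal ((hrate.mul h_zero).const_mul (2 * C / η ^ (κ + 1)))
      simpa using this
    refine tendsto_of_tendsto_of_tendsto_of_le_of_le' tendsto_const_nhds hlim
      (Eventually.of_forall fun n => zero_le) ?_
    have hsmall : ∀ᶠ n in atTop, h n < η / u₀ := h_zero.eventually (gt_mem_nhds (by positivity))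
    filter_upwards [hsmall, eventually_ge_atTop 1] with n hs hn
    have hh := h_pos n hn
    have hu : u₀ ≤ η / h n := by
      rw [le_div_iff₀ hh]
      rw [lt_div_iff₀ (by linarith)] at hs
      linarith
    have hbd : ∀ x ∈ (Finset.univ : Finset (Fin 2)) ×ˢ Finset.range ⌊n * h n / η⌋₊,
        P (bad n x.1 x.2) ≤ ENNReal.ofReal (C / (η / h n) ^ κ) := by
      intro x hx
      have hxj : (x.2 : ℝ) + 1 ≤ n * h n / η := by
        have h1 := Finset.mem_range.1 (Finset.mem_product.1 hx).2
        have h2 := Nat.floor_le (by positivity : 0 ≤ n * h n / η)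
        have h3 : (x.2 : ℝ) + 1 ≤ (⌊n * h n / η⌋₊ : ℕ) := by exact_mod_cast h1
        exact h3.trans h2
      rw [le_div_iff₀ hη] at hxj
      have e : η / h n * h n = η := div_mul_cancel₀ _ hh.ne'
      have := hb (η / h n) hu n hn x.1 (x.2 * η) ⟨by positivity, by rw [e]; linarith⟩
      rw [e] at this
      simpa only [hbad, add_mul, one_mul] using this
    refine (measure_biUnion_finset_le _ _).trans ((Finset.sum_le_card_nsmul _ _ _ hbd).trans ?_)
    rw [Finset.card_product, Finset.card_univ, Fintype.card_fin, Finset.card_range, nsmul_eq_mul,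
      ← ENNReal.ofReal_natCast, ← ENNReal.ofReal_mul (by positivity)]
    refine ENNReal.ofReal_le_ofReal ?_
    push_cast
    have h1 := Nat.floor_le (by positivity : 0 ≤ n * h n / η)
    calc 2 * ((⌊n * h n / η⌋₊ : ℕ) : ℝ) * (C / (η / h n) ^ κ)
        ≤ 2 * (n * h n / η) * (C / (η / h n) ^ κ) := by gcongr
      _ = _ := by
        rw [Real.div_rpow hη.le hh.le, Real.rpow_add hη, Real.rpow_one]
        have := Real.rpow_pos_of_pos hη κ
        have := Real.rpow_pos_of_pos hh κ
        field_simp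
  · have hh := h_pos n hn
    have : D.len n l ω i ≤ 2 * η := by
      refine len_le_of_grid hn hη (fun j hj => ?_) i
      by_contra hcon
      refine hω (mem_biUnion (x := (l, j)) (Finset.mem_product.2 ⟨Finset.mem_univ _,
        Finset.mem_range.2 (Nat.lt_of_succ_le (Nat.le_floor ?_))⟩) (Nat.sub_eq_zero_of_le (not_lt.1 hcon)))
      rw [le_div_iff₀ hη]
      push_cast
      exact hj
    linarith

theorem a2_of_gap_bounds {P : Measure Ω} (h_pos : ∀ n, 1 ≤ n → 0 < h n) (h_zero : Tendsto h atTop (𝓝 0))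
    (h_rate : ∃ κ : ℝ, 0 < κ ∧ Tendsto (fun n : ℕ => n * h n ^ κ) atTop (𝓝 0))
    (hB2 : ∀ q : ℝ, 0 < q → D.B2 P q) : D.A2 P := by
  rw [A2, tendstoInMeasure_iff_norm]
  intro ε hε
  obtain ⟨E, hE, hlen⟩ := exists_len_le h_pos h_zero h_rate hB2 (half_pos hε)
  refine tendsto_of_tendsto_of_tendsto_of_le_of_le' tendsto_const_nhds hE
    (Eventually.of_forall fun n => zero_le) ?_
  filter_upwards [eventually_ge_atTop 1] with n hn
  refine measure_mono fun ω hω => ?_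
  by_contra hcon
  have h1 : D.mesh n ω ≤ ε / 2 := Real.iSup_le
    (fun l => Real.iSup_le (fun i => hlen n hn ω hcon l i) (half_pos hε).le) (half_pos hε).le
  have h2 : 0 ≤ D.mesh n ω :=
    Real.iSup_nonneg fun l => Real.iSup_nonneg fun i => (D.len_pos hn i).le
  have h3 : ε ≤ ‖D.mesh n ω - 0‖ := hω
  rw [sub_zero, Real.norm_of_nonneg h2] at h3
  linarith

/-- The lengths telescope to the last observation time not exceeding `t`. -/
lemma sum_len_indicator {n : ℕ} (hn : 1 ≤ n) {l : Fin 2} {ω : Ω} {t : ℝ} (ht : 0 ≤ t) :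
    ∑ i : Fin (D.M n l ω), (if D.S n l (i + 1) ω ≤ t then D.len n l ω i else 0)
      = D.S n l (D.count n l t ω) ω := by
  have h1 : ∀ i : Fin (D.M n l ω), (if D.S n l (i + 1) ω ≤ t then D.len n l ω i else 0)
      = if (i : ℕ) < D.count n l t ω then D.S n l (i + 1) ω - D.S n l i ω else 0 := fun i =>
    if_congr (D.S_le_iff_le_count hn ht i.2) rfl rfl
  rw [Finset.sum_congr rfl fun i _ => h1 i, Fin.sum_univ_eq_sum_range (fun i =>
    if i < D.count n l t ω then D.S n l (i + 1) ω - D.S n l i ω else 0) (D.M n l ω),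
    ← Finset.sum_filter]
  have h2 : (Finset.range (D.M n l ω)).filter (fun i => i < D.count n l t ω)
      = Finset.range (D.count n l t ω) := by
    ext i
    have := D.count_le (n := n) (l := l) (ω := ω) t
    simp only [Finset.mem_filter, Finset.mem_range]
    omega
  rw [h2, Finset.sum_range_sub (fun i => D.S n l i ω), D.S_zero n hn, sub_zero]

lemma sub_S_count_mem {n : ℕ} (hn : 1 ≤ n) {l : Fin 2} {ω : Ω} {ε : ℝ} (hε : 0 ≤ ε)
    (hlen : ∀ i, D.len n l ω i ≤ ε) {t : ℝ} (ht : 0 ≤ t) (htn : t ≤ n * h n) :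
    0 ≤ t - D.S n l (D.count n l t ω) ω ∧ t - D.S n l (D.count n l t ω) ω ≤ ε := by
  have hM := D.count_le (n := n) (l := l) (ω := ω) t
  have h1 := (D.S_le_iff_le_count hn ht hM).2 le_rfl
  refine ⟨by linarith, ?_⟩
  rcases hM.eq_or_lt with hM | hM
  · rw [hM, D.S_last n hn]
    linarith
  · have h2 : t < D.S n l (D.count n l t ω + 1) ω := by
      by_contra hc
      have := (D.S_le_iff_le_count hn ht hM).1 (not_lt.1 hc)
      omega
    have h3 := hlen ⟨D.count n l t ω, hM⟩
    simp only [len] at h3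
    linarith

/-- The form `𝔍_l^⊤ ℰ^l_{(k)} 𝔍_l` is the total length of the intervals ending in the cell. -/
lemma abs_sqrtLen_form_sub_le {n : ℕ} (hn : 1 ≤ n) {l : Fin 2} {ω : Ω} {ε : ℝ} (hε : 0 ≤ ε)
    (hlen : ∀ i, D.len n l ω i ≤ ε) {s : ℕ → ℝ} {k : ℕ} (hs0 : 0 ≤ s (k - 1))
    (hs : s (k - 1) ≤ s k) (hsn : s k ≤ n * h n) :
    |D.sqrtLen n l ω ⬝ᵥ D.blockMatrix s n l k ω *ᵥ D.sqrtLen n l ω - (s k - s (k - 1))| ≤ ε := by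
  have e : D.sqrtLen n l ω ⬝ᵥ D.blockMatrix s n l k ω *ᵥ D.sqrtLen n l ω
      = D.S n l (D.count n l (s k) ω) ω - D.S n l (D.count n l (s (k - 1)) ω) ω := by
    rw [← sum_len_indicator hn hs0, ← sum_len_indicator hn (hs0.trans hs),
      ← Finset.sum_sub_distrib]
    refine Finset.sum_congr rfl fun i _ => ?_
    rw [blockMatrix, Matrix.mulVec_diagonal]
    have hsq : D.sqrtLen n l ω i * D.sqrtLen n l ω i = D.len n l ω i :=
      Real.mul_self_sqrt (D.len_pos hn i).le
    by_cases h1 : D.S n l (i + 1) ω ≤ s (k - 1)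
    · simp [h1, h1.trans hs, not_lt.2 h1]
    · by_cases h2 : D.S n l (i + 1) ω ≤ s k
      · simp [h1, h2, not_le.1 h1, hsq]
      · simp [h1, h2]
  have h1 := sub_S_count_mem hn hε hlen hs0 (hs.trans hsn)
  have h2 := sub_S_count_mem hn hε hlen (hs0.trans hs) hsn
  rw [e, abs_le]
  constructor <;> linarith [h1.1, h1.2, h2.1, h2.2]

lemma GTG_mulVec_sqrtLen {n : ℕ} {ω : Ω} (hn : 1 ≤ n) :
    ((D.G n ω)ᵀ * D.G n ω) *ᵥ D.sqrtLen n 1 ω = D.sqrtLen n 1 ω := by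
  rw [← Matrix.mulVec_mulVec, D.G_mulVec_sqrtLen hn, D.transpose_G_mulVec_sqrtLen hn]

/-- Powers of `G Gᵀ` and `Gᵀ G` fix the square-root length vectors and `G` exchanges them, so every
form reduces to its case `p = 0` and all constants can be taken equal to 1. -/
theorem a5_of_gap_bounds {P : Measure Ω} (h_pos : ∀ n, 1 ≤ n → 0 < h n) (h_zero : Tendsto h atTop (𝓝 0))
    (h_rate : ∃ κ : ℝ, 0 < κ ∧ Tendsto (fun n : ℕ => n * h n ^ κ) atTop (𝓝 0))
    (hB2 : ∀ q : ℝ, 0 < q → D.B2 P q) : D.A5 P := by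
  have key : ∀ (l : Fin 2) (s : ℕ → ℝ), IsPartition s → ∀ Y : ℕ → ℕ → Ω → ℝ,
      (∀ n, 1 ≤ n → ∀ k ω, Y n k ω
        = D.sqrtLen n l ω ⬝ᵥ D.blockMatrix s n l k ω *ᵥ D.sqrtLen n l ω) →
      BlockConv P h s Y 1 := by
    intro l s hs Y hY
    refine blockConv_of_eventually_bound fun ε hε => ?_
    obtain ⟨E, hE, hlen⟩ := exists_len_le h_pos h_zero h_rate hB2 hε
    refine ⟨E, hE, ?_⟩
    filter_upwards [eventually_ge_atTop 1] with n hn ω hω k hk hkq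
    have hh := h_pos n hn
    have hs0 : 0 ≤ s (k - 1) := by
      have := hs.strictMono.monotone (Nat.zero_le (k - 1))
      rwa [hs.1] at this
    rw [hY n hn, one_mul]
    exact abs_sqrtLen_form_sub_le hn hε.le (hlen n hn ω hω l) hs0
      (hs.strictMono.monotone (Nat.sub_le k 1))
      ((hs.strictMono.monotone hkq).trans (hs.lastIndex_spec (by positivity)))
  refine fun p => ⟨1, 1, 1, zero_le_one, zero_le_one, zero_le_one, fun s hs =>
    ⟨key 0 s hs _ fun n hn k ω => ?_, key 0 s hs _ fun n hn k ω => ?_,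
      key 1 s hs _ fun n hn k ω => ?_⟩⟩
  · rw [← Matrix.mulVec_mulVec, pow_mulVec_eq (D.GGT_mulVec_sqrtLen hn)]
  · rw [← Matrix.mulVec_mulVec, D.G_mulVec_sqrtLen hn, ← Matrix.mulVec_mulVec,
      pow_mulVec_eq (D.GGT_mulVec_sqrtLen hn)]
  · rw [← Matrix.mulVec_mulVec, pow_mulVec_eq (GTG_mulVec_sqrtLen hn)]

lemma blockCount_eq_sum (s : ℕ → ℝ) (n : ℕ) (l : Fin 2) (k : ℕ) (ω : Ω) :
    (D.blockCount s n l k ω : ℝ) = ∑ i : Fin (D.M n l ω),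
      if s (k - 1) < D.S n l (i + 1) ω ∧ D.S n l (i + 1) ω ≤ s k then (1 : ℝ) else 0 := by
  classical
  rw [blockCount, Set.ncard_eq_toFinset_card', Finset.sum_boole]
  congr 2
  ext i
  simp

lemma blockCount_eq_sub {s : ℕ → ℝ} {n : ℕ} (hh : 0 < h n) {k : ℕ} (hs : s (k - 1) ≤ s k)
    (l : Fin 2) (ω : Ω) : (D.blockCount s n l k ω : ℝ)
      = D.count n l (s k / h n * h n) ω - D.count n l (s (k - 1) / h n * h n) ω := by
  rw [count_sub_eq_sum hh.le (by gcongr), blockCount_eq_sum, div_mul_cancel₀ _ hh.ne',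
    div_mul_cancel₀ _ hh.ne']

lemma blockMatrix_trace_eq_sub {s : ℕ → ℝ} {n : ℕ} (hh : 0 < h n) {k : ℕ} (hs : s (k - 1) ≤ s k)
    (p : ℕ) (ω : Ω) : (D.blockMatrix s n 0 k ω * (D.G n ω * (D.G n ω)ᵀ) ^ p).trace
      = D.traceCum p n (s k / h n) ω - D.traceCum p n (s (k - 1) / h n) ω := by
  rw [traceCum_sub hh.le p (by gcongr), div_mul_cancel₀ _ hh.ne', div_mul_cancel₀ _ hh.ne',
    Matrix.trace]
  refine Finset.sum_congr rfl fun i _ => ?_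
  rw [Matrix.diag, blockMatrix, Matrix.diagonal_mul]
  simp [indicator_apply]

lemma _root_.NonsyncSampling.BlockConv.congr {P : Measure Ω} {s : ℕ → ℝ} {Y Y' : ℕ → ℕ → Ω → ℝ} {a : ℝ}
    (hY : BlockConv P h s Y a) (hYY' : ∀ n, 1 ≤ n → ∀ k ω, Y n k ω = Y' n k ω) :
    BlockConv P h s Y' a := by
  rw [BlockConv, tendstoInMeasure_iff_norm] at hY ⊢
  intro ε hε
  refine (hY ε hε).congr' ?_
  filter_upwards [eventually_ge_atTop 1] with n hn
  simp only [hYY' n hn]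

/-- The incomplete last cell has length at most 1, so it is covered by the last `⌈1 / h_n⌉` unit
blocks before `n`. Their expected count times `h_n` is bounded, and Markov's inequality applies. -/
lemma isPTight_blockCount (h_pos : ∀ n, 1 ≤ n → 0 < h n) (h_zero : Tendsto h atTop (𝓝 0))
    (H : ∀ᵐ ω ∂P, D.IsRescaledAt Nbar ω) {l : Fin 2}
    (hI : IsBlockFunctional P Nbar (blockInc Nbar l)) {s : ℕ → ℝ} (hs : IsPartition s) :
    IsPTight P fun n ω => h n * D.blockCount s n l (lastIndex h s n + 1) ω := by
  set m := ∫ ω, blockInc Nbar l 1 0 ω ∂P with hm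
  have hm0 : 0 ≤ m := integral_nonneg fun ω => hI.nonneg 1 0 ω
  -- Tightness is required for every `n ≥ 1`, so `h` must be bounded and not only eventually small.
  obtain ⟨A, hA⟩ := h_zero.bddAbove_range
  have hA' : ∀ n, h n ≤ A := fun n => hA (mem_range_self n)
  have hA0 : 0 < A := (h_pos 1 le_rfl).trans_le (hA' 1)
  -- Truncated subtraction starts the range at 0 when the whole horizon is shorter than the cell
  -- bound; the `+ 1` is the observation at the horizon.
  set W : ℕ → Ω → ℝ := fun n ω =>
    h n * (∑ b ∈ Finset.Ico (n - ⌈(h n)⁻¹⌉₊) n, blockInc Nbar l 1 b ω + 1) with hW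
  have hWint : ∀ n, Integrable (W n) P := fun n =>
    ((integrable_finsetSum _ fun b _ => hI.integrable 1 b).add (integrable_const 1)).const_mul _
  have hW0 : ∀ n, 1 ≤ n → ∀ ω, 0 ≤ W n ω := fun n hn ω =>
    mul_nonneg (h_pos n hn).le (add_nonneg (Finset.sum_nonneg fun b _ => hI.nonneg 1 b ω)
      zero_le_one)
  have hWE : ∀ n, 1 ≤ n → ∫ ω, W n ω ∂P ≤ m + A * (m + 1) := by
    intro n hn
    have hh := h_pos n hn
    have e : ∫ ω, W n ω ∂P = h n * ((n - (n - ⌈(h n)⁻¹⌉₊) : ℕ) * m + 1) := by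
      rw [hW, integral_const_mul, integral_add (integrable_finsetSum _ fun b _ => hI.integrable 1 b)
        (integrable_const 1), integral_finsetSum _ fun b _ => hI.integrable 1 b,
        Finset.sum_congr rfl fun b _ => (hI.ident 1 b).integral_eq]
      simp [hm]
    have h1 : ((n - (n - ⌈(h n)⁻¹⌉₊) : ℕ) : ℝ) ≤ (h n)⁻¹ + 1 := by
      have : ((n - (n - ⌈(h n)⁻¹⌉₊) : ℕ) : ℝ) ≤ (⌈(h n)⁻¹⌉₊ : ℕ) := by
        exact_mod_cast (by omega : n - (n - ⌈(h n)⁻¹⌉₊) ≤ ⌈(h n)⁻¹⌉₊)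
      exact this.trans (Nat.ceil_lt_add_one (by positivity)).le
    rw [e]
    calc h n * (((n - (n - ⌈(h n)⁻¹⌉₊) : ℕ) : ℝ) * m + 1)
        ≤ h n * (((h n)⁻¹ + 1) * m + 1) := by gcongr
      _ = m + h n * (m + 1) := by field_simp; ring
      _ ≤ m + A * (m + 1) := by
        have := hA' n
        gcongr
  have hle : ∀ n, 1 ≤ n → ∀ᵐ ω ∂P,
      |h n * D.blockCount s n l (lastIndex h s n + 1) ω| ≤ W n ω := by
    intro n hn
    have hh := h_pos n hn
    filter_upwards [H] with ω H
    rw [abs_of_nonneg (by positivity)]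
    refine mul_le_mul_of_nonneg_left ?_ hh.le
    set k := lastIndex h s n with hk
    have hsk : s k ≤ n * h n := hs.lastIndex_spec (by positivity)
    have hsk1 : n * h n < s (k + 1) := hs.lt_lastIndex_succ n
    have hsk0 : 0 ≤ s k := by
      have := hs.strictMono.monotone (Nat.zero_le k)
      rwa [hs.1] at this
    have hstep := hs.2.1 k
    have hb := blockCount_eq_sub (D := D) hh (s := s) (k := k + 1)
      (hs.strictMono.monotone (Nat.sub_le _ _)) l ω
    rw [Nat.add_sub_cancel] at hb
    rw [hb]
    -- The cell extends past the horizon, where there are no observations.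
    have hlast : D.count n l (s (k + 1) / h n * h n) ω ≤ D.count n l (n * h n) ω := by
      rw [div_mul_cancel₀ _ hh.ne']
      refine (D.count_le _).trans ?_
      exact (D.S_le_iff_le_count hn (by positivity) le_rfl).1 (D.S_last n hn l ω).le
    have hx : s k / h n ≤ n := by rwa [div_le_iff₀ hh]
    have h1 := H.count_sub_le hn (l := l) (x := s k / h n) (y := n) (by positivity) hx le_rfl
    have hxn : ((n - ⌈(h n)⁻¹⌉₊ : ℕ) : ℝ) ≤ s k / h n := by
      have h2 : (n : ℝ) - (h n)⁻¹ ≤ s k / h n := by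
        rw [sub_le_iff_le_add, ← one_div, ← add_div, le_div_iff₀ hh]
        linarith
      rcases le_total n ⌈(h n)⁻¹⌉₊ with hc | hc
      · rw [Nat.sub_eq_zero_of_le hc, Nat.cast_zero]
        positivity
      · rw [Nat.cast_sub hc]
        linarith [Nat.le_ceil (h n)⁻¹]
    have h3 : Nbar l ((n - ⌈(h n)⁻¹⌉₊ : ℕ) : ℝ) ω ≤ Nbar l (s k / h n) ω :=
      H.mono l (mem_Ici.2 (by positivity)) (mem_Ici.2 (by positivity)) hxn
    have h3' : (Nbar l ((n - ⌈(h n)⁻¹⌉₊ : ℕ) : ℝ) ω : ℝ) ≤ Nbar l (s k / h n) ω := by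
      exact_mod_cast h3
    have h4 : (D.count n l (s (k + 1) / h n * h n) ω : ℝ) ≤ D.count n l (n * h n) ω := by
      exact_mod_cast hlast
    rw [sum_blockInc_one H.mono l (Nat.sub_le _ _)]
    linarith
  intro ε hε
  obtain ⟨δ, hδ0, hδ⟩ : ∃ δ : ℝ, 0 < δ ∧ ENNReal.ofReal δ ≤ ε := by
    obtain ⟨r, hr0, hr⟩ := ENNReal.lt_iff_exists_nnreal_btwn.1 hε
    exact ⟨r, by exact_mod_cast hr0, by simpa using hr.le⟩
  set K := (m + A * (m + 1)) / δ with hK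
  have hnum : 0 < m + A * (m + 1) := by positivity
  have hK0 : 0 < K := by positivity
  refine ⟨K, fun n hn => le_trans ?_ hδ⟩
  have h1 : P {ω | K < |h n * D.blockCount s n l (lastIndex h s n + 1) ω|} ≤ P {ω | K ≤ W n ω} :=
    measure_mono_ae <| (hle n hn).mono fun ω hω (hlt : K < _) => hlt.le.trans hω
  refine h1.trans ?_
  rw [← ofReal_measureReal (measure_ne_top _ _)]
  refine ENNReal.ofReal_le_ofReal ?_
  have h2 := mul_meas_ge_le_integral_of_nonneg (ae_of_all _ (hW0 n hn)) (hWint n) K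
  have h3 : K * P.real {ω | K ≤ W n ω} ≤ K * δ := by
    refine (h2.trans (hWE n hn)).trans (le_of_eq ?_)
    rw [hK, div_mul_cancel₀ _ hδ0.ne']
  exact le_of_mul_le_mul_left h3 hK0

end SamplingScheme

end Mesh

end

end NonsyncSampling

/-! ### Conclusions (A2), (A4) and (A5). -/

theorem mainTheorem7 {Ω : Type*} [MeasurableSpace Ω] (P : Measure Ω) [IsProbabilityMeasure P]
    (h : ℕ → ℝ) (h_pos : ∀ n, 1 ≤ n → 0 < h n)
    (h_zero : Tendsto h atTop (𝓝 0))
    (h_horizon : Tendsto (fun n : ℕ => n * h n) atTop atTop)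
    (h_rate : ∃ κ : ℝ, 0 < κ ∧ Tendsto (fun n : ℕ => n * h n ^ κ) atTop (𝓝 0))
    (Nbar : Fin 2 → ℝ → Ω → ℕ)
    (hN : NonsyncSampling.IsPointProcess P Nbar)
    (hstat : NonsyncSampling.HasStationaryIncrements P Nbar)
    (hmix : NonsyncSampling.IsExpAlphaMixing P Nbar)
    (D : NonsyncSampling.SamplingScheme Ω h)
    (hD : D.IsRescaling P Nbar)
    (hB1 : ∀ q : ℝ, 0 < q → D.B1 P q)
    (hB2 : ∀ q : ℝ, 0 < q → D.B2 P q) :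
    D.A2 P ∧ (∃ (a₀ : Fin 2 → ℝ) (a : ℕ → ℝ), D.A4 P a₀ a ∧ 0 < a 1) ∧ D.A5 P := by
  open NonsyncSampling SamplingScheme in
  have H := D.ae_isRescaledAt h_pos hN hD
  have hI := isBlockFunctional_blockInc H h_pos hN hstat hB1
  have hT := isBlockFunctional_blockTrace H h_pos hN hstat hB1
  have hcount := fun l => (isNearlyLocal_count H l).exists_blockConv h_pos h_zero h_rate hN hmix
    (hI l) (hI l) le_rfl
  have htrace := fun p => (isNearlyLocal_traceCum H p).exists_blockConv h_pos h_zero h_rate hN hmix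
    (hI 0) (hT p) (by positivity)
  choose a₀ ha₀ hle₀ hconv₀ using hcount
  choose a ha hle hconv using htrace
  -- The slope times `ℓ` dominates the window mean for each `ℓ ≥ 1`, so a single positive mean
  -- forces a positive slope.
  have pos_of : ∀ {b e : ℝ} {ℓ : ℕ}, 0 ≤ b → 0 < e → e ≤ b * ℓ → 0 < b := fun hb he hbe =>
    lt_of_le_of_ne hb fun h0 => by
      rw [← h0, zero_mul] at hbe
      exact absurd he (not_lt.2 hbe)
  have hcell : ∀ {s : ℕ → ℝ}, IsPartition s → ∀ k, s (k - 1) ≤ s k := fun hs k =>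
    hs.strictMono.monotone (Nat.sub_le k 1)
  refine ⟨a2_of_gap_bounds h_pos h_zero h_rate hB2, ⟨a₀, a, ⟨fun l => ⟨?_, fun s hs => ⟨?_, ?_⟩⟩,
    fun p _ => ⟨ha p, fun s hs => ?_⟩⟩, ?_⟩, a5_of_gap_bounds h_pos h_zero h_rate hB2⟩
  · obtain ⟨ℓ, hℓ, hp⟩ := exists_integral_blockInc_pos H h_pos (hI l) (hB2 1 one_pos)
    exact pos_of (ha₀ l) hp (hle₀ l ℓ hℓ)
  · exact isPTight_blockCount h_pos h_zero H (hI l) hs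
  · exact (hconv₀ l s hs).congr fun n hn k ω => by
      rw [blockCount_eq_sub (h_pos n hn) (hcell hs k)]
  · exact (hconv p s hs).congr fun n hn k ω => by
      rw [blockMatrix_trace_eq_sub (h_pos n hn) (hcell hs k)]
  · obtain ⟨ℓ, hℓ, hp⟩ := exists_integral_blockTrace_pos H h_pos (hT 1) (hB2 1 one_pos)
    exact pos_of (ha 1) hp (hle 1 ℓ hℓ)
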